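/- **Theorem 4.1.** Graphs are finite and may have multiple edges or loops. A signed graph $(G,\sigma)$ is a graph $G$ together with a signature $\sigma\colon E(G)\to\{+1,-1\}$. Each edge consists of two half-edges, one at each of its ends (both at the same vertex if the edge is a loop). An orientation of $(G,\sigma)$ is a map $\tau$ from the set of half-edges to $\{+1,-1\}$ such that $\tau(h)\tau(h')=-\sigma(e)$ for the two half-edges $h,h'$ of each edge $e$. For an integer $k\ge 2$, a nowhere-zero $k$-flow on $(G,\sigma)$ is a pair $(\tau,f)$, where $\tau$ is an orientation of $(G,\sigma)$ and $f\colon E(G)\to\mathbb{Z}$ satisfies $0<|f(e)|<k$ for every edge $e$ and $\sum_{h\in H(v)}\tau(h)f(e_h)=0$ for every vertex $v$; here $H(v)$ is the set of half-edges incident with $v$ and $e_h$ is the edge containing $h$. The signed graph $(G,\sigma)$ is flow-admissible if it admits a nowhere-zero $k$-flow for some integer $k\ge 2$. Let $(G,\sigma)$ be a flow-admissible signed graph whose underlying graph $G$ is cubic (every vertex is incident with exactly three half-edges) and $3$-edge-colourable (the edges can be coloured with three colours so that distinct half-edges at the same vertex belong to edges of different colours; in particular $G$ has no loops). Then $(G,\sigma)$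 admits a nowhere-zero $8$-flow. -/

import Mathlib

namespace Graph

universe u v

/-- The half-edges of a multigraph, as triples (edge, end vertex, tag). A non-loop edge `e = uv`
has the two half-edges `(e, u, false)` and `(e, v, false)`; a loop `e` at `u` has the two
half-edges `(e, u, false)` and `(e, u, true)`. -/
def HalfEdge {α : Type u} {β : Type v} (G : Graph α β) : Type (max u v) :=
  {h : β × α × Bool // G.Inc h.1 h.2.1 ∧ (h.2.2 = true → G.IsLoopAt h.1 h.2.1)}

/-- The edge to which a half-edge belongs. -/
def HalfEdge.edge {α : Type u} {β : Type v} {G : Graph α β} (h : G.HalfEdge) : G.edgeSet :=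
  ⟨h.1.1, h.2.1.edge_mem⟩

/-- The vertex with which a half-edge is incident. -/
def HalfEdge.vertex {α : Type u} {β : Type v} {G : Graph α β} (h : G.HalfEdge) : α :=
  h.1.2.1

/-- The set `H(x)` of half-edges incident with the vertex `x`. -/
def halfEdgesAt {α : Type u} {β : Type v} (G : Graph α β) (x : α) : Set G.HalfEdge :=
  {h | h.vertex = x}

/-- Every vertex has degree three (a loop contributes two to the degree of its end). -/
def IsCubic {α : Type u} {β : Type v} (G : Graph α β) : Prop :=
  ∀ x ∈ G.vertexSet, (G.halfEdgesAt x).ncard = 3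

/-- There is a proper edge-colouring with `n` colours: any two different half-edges at a common
vertex belong to edges of different colours. In particular a loop, which is adjacent to itself,
cannot be coloured. -/
def EdgeColorable {α : Type u} {β : Type v} (G : Graph α β) (n : ℕ) : Prop :=
  ∃ c : G.edgeSet → Fin n, ∀ h h' : G.HalfEdge,
    h ≠ h' → h.vertex = h'.vertex → c h.edge ≠ c h'.edge

/-- `τ` is an orientation of the signed graph `(G, σ)`: the product of the values of `τ` on the
two half-edges of any edge `e` is `-σ e`. -/
def IsOrientation {α : Type u} {β : Type v} (G : Graph α β) (σ : G.edgeSet → ℤˣ)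
    (τ : G.HalfEdge → ℤˣ) : Prop :=
  ∀ h h' : G.HalfEdge, h ≠ h' → h.edge = h'.edge → τ h * τ h' = -σ h.edge

/-- `(τ, f)` satisfies the conservation law at every vertex (for finite graphs, where the
sum below is a genuine finite sum). -/
def IsIntFlow {α : Type u} {β : Type v} (G : Graph α β) (τ : G.HalfEdge → ℤˣ)
    (f : G.edgeSet → ℤ) : Prop :=
  ∀ x ∈ G.vertexSet, ∑ᶠ h ∈ G.halfEdgesAt x, (τ h : ℤ) * f h.edge = 0

/-- The signed graph `(G, σ)` admits a nowhere-zero `k`-flow, for an integer `k ≥ 2`. -/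
def HasNowhereZeroFlow {α : Type u} {β : Type v} (G : Graph α β) (σ : G.edgeSet → ℤˣ)
    (k : ℕ) : Prop :=
  2 ≤ k ∧ ∃ (τ : G.HalfEdge → ℤˣ) (f : G.edgeSet → ℤ),
    G.IsOrientation σ τ ∧ G.IsIntFlow τ f ∧ (∀ e, f e ≠ 0) ∧ ∀ e, |f e| < (k : ℤ)

/-- The signed graph `(G, σ)` admits a nowhere-zero `k`-flow for some integer `k ≥ 2`. -/
def FlowAdmissible {α : Type u} {β : Type v} (G : Graph α β) (σ : G.edgeSet → ℤˣ) : Prop :=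
  ∃ k : ℕ, G.HasNowhereZeroFlow σ k

end Graph

/-! ### Fixed-point-free involutions and the circuits they generate. -/

namespace SignedCubic

open Finset

/-! Record a flow by its outgoing values at half-edges. A proper 3-edge-colouring turns the graph
into three fixed-point-free involutions `S.c i`, and crossing an edge multiplies the value by the
sign `S.s i`; "negative" refers to this sign. A two-coloured circuit carries a flow with values `±1`
when its product of signs is `1` (`Bal`). By pigeonhole two colours have the same parity of negative
edges, and these may be called 0 and 1.

If all three parities agree, `exists_join` yields two flows with values in `{0, ±1, ±2}`, and the
first plus three times the second is an 8-flow. Otherwise a Kempe change on an unbalanced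
0-1-circuit would make all parities agree, so without an 8-flow all 0-1-circuits are balanced
(`Connected.bal`). Two unbalanced 0-2-circuits would give an 8-flow `f + 2φ + 4ψ`
(`Connected.unique_unbalanced`), so there is just one, called `D`.

After switching, colours 0 and 1 (`r` and `b`) have trivial signs. It then suffices to find an
integer flow `(lam - y, -lam, y)` with `0 < |y| ≤ 3` on colour 2 (`t`) and with `lam` and `lam - y`
confined, on each `r`-`b`-circuit, to a window of eight consecutive integers: double it and add an
odd constant around each such circuit (`Cfg.Solved`). Begin with `±1` on every `r`-`t`-circuit
except `D`. Unbalancedness lets `D` absorb a demand of two units at any one of its `r`-edges. These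
units travel through alternating `r`-`b`- and `r`-`t`-circuits (`Stage.hasPath_hasPair_hasSpec`).
Growing this collection from a root on `D`, either two contacts with a new circuit have conflicting
signs and absorb the two units, or the orientation signs `κ` extend consistently
(`solved_or_exists_good`).

In the consistent case, delete the `t`-edges of `D`. On every remaining component `κ` cancels the
two end values of each edge. The given flow is nonzero on every `t`-edge of `D`; summing it against
`κ` shows that each such edge needs a component whose signs are inconsistent with `D` cut there
(`exists_not_cons`). A minimal family of such components behaves like a cover by intervals with at
most two overlapping, and counting overlaps gives a potential on `D` of size 1 to 3
(`Cover.exists_potential`). Its jumps are realised by single or double paths inside the components;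
three alternating signs in one component are instead served by a pair of unit paths
(`Chart.solved_of_alternating`). -/

/-- A fixed-point-free involution. -/
structure FPF {V : Type*} (p : V → V) : Prop where
  inv : ∀ v, p (p v) = v
  ne : ∀ v, p v ≠ v

/-- `v` can be reached from `u` by applying `p` and `q` repeatedly. -/
def Conn {V : Type*} (p q : V → V) : V → V → Prop :=
  Relation.ReflTransGen (fun a c => c = p a ∨ c = q a)

section Basic

variable {V : Type*} {p q : V → V}

theorem FPF.inj (hp : FPF p) : Function.Injective p :=
  fun a b h => by rw [← hp.inv a, h, hp.inv]

theorem Conn.refl (v : V) : Conn p q v v := Relation.ReflTransGen.refl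

theorem Conn.trans {u v w : V} (h : Conn p q u v) (h' : Conn p q v w) : Conn p q u w :=
  Relation.ReflTransGen.trans h h'

theorem Conn.left (v : V) : Conn p q v (p v) := Relation.ReflTransGen.single (Or.inl rfl)

theorem Conn.right (v : V) : Conn p q v (q v) := Relation.ReflTransGen.single (Or.inr rfl)

theorem Conn.closed {P : V → Prop} (hp : ∀ v, P v → P (p v)) (hq : ∀ v, P v → P (q v)) {u v : V}
    (h : Conn p q u v) (hu : P u) : P v := by
  induction h with
  | refl => exact hu
  | tail _ h ih => rcases h with rfl | rfl; exacts [hp _ ih, hq _ ih]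

theorem Conn.symm (hp : FPF p) (hq : FPF q) {u v : V} (h : Conn p q u v) : Conn p q v u := by
  induction h with
  | refl => exact Conn.refl _
  | @tail b c _ h ih =>
    rcases h with rfl | rfl
    · have := Conn.left (q := q) (p := p) (p b)
      rw [hp.inv] at this
      exact this.trans ih
    · have := Conn.right (q := q) (p := p) (q b)
      rw [hq.inv] at this
      exact this.trans ih

theorem Conn.swap {u v : V} (h : Conn p q u v) : Conn q p u v :=
  h.closed (P := fun w => Conn q p u w) (fun _ hv => hv.trans (Conn.right _))
    (fun _ hv => hv.trans (Conn.left _)) (Conn.refl _)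

/-- In the dihedral group generated by `p` and `q`, `p ∘ (q ∘ p)^n` is a reflection, conjugate to
`p` or to `q`, hence has no fixed point. Each two-step induction strips one conjugation. -/
theorem iterate_comp_ne (hp : FPF p) (hq : FPF q) (n : ℕ) : ∀ u, p u ≠ (fun x => q (p x))^[n] u := by
  induction n using Nat.twoStepInduction with
  | zero => exact fun u => hp.ne u
  | one => exact fun u h => hq.ne (p u) h.symm
  | more n ih _ =>
    intro u h
    apply ih (q (p u))
    rw [Function.iterate_succ_apply', Function.iterate_succ_apply] at h
    have h2 : q (p u) = p ((fun x => q (p x))^[n] (q (p u))) := by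
      have := congrArg q h
      rwa [hq.inv] at this
    have h3 := congrArg p h2
    rwa [hp.inv] at h3

/-- A parametrization of the orbit of `v₀` under two fixed-point-free involutions as a circuit of
length `2 * m`, with `p` and `q` alternating. -/
structure IsCircuit (p q : V → V) (v₀ : V) (m : ℕ) (a : ℕ → V) (idx : V → ℕ) : Prop where
  pos : 0 < m
  zero : a 0 = v₀
  left : ∀ i, p (a (2 * i)) = a (2 * i + 1)
  right : ∀ i, q (a (2 * i + 1)) = a (2 * i + 2)
  last : a (2 * m) = v₀
  idx_a : ∀ i < 2 * m, idx (a i) = i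
  idx_lt : ∀ u, Conn p q v₀ u → idx u < 2 * m
  a_idx : ∀ u, Conn p q v₀ u → a (idx u) = u
  conn : ∀ i, Conn p q v₀ (a i)

/-- The orbit of `v₀` under `q ∘ p`, of minimal period `m`, is interleaved with its image under `p`.
The two halves are disjoint by `iterate_comp_ne`, and the resulting list is closed under both
involutions. -/
theorem exists_isCircuit [Finite V] (hp : FPF p) (hq : FPF q) (v₀ : V) :
    ∃ m a idx, IsCircuit p q v₀ m a idx := by
  classical
  set π : V → V := fun x => q (p x) with hπ
  have hinj : Function.Injective π := hq.inj.comp hp.inj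
  have hper : v₀ ∈ Function.periodicPts π := hinj.mem_periodicPts v₀
  set m := Function.minimalPeriod π v₀ with hm
  have hmpos : 0 < m := Function.minimalPeriod_pos_of_mem_periodicPts hper
  have hmp : π^[m] v₀ = v₀ := Function.isPeriodicPt_minimalPeriod π v₀
  have hiter : ∀ i < m, ∀ j < m, π^[i] v₀ = π^[j] v₀ → i = j := fun i hi j hj h =>
    Function.iterate_injOn_Iio_minimalPeriod hi hj h
  let a : ℕ → V := fun n => if n % 2 = 0 then π^[n / 2] v₀ else p (π^[n / 2] v₀)
  have ha0 : ∀ i, a (2 * i) = π^[i] v₀ := fun i => by simp [a]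
  have ha1 : ∀ i, a (2 * i + 1) = p (π^[i] v₀) := fun i => by
    have : (2 * i + 1) / 2 = i := by omega
    simp [a, this]
  have hne : ∀ i j, p (π^[i] v₀) ≠ π^[j] v₀ := by
    intro i j h
    rcases le_total i j with hij | hij
    · obtain ⟨d, rfl⟩ := Nat.exists_eq_add_of_le hij
      rw [Nat.add_comm, Function.iterate_add_apply] at h
      exact iterate_comp_ne hp hq d _ h
    · obtain ⟨d, rfl⟩ := Nat.exists_eq_add_of_le hij
      rw [Nat.add_comm, Function.iterate_add_apply] at h
      apply iterate_comp_ne hp hq d (π^[j] v₀)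
      have h2 := congrArg p h
      rw [hp.inv] at h2
      exact h2.symm
  have hainj : ∀ i < 2 * m, ∀ j < 2 * m, a i = a j → i = j := by
    intro i hi j hj h
    rcases Nat.even_or_odd' i with ⟨k, rfl | rfl⟩ <;> rcases Nat.even_or_odd' j with ⟨l, rfl | rfl⟩
    · rw [ha0, ha0] at h
      rw [hiter k (by omega) l (by omega) h]
    · rw [ha0, ha1] at h
      exact absurd h.symm (hne _ _)
    · rw [ha1, ha0] at h
      exact absurd h (hne _ _)
    · rw [ha1, ha1] at h
      rw [hiter k (by omega) l (by omega) (hp.inj h)]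
  have hleft : ∀ i, p (a (2 * i)) = a (2 * i + 1) := fun i => by rw [ha0, ha1]
  have hright : ∀ i, q (a (2 * i + 1)) = a (2 * i + 2) := fun i => by
    rw [show 2 * i + 2 = 2 * (i + 1) by ring, ha0, ha1, Function.iterate_succ_apply']
  have hlast : a (2 * m) = v₀ := by rw [ha0, hmp]
  have hsurj : ∀ u, Conn p q v₀ u → ∃ i, i < 2 * m ∧ a i = u := by
    intro u hu
    refine hu.closed (P := fun u => ∃ i, i < 2 * m ∧ a i = u) ?_ ?_ ⟨0, by omega, by simp [a]⟩
    · rintro _ ⟨i, hi, rfl⟩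
      rcases Nat.even_or_odd' i with ⟨k, rfl | rfl⟩
      · exact ⟨2 * k + 1, by omega, (hleft k).symm⟩
      · exact ⟨2 * k, by omega, by rw [← hleft, hp.inv]⟩
    · rintro _ ⟨i, hi, rfl⟩
      rcases Nat.even_or_odd' i with ⟨k, rfl | rfl⟩
      · rcases Nat.eq_zero_or_pos k with rfl | hk
        · refine ⟨2 * m - 1, by omega, ?_⟩
          have h1 := hright (m - 1)
          have e1 : 2 * (m - 1) + 2 = 2 * m := by omega
          have e2 : 2 * (m - 1) + 1 = 2 * m - 1 := by omega
          rw [e1, e2, hlast] at h1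
          rw [Nat.mul_zero, ha0 0, Function.iterate_zero, id, ← h1, hq.inv]
        · refine ⟨2 * k - 1, by omega, ?_⟩
          have h1 := hright (k - 1)
          have e1 : 2 * (k - 1) + 2 = 2 * k := by omega
          have e2 : 2 * (k - 1) + 1 = 2 * k - 1 := by omega
          rw [e1, e2] at h1
          rw [← h1, hq.inv]
      · rcases Nat.lt_or_ge (2 * k + 2) (2 * m) with h | h
        · exact ⟨2 * k + 2, h, (hright k).symm⟩
        · refine ⟨0, by omega, ?_⟩
          have e1 : 2 * k + 2 = 2 * m := by omega
          rw [hright, e1, hlast]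
          simp [a]
  have hconn : ∀ i, Conn p q v₀ (a i) := by
    intro i
    induction i with
    | zero => simpa [a] using Conn.refl v₀
    | succ i ih =>
      rcases Nat.even_or_odd' i with ⟨k, rfl | rfl⟩
      · rw [← hleft]; exact ih.trans (Conn.left _)
      · rw [← hright]; exact ih.trans (Conn.right _)
  refine ⟨m, a, fun u => if h : ∃ i, i < 2 * m ∧ a i = u then h.choose else 0, hmpos, by simp [a],
    hleft, hright, hlast, ?_, ?_, ?_, hconn⟩
  · intro i hi
    have h : ∃ j, j < 2 * m ∧ a j = a i := ⟨i, hi, rfl⟩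
    simp only [dif_pos h]
    exact hainj _ h.choose_spec.1 _ hi h.choose_spec.2
  · intro u hu
    have h := hsurj u hu
    simp only [dif_pos h]
    exact h.choose_spec.1
  · intro u hu
    have h := hsurj u hu
    simp only [dif_pos h]
    exact h.choose_spec.2

namespace IsCircuit

variable {v₀ : V} {m : ℕ} {a : ℕ → V} {idx : V → ℕ}

theorem left' (h : IsCircuit p q v₀ m a idx) (hp : FPF p) (i : ℕ) :
    p (a (2 * i + 1)) = a (2 * i) := by
  rw [← h.left, hp.inv]

theorem right' (h : IsCircuit p q v₀ m a idx) (hq : FPF q) (i : ℕ) :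
    q (a (2 * i + 2)) = a (2 * i + 1) := by
  rw [← h.right, hq.inv]

theorem right_zero (h : IsCircuit p q v₀ m a idx) (hq : FPF q) : q (a 0) = a (2 * m - 1) := by
  have h1 := h.right' hq (m - 1)
  have hm := h.pos
  have e1 : 2 * (m - 1) + 2 = 2 * m := by omega
  have e2 : 2 * (m - 1) + 1 = 2 * m - 1 := by omega
  rw [e1, e2, h.last] at h1
  rw [h.zero, h1]

/-- Every vertex of the circuit is the first or the second end of a `p`-edge. -/
theorem cases_vertex (h : IsCircuit p q v₀ m a idx) {u : V} (hu : Conn p q v₀ u) :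
    ∃ k < m, u = a (2 * k) ∨ u = a (2 * k + 1) := by
  have h1 := h.idx_lt u hu
  have h2 := h.a_idx u hu
  rcases Nat.even_or_odd' (idx u) with ⟨k, hk | hk⟩
  · exact ⟨k, by omega, Or.inl (by rw [← hk, h2])⟩
  · exact ⟨k, by omega, Or.inr (by rw [← hk, h2])⟩

theorem inj (h : IsCircuit p q v₀ m a idx) {i j : ℕ} (hi : i < 2 * m) (hj : j < 2 * m)
    (hij : a i = a j) : i = j := by
  rw [← h.idx_a i hi, ← h.idx_a j hj, hij]

end IsCircuit

/-- Signs along a circuit that are prescribed across all edges but the `q`-edge at `v₀`. -/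
theorem exists_frame [Finite V] (hp : FPF p) (hq : FPF q) (α β : V → ℤˣ)
    (hα : ∀ v, α (p v) = α v) (hβ : ∀ v, β (q v) = β v) (v₀ : V) :
    ∃ θ : V → ℤˣ, ∀ u, Conn p q v₀ u → θ (p u) = α u * θ u ∧
      (u ≠ v₀ → u ≠ q v₀ → θ (q u) = β u * θ u) := by
  obtain ⟨m, a, idx, h⟩ := exists_isCircuit hp hq v₀
  -- `e` is the running product of signs along the parametrization; the closing `q`-edge, from
  -- position `2 * m - 1` back to `v₀`, is never imposed.
  let e : ℕ → ℤˣ := fun n => Nat.rec 1 (fun n x => (if n % 2 = 0 then α (a n) else β (a n)) * x) n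
  have e0 : ∀ i, e (2 * i + 1) = α (a (2 * i)) * e (2 * i) := fun i => by simp [e]
  have e1 : ∀ i, e (2 * i + 2) = β (a (2 * i + 1)) * e (2 * i + 1) := fun i => by
    simp [e, Nat.add_mod]
  have hm := h.pos
  refine ⟨fun u => e (idx u), fun u hu => ?_⟩
  obtain ⟨k, hk, rfl | rfl⟩ := h.cases_vertex hu
  · constructor
    · simp only [h.left]
      rw [h.idx_a _ (by omega), h.idx_a _ (by omega), e0]
    · intro h1 h2
      rcases Nat.eq_zero_or_pos k with rfl | hk0
      · exact absurd h.zero h1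
      · obtain ⟨j, rfl⟩ : ∃ j, k = j + 1 := ⟨k - 1, by omega⟩
        simp only [show 2 * (j + 1) = 2 * j + 2 by ring, h.right' hq]
        rw [h.idx_a _ (by omega), h.idx_a _ (by omega), e1, ← h.right' hq, hβ, ← mul_assoc,
          Int.units_mul_self, one_mul]
  · constructor
    · simp only [h.left' hp]
      rw [h.idx_a _ (by omega), h.idx_a _ (by omega), e0, ← h.left, hα, ← mul_assoc,
          Int.units_mul_self, one_mul]
    · intro h1 h2
      have hk' : 2 * k + 2 < 2 * m := by
        by_contra hcon
        apply h2
        have e3 : 2 * k + 1 = 2 * m - 1 := by omega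
        rw [e3, ← h.right_zero hq, h.zero]
      simp only [h.right]
      rw [h.idx_a _ (by omega), h.idx_a _ (by omega), e1]

end Basic

/-! ### Counting negative edges modulo four; the balance criterion. -/

section Count

variable {V : Type*} {p q : V → V}

/-- Both ends of an edge contribute equally to the left side, so modulo 4 only the parity of its
failure matters. That parity is the product of `α v`, `θ v` and `θ (p v)`. -/
theorem sum_defect (hp : FPF p) (N : Finset V) (hN : ∀ v ∈ N, p v ∈ N) (α θ : V → ℤˣ)
    (hα : ∀ v, α (p v) = α v) :
    (∑ v ∈ N, if θ (p v) ≠ α v * θ v then (1 : ZMod 4) else 0) =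
      ∑ v ∈ N, ((if α v = -1 then (1 : ZMod 4) else 0) + if θ v = -1 then 2 else 0) := by
  rw [← sub_eq_zero, ← Finset.sum_sub_distrib]
  refine Finset.sum_involution (fun v _ => p v) ?_ (fun v _ _ => hp.ne v) hN (fun v _ => hp.inv v)
  intro v hv
  simp only [hp.inv, hα]
  rcases Int.units_eq_one_or (α v) with h1 | h1 <;> rcases Int.units_eq_one_or (θ v) with h2 | h2 <;>
  rcases Int.units_eq_one_or (θ (p v)) with h3 | h3 <;> simp only [h1, h2, h3] <;> decide

theorem even_sum (hp : FPF p) (N : Finset V) (hN : ∀ v ∈ N, p v ∈ N) (P : V → Prop)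
    [DecidablePred P] (hP : ∀ v, P (p v) ↔ P v) :
    (∑ v ∈ N, if P v then (2 : ZMod 4) else 0) = 0 := by
  refine Finset.sum_involution (fun v _ => p v) ?_ (fun v _ _ => hp.ne v) hN (fun v _ => hp.inv v)
  intro v hv
  simp only [hP]
  split_ifs <;> decide

/-- The number of vertices of `N` with a negative sign, modulo four. -/
noncomputable def negs (N : Finset V) (α : V → ℤˣ) : ZMod 4 :=
  ∑ v ∈ N, if α v = -1 then 1 else 0

/-- Each negative edge is counted at both ends. Thus `negs` is 0 or 2 and encodes the parity of the
number of negative edges. -/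
theorem two_mul_negs (hp : FPF p) (N : Finset V) (hN : ∀ v ∈ N, p v ∈ N) (α : V → ℤˣ)
    (hα : ∀ v, α (p v) = α v) : 2 * negs N α = 0 := by
  refine Eq.trans ?_ (even_sum hp N hN (fun v => α v = -1) (fun v => by rw [hα]))
  rw [negs, Finset.mul_sum]
  exact Finset.sum_congr rfl fun v _ => by split_ifs <;> decide

/-- `sum_defect` is applied to both matchings; the terms counting `θ v = -1` are common to the two
and cancel. -/
theorem negs_of_balanced (hp : FPF p) (hq : FPF q) (N : Finset V) (hNp : ∀ v ∈ N, p v ∈ N)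
    (hNq : ∀ v ∈ N, q v ∈ N) (α β : V → ℤˣ) (hα : ∀ v, α (p v) = α v) (hβ : ∀ v, β (q v) = β v)
    (θ : V → ℤˣ) (h1 : ∀ v ∈ N, θ (p v) = α v * θ v) :
    (∑ v ∈ N, if θ (q v) ≠ β v * θ v then (1 : ZMod 4) else 0) = negs N α + negs N β := by
  have h3 := sum_defect hp N hNp α θ hα
  have h4 := sum_defect hq N hNq β θ hβ
  have h0 : (∑ v ∈ N, if θ (p v) ≠ α v * θ v then (1 : ZMod 4) else 0) = 0 :=
    Finset.sum_eq_zero fun v hv => if_neg (not_not.2 (h1 v hv))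
  rw [h0, Finset.sum_add_distrib] at h3
  rw [Finset.sum_add_distrib] at h4
  rw [h4]
  have h5 : ∑ v ∈ N, (if θ v = -1 then (2 : ZMod 4) else 0) + ∑ v ∈ N, (if θ v = -1 then 2 else 0)
      = 0 := by
    rw [← Finset.sum_add_distrib]
    exact Finset.sum_eq_zero fun v _ => by split_ifs <;> decide
  have h6 : negs N α = -∑ v ∈ N, (if θ v = -1 then (2 : ZMod 4) else 0) :=
    eq_neg_of_add_eq_zero_left h3.symm
  rw [h6, neg_eq_of_add_eq_zero_left h5, add_comm]
  rfl

/-- A `p`-`q`-circuit all of whose signs can be balanced. -/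
def Bal (p q : V → V) (α β : V → ℤˣ) (v₀ : V) : Prop :=
  ∃ ε : V → ℤˣ, ∀ u, Conn p q v₀ u → ε (p u) = α u * ε u ∧ ε (q u) = β u * ε u

theorem Bal.exists_global (hp : FPF p) (hq : FPF q) {α β : V → ℤˣ} (h : ∀ v, Bal p q α β v) :
    ∃ ε : V → ℤˣ, ∀ u, ε (p u) = α u * ε u ∧ ε (q u) = β u * ε u := by
  classical
  let S : Setoid V := ⟨Conn p q, ⟨Conn.refl, fun h => h.symm hp hq, fun h h' => h.trans h'⟩⟩
  have hrep : ∀ v, Conn p q (Quotient.mk S v).out v := fun v => Quotient.mk_out (s := S) v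
  have hl : ∀ v, Quotient.mk S (p v) = Quotient.mk S v := fun v =>
    Quotient.sound ((Conn.left v).symm hp hq)
  have hr : ∀ v, Quotient.mk S (q v) = Quotient.mk S v := fun v =>
    Quotient.sound ((Conn.right v).symm hp hq)
  choose ε hε using h
  refine ⟨fun v => ε (Quotient.mk S v).out v, fun v => ?_⟩
  simp only [hl, hr]
  exact hε _ v (hrep v)

/-- The criterion for balanced circuits. -/
theorem bal_of_negs [Fintype V] (hp : FPF p) (hq : FPF q) (α β : V → ℤˣ)
    (hα : ∀ v, α (p v) = α v) (hβ : ∀ v, β (q v) = β v) (v₀ : V) (N : Finset V)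
    (hN : ∀ v, v ∈ N ↔ Conn p q v₀ v) (h : negs N α + negs N β = 0) : Bal p q α β v₀ := by
  classical
  obtain ⟨θ, hθ⟩ := exists_frame hp hq α β hα hβ v₀
  refine ⟨θ, fun u hu => ⟨(hθ u hu).1, ?_⟩⟩
  have hNp : ∀ v ∈ N, p v ∈ N := fun v hv => (hN _).2 (((hN v).1 hv).trans (Conn.left v))
  have hNq : ∀ v ∈ N, q v ∈ N := fun v hv => (hN _).2 (((hN v).1 hv).trans (Conn.right v))
  have h1 := negs_of_balanced hp hq N hNp hNq α β hα hβ θ (fun v hv => (hθ v ((hN v).1 hv)).1)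
  -- The frame can fail only at the `q`-edge of `v₀`. Its two ends would make the number of failures
  -- 2 modulo 4, while the hypothesis makes it 0.
  have key : θ (q v₀) = β v₀ * θ v₀ := by
    by_contra hcon
    have hcon' : θ v₀ ≠ β (q v₀) * θ (q v₀) := by
      rw [hβ]
      intro h'
      apply hcon
      rw [h', ← mul_assoc, Int.units_mul_self, one_mul]
    rw [h, ← Finset.sum_subset (s₁ := {v₀, q v₀})] at h1
    · rw [Finset.sum_pair (hq.ne v₀).symm, hq.inv, if_pos hcon, if_pos hcon'] at h1
      exact absurd h1 (by decide)
    · intro v hv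
      simp only [mem_insert, mem_singleton] at hv
      rcases hv with rfl | rfl
      exacts [(hN _).2 (Conn.refl _), (hN _).2 (Conn.right _)]
    · intro v hv hv'
      simp only [mem_insert, mem_singleton, not_or] at hv'
      rw [if_neg (not_not.2 ((hθ v ((hN v).1 hv)).2 hv'.1 hv'.2))]
  by_cases h2 : u = v₀
  · rw [h2, key]
  · by_cases h3 : u = q v₀
    · rw [h3, hq.inv, hβ, key, ← mul_assoc, Int.units_mul_self, one_mul]
    · exact (hθ u hu).2 h2 h3

end Count

end SignedCubic

/-! ### Flows on two matchings completed by a join in the third. -/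

namespace SignedCubic

open Finset

section Join

variable {V : Type*} {p q t : V → V}

theorem exists_minimizer {X : Type*} (P : X → Prop) (f : X → ℕ) (h : ∃ x, P x) :
    ∃ x, P x ∧ ∀ y, P y → f x ≤ f y := by
  classical
  have h' : ∃ n, ∃ x, P x ∧ f x = n := by
    obtain ⟨x, hx⟩ := h
    exact ⟨f x, x, hx, rfl⟩
  obtain ⟨x, hx, hxn⟩ := Nat.find_spec h'
  exact ⟨x, hx, fun y hy => hxn ▸ Nat.find_min' h' ⟨y, hy, rfl⟩⟩

/-- The edges of one matching are independent: enumerate `V`, and put `1` at the earlier end and `α`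
at the later end. -/
theorem FPF.exists_sign [Finite V] (hp : FPF p) (α : V → ℤˣ) (hα : ∀ v, α (p v) = α v) :
    ∃ ζ : V → ℤˣ, ∀ v, ζ (p v) = α v * ζ v := by
  classical
  obtain ⟨n, ⟨e⟩⟩ := Finite.exists_equiv_fin V
  refine ⟨fun v => if e v < e (p v) then 1 else α v, fun v => ?_⟩
  have hne : e (p v) ≠ e v := fun h => hp.ne v (e.injective h)
  simp only [hp.inv, hα]
  rcases lt_or_gt_of_ne hne with h | h
  · rw [if_pos h, if_neg (not_lt.2 h.le), Int.units_mul_self]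
  · rw [if_pos h, if_neg (not_lt.2 h.le), mul_one]

/-- Reachability along `p`-edges, `q`-edges, and those `t`-edges whose ends satisfy `Z`. -/
def Reach (p q t : V → V) (Z : V → Prop) : V → V → Prop :=
  Relation.ReflTransGen (fun a c => c = p a ∨ c = q a ∨ (Z a ∧ c = t a))

/-- The sign function that is negative at `x` only. -/
noncomputable def flip (x : V) : V → ℤˣ := fun w => by classical exact if w = x then -1 else 1

theorem flip_self (x : V) : flip x x = -1 := by simp [flip]

theorem flip_of_ne {x w : V} (h : w ≠ x) : flip x w = 1 := by simp [flip, h]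

theorem flip_apply_comm (hp : FPF p) (x w : V) : flip x (p w) = flip (p x) w := by
  by_cases h : w = p x
  · rw [h, hp.inv, flip_self, flip_self]
  · rw [flip_of_ne h, flip_of_ne]
    rintro rfl
    exact h (hp.inv w).symm

/-- The defect of a sign function `ξ` at a `q`-edge. -/
def defect (q : V → V) (β ξ : V → ℤˣ) (w : V) : ℤˣ := β w * ξ w * ξ (q w)

/-- The sign function that is negative at the two ends of the `q`-edge at `x`. -/
noncomputable def flipEdge (q : V → V) (x w : V) : ℤˣ := flip x w * flip x (q w)

theorem flipEdge_right (hq : FPF q) (x w : V) : flipEdge q (q x) w = flipEdge q x w := by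
  rw [flipEdge, flipEdge, flip_apply_comm hq, hq.inv, mul_comm, flip_apply_comm hq]

theorem defect_mul_flip (q : V → V) (β ξ : V → ℤˣ) (x y w : V) :
    defect q β (fun u => ξ u * (flip x u * flip y u)) w =
      defect q β ξ w * (flipEdge q x w * flipEdge q y w) := by
  simp only [defect, flipEdge]
  ac_rfl

/-- Along the path, `ζ` is negated at both ends of each `p`-edge and `χ` at both ends of each
`t`-edge, which respects their constraints. The changes of defect telescope, leaving only the
`q`-edges at the two ends of the path; a `q`-step costs nothing because `flipEdge` is the same at
both ends of a `q`-edge. -/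
theorem reach_modify (hp : FPF p) (hq : FPF q) (ht : FPF t) (α β : V → ℤˣ) (Z : V → Prop)
    (hZ : ∀ v, Z v → Z (t v)) (χ ζ : V → ℤˣ) (hχ : ∀ v, χ (t v) = χ v)
    (hζ : ∀ v, ζ (p v) = α v * ζ v) {v u : V} (h : Reach p q t Z v u) :
    ∃ χ' ζ' : V → ℤˣ, (∀ w, χ' (t w) = χ' w) ∧ (∀ w, ζ' (p w) = α w * ζ' w) ∧
      (∀ w, ¬ Z w → χ' w = χ w) ∧
      ∀ w, defect q β (fun x => χ' x * ζ' x) w =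
        defect q β (fun x => χ x * ζ x) w * (flipEdge q v w * flipEdge q u w) := by
  induction h with
  | refl => exact ⟨χ, ζ, hχ, hζ, fun _ _ => rfl, fun w => by rw [Int.units_mul_self, mul_one]⟩
  | @tail b c _ h ih =>
    obtain ⟨χ', ζ', h1, h2, h3, h4⟩ := ih
    have cancel : ∀ w d, defect q β (fun x => χ x * ζ x) w * (flipEdge q v w * flipEdge q b w) *
        (flipEdge q b w * d) = defect q β (fun x => χ x * ζ x) w * (flipEdge q v w * d) := by
      intro w d
      have := Int.units_mul_self (flipEdge q b w)
      calc _ = defect q β (fun x => χ x * ζ x) w * (flipEdge q v w * d) *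
            (flipEdge q b w * flipEdge q b w) := by ac_rfl
        _ = _ := by rw [this, mul_one]
    rcases h with rfl | rfl | ⟨hb, rfl⟩
    · refine ⟨χ', fun w => ζ' w * (flip b w * flip (p b) w), h1, fun w => ?_, h3, fun w => ?_⟩
      · beta_reduce
        rw [h2, flip_apply_comm hp, flip_apply_comm hp, hp.inv]
        ac_rfl
      · have := defect_mul_flip q β (fun x => χ' x * ζ' x) b (p b) w
        rw [h4, cancel] at this
        rw [← this]
        simp only [mul_assoc]
    · refine ⟨χ', ζ', h1, h2, h3, fun w => ?_⟩
      rw [h4, flipEdge_right hq]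
    · refine ⟨fun w => χ' w * (flip b w * flip (t b) w), ζ', fun w => ?_, h2, fun w hw => ?_,
        fun w => ?_⟩
      · beta_reduce
        rw [h1, flip_apply_comm ht, flip_apply_comm ht, ht.inv]
        ac_rfl
      · have e1 : w ≠ b := fun h => hw (h ▸ hb)
        have e2 : w ≠ t b := fun h => hw (h ▸ hZ _ hb)
        beta_reduce
        rw [h3 w hw, flip_of_ne e1, flip_of_ne e2, mul_one, mul_one]
      · have := defect_mul_flip q β (fun x => χ' x * ζ' x) b (t b) w
        rw [h4, cancel] at this
        rw [← this]
        simp only [defect]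
        ac_rfl

/-- Since `χ` is constant on `t`-edges, it contributes 0 modulo 4, and the count reduces to `negs α
+ negs β`. Both ends of a defective edge are counted, so the number of defective edges is even. -/
theorem card_defect [Fintype V] (hp : FPF p) (hq : FPF q) (ht : FPF t) (α β χ ζ : V → ℤˣ)
    (hα : ∀ v, α (p v) = α v) (hβ : ∀ v, β (q v) = β v) (hpar : negs univ α + negs univ β = 0)
    (hχ : ∀ v, χ (t v) = χ v) (hζ : ∀ v, ζ (p v) = α v * ζ v) :
    4 ∣ (univ.filter fun v => defect q β (fun x => χ x * ζ x) v = -1).card := by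
  classical
  rw [← ZMod.natCast_eq_zero_iff, Finset.card_filter, Nat.cast_sum]
  have h1 := sum_defect hp univ (fun _ _ => mem_univ _) α ζ hα
  have h2 := sum_defect hq univ (fun _ _ => mem_univ _) β (fun x => χ x * ζ x) hβ
  have h0 : (∑ v, if ζ (p v) ≠ α v * ζ v then (1 : ZMod 4) else 0) = 0 :=
    Finset.sum_eq_zero fun v _ => if_neg (not_not.2 (hζ v))
  have h3 := even_sum ht univ (fun _ _ => mem_univ _) (fun v => χ v = -1) (fun v => by rw [hχ])
  rw [h0, Finset.sum_add_distrib] at h1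
  rw [Finset.sum_add_distrib] at h2
  have h4 : (∑ v, if χ v * ζ v = -1 then (2 : ZMod 4) else 0) =
      (∑ v, if χ v = -1 then (2 : ZMod 4) else 0) + ∑ v, if ζ v = -1 then (2 : ZMod 4) else 0 := by
    rw [← Finset.sum_add_distrib]
    refine Finset.sum_congr rfl fun v _ => ?_
    rcases Int.units_eq_one_or (χ v) with h | h <;> rcases Int.units_eq_one_or (ζ v) with h' | h' <;>
    simp only [h, h'] <;> decide
  have h5 : (∑ v, ((if defect q β (fun x => χ x * ζ x) v = -1 then 1 else 0 : ℕ) : ZMod 4)) =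
      ∑ v, if χ (q v) * ζ (q v) ≠ β v * (χ v * ζ v) then (1 : ZMod 4) else 0 := by
    refine Finset.sum_congr rfl fun v _ => ?_
    rcases Int.units_eq_one_or (χ v * ζ v) with h | h <;>
    rcases Int.units_eq_one_or (χ (q v) * ζ (q v)) with h' | h' <;>
    rcases Int.units_eq_one_or (β v) with h'' | h'' <;> simp only [defect, h, h', h''] <;> decide
  rw [h5, h2, h4, h3, zero_add]
  change negs univ β + _ = 0
  change 0 = negs univ α + _ at h1
  rw [eq_neg_of_add_eq_zero_right h1.symm, ← sub_eq_add_neg, sub_eq_zero]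
  have h6 := two_mul_negs hp univ (fun _ _ => mem_univ _) α hα
  have h7 : negs univ α = - negs univ α := by
    rw [eq_neg_iff_add_eq_zero, ← two_mul, h6]
  rw [h7, ← add_eq_zero_iff_eq_neg, add_comm, hpar]

/-- A spanning pair of perfect matchings `p`, `q` with an even number of negative edges carries a
flow with values `±1`, completed by values `0`, `±2` on the third perfect matching. -/
theorem exists_join [Fintype V] (hp : FPF p) (hq : FPF q) (ht : FPF t) (α β γ : V → ℤˣ)
    (hα : ∀ v, α (p v) = α v) (hβ : ∀ v, β (q v) = β v) (hγ : ∀ v, γ (t v) = γ v)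
    (hconn : ∀ u v, Reach p q t (fun _ => True) u v)
    (hpar : negs univ α + negs univ β = 0) :
    ∃ χ ζ : V → ℤˣ, (∀ v, χ (t v) = χ v) ∧ (∀ v, ζ (p v) = α v * ζ v) ∧
      (∀ v, χ (q v) * ζ (q v) = β v * (χ v * ζ v)) ∧ ∀ v, χ v = 1 → ζ (t v) = γ v * ζ v := by
  classical
  let D : (V → ℤˣ) × (V → ℤˣ) → V → ℤˣ := fun x => defect q β (fun v => x.1 v * x.2 v)
  let P : (V → ℤˣ) × (V → ℤˣ) → Prop := fun x => (∀ v, x.1 (t v) = x.1 v) ∧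
    ∀ v, x.2 (p v) = α v * x.2 v
  have hD : ∀ x v, D x (q v) = D x v := fun x v => by
    simp only [D, defect, hq.inv, hβ]
    ac_rfl
  have hEself : ∀ v, flipEdge q v v = -1 := fun v => by
    rw [flipEdge, flip_self, flip_of_ne (hq.ne v), mul_one]
  have hEne : ∀ v w, w ≠ v → w ≠ q v → flipEdge q v w = 1 := fun v w h h' => by
    rw [flipEdge, flip_of_ne h, flip_of_ne, mul_one]
    rintro rfl
    exact h' (hq.inv w).symm
  have hEq : ∀ v w, flipEdge q v (q w) = flipEdge q v w := fun v w => by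
    simp only [flipEdge, hq.inv]
    ac_rfl
  obtain ⟨ζ₀, hζ₀⟩ := hp.exists_sign α hα
  obtain ⟨x, hx, hmin⟩ := exists_minimizer P (fun x => (univ.filter fun v => D x v = -1).card)
    ⟨(fun _ => -1, ζ₀), fun _ => rfl, hζ₀⟩
  -- A minimum with a defective edge would have a second one by `card_defect`, and modifying along a
  -- path between them would remove both.
  have hgood : ∀ v, D x v = 1 := by
    by_contra hcon
    push Not at hcon
    obtain ⟨v, hv⟩ := hcon
    have hv : D x v = -1 := (Int.units_eq_one_or _).resolve_left hv
    have hcard := card_defect hp hq ht α β x.1 x.2 hα hβ hpar hx.1 hx.2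
    obtain ⟨u, hu, huv⟩ : ∃ u ∈ univ.filter (fun v => D x v = -1), u ∉ ({v, q v} : Finset V) := by
      apply Finset.exists_mem_notMem_of_card_lt_card
      have h1 : ({v, q v} : Finset V).card ≤ 2 := Finset.card_le_two
      have h2 : 0 < (univ.filter fun v => D x v = -1).card :=
        Finset.card_pos.2 ⟨v, by simp [hv]⟩
      have h3 := Nat.le_of_dvd h2 hcard
      change 4 ≤ (univ.filter fun v => D x v = -1).card at h3
      omega
    simp only [mem_filter, mem_univ, true_and, mem_insert, mem_singleton, not_or] at hu huv
    obtain ⟨χ', ζ', h1, h2, -, h4⟩ := reach_modify hp hq ht α β (fun _ => True)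
      (fun _ _ => trivial) x.1 x.2 hx.1 hx.2 (hconn v u)
    have h5 := hmin (χ', ζ') ⟨h1, h2⟩
    have h4 : ∀ w, D (χ', ζ') w = D x w * (flipEdge q v w * flipEdge q u w) := h4
    refine absurd h5 (not_le.2 (Finset.card_lt_card ?_))
    have hvu : v ≠ q u := by
      rintro rfl
      exact huv.2 (hq.inv u).symm
    have hDv : D (χ', ζ') v = 1 := by
      rw [h4, hv, hEself, hEne u v (Ne.symm huv.1) hvu]
      decide
    have hDu : D (χ', ζ') u = 1 := by
      rw [h4, hu, hEself, hEne v u huv.1 huv.2]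
      decide
    rw [Finset.ssubset_iff_of_subset]
    · exact ⟨v, by simp [hv], by simp [hDv]⟩
    · intro w hw
      simp only [mem_filter, mem_univ, true_and] at hw ⊢
      by_cases e1 : w = v
      · rw [e1, hv]
      by_cases e2 : w = q v
      · rw [e2, hD, hv]
      by_cases e3 : w = u
      · rw [e3, hu]
      by_cases e4 : w = q u
      · rw [e4, hD, hu]
      rw [h4, hEne v w e1 e2, hEne u w e3 e4, mul_one, mul_one] at hw
      exact hw
  -- `χ = 1` marks the `t`-edges that carry `±2` (the set `J`), and `χ = -1` those that carry 0. The
  -- minimization is lexicographic, first in `J` and then in the failures: the weight `Fintype.card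
  -- V + 1` exceeds any number of failures.
  let fails : (V → ℤˣ) × (V → ℤˣ) → Finset V := fun x =>
    univ.filter fun v => x.1 v = 1 ∧ x.2 (t v) ≠ γ v * x.2 v
  let J : (V → ℤˣ) × (V → ℤˣ) → Finset V := fun x => univ.filter fun v => x.1 v = 1
  obtain ⟨⟨χ, ζ⟩, ⟨⟨hχ, hζ⟩, hdef⟩, hmin2⟩ := exists_minimizer (fun x => P x ∧ ∀ v, D x v = 1)
    (fun x => (J x).card * (Fintype.card V + 1) + (fails x).card) ⟨x, hx, hgood⟩
  simp only at hχ hζ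
  have hqeq : ∀ v, χ (q v) * ζ (q v) = β v * (χ v * ζ v) := by
    intro v
    have h1 : β v * (χ v * ζ v) * (χ (q v) * ζ (q v)) = 1 := hdef v
    rw [mul_eq_one_iff_eq_inv, Int.units_inv_eq_self] at h1
    exact h1.symm
  refine ⟨χ, ζ, hχ, hζ, hqeq, ?_⟩
  by_contra hcon
  push Not at hcon
  obtain ⟨v, hv, hvt⟩ := hcon
  let Z : V → Prop := fun w => χ w = 1 ∧ w ≠ v ∧ w ≠ t v
  have hZt : ∀ w, Z w → Z (t w) := by
    rintro w ⟨h1, h2, h3⟩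
    refine ⟨by rw [hχ, h1], fun h => h3 ?_, fun h => h2 (ht.inj h)⟩
    rw [← h, ht.inv]
  -- If `v` and `t v` stay joined without their own `t`-edge, removing that edge from `J` and
  -- compensating along the path shrinks `J`. Otherwise negating `ζ` on the side of `v` repairs this
  -- edge and disturbs no other edge of `J`.
  by_cases hA : Reach p q t Z v (t v)
  · obtain ⟨χ', ζ', h1, h2, h3, h4⟩ := reach_modify hp hq ht α β Z hZt χ ζ hχ hζ hA
    have h5 := hmin2 (fun w => χ' w * (flip v w * flip (t v) w), ζ') ⟨⟨fun w => ?_, h2⟩, fun w => ?_⟩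
    · have hlt : (J (fun w => χ' w * (flip v w * flip (t v) w), ζ')).card < (J (χ, ζ)).card := by
        apply Finset.card_lt_card
        rw [Finset.ssubset_iff_of_subset]
        · refine ⟨v, by simp [J, hv], ?_⟩
          have hZv : ¬ Z v := fun h => h.2.1 rfl
          simp only [J, mem_filter, mem_univ, true_and]
          rw [h3 v hZv, hv, flip_self, flip_of_ne (ht.ne v).symm]
          decide
        · intro w hw
          simp only [J, mem_filter, mem_univ, true_and] at hw ⊢
          by_cases e1 : w = v
          · rw [e1, hv]
          by_cases e2 : w = t v
          · rw [e2, hχ, hv]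
          by_cases hZw : Z w
          · exact hZw.1
          · rw [h3 w hZw, flip_of_ne e1, flip_of_ne e2, mul_one, mul_one] at hw
            exact hw
      have hf : ∀ y, (fails y).card ≤ Fintype.card V := fun y => Finset.card_le_univ _
      have h6 := hf (fun w => χ' w * (flip v w * flip (t v) w), ζ')
      have h7 : ((J (fun w => χ' w * (flip v w * flip (t v) w), ζ')).card + 1) *
        (Fintype.card V + 1) ≤ (J (χ, ζ)).card * (Fintype.card V + 1) := Nat.mul_le_mul_right _ hlt
      rw [Nat.add_mul, Nat.one_mul] at h7
      omega
    · change χ' (t w) * (flip v (t w) * flip (t v) (t w)) = χ' w * (flip v w * flip (t v) w)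
      rw [h1, flip_apply_comm ht, flip_apply_comm ht, ht.inv]
      ac_rfl
    · have h6 := defect_mul_flip q β (fun x => χ' x * ζ' x) v (t v) w
      rw [h4] at h6
      have h7 : defect q β (fun x => χ x * ζ x) w = 1 := hdef w
      rw [h7, one_mul, Int.units_mul_self] at h6
      rw [← h6]
      simp only [D, defect]
      ac_rfl
  · let A : V → Prop := fun w => Reach p q t Z v w
    have hAp : ∀ w, A (p w) ↔ A w := fun w =>
      ⟨fun h => h.tail (Or.inl (hp.inv w).symm), fun h => h.tail (Or.inl rfl)⟩
    have hAq : ∀ w, A (q w) ↔ A w := fun w =>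
      ⟨fun h => h.tail (Or.inr (Or.inl (hq.inv w).symm)), fun h => h.tail (Or.inr (Or.inl rfl))⟩
    have hAt : ∀ w, Z w → (A (t w) ↔ A w) := fun w hw =>
      ⟨fun h => h.tail (Or.inr (Or.inr ⟨hZt w hw, (ht.inv w).symm⟩)),
        fun h => h.tail (Or.inr (Or.inr ⟨hw, rfl⟩))⟩
    have hAv : A v := Relation.ReflTransGen.refl
    let ζ' : V → ℤˣ := fun w => if A w then - ζ w else ζ w
    have h5 := hmin2 (χ, ζ') ⟨⟨hχ, fun w => ?_⟩, fun w => ?_⟩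
    · have hlt : (fails (χ, ζ')).card < (fails (χ, ζ)).card := by
        apply Finset.card_lt_card
        have hv1 : ζ' (t v) = γ v * ζ' v := by
          simp only [ζ']
          rw [if_pos hAv, if_neg hA]
          rcases Int.units_eq_one_or (ζ (t v)) with h | h <;>
          rcases Int.units_eq_one_or (γ v * ζ v) with h' | h'
          · exact absurd (h.trans h'.symm) hvt
          · rw [mul_neg, h, h']; decide
          · rw [mul_neg, h, h']
          · exact absurd (h.trans h'.symm) hvt
        have hv2 : ζ' (t (t v)) = γ (t v) * ζ' (t v) := by
          rw [ht.inv, hγ, hv1, ← mul_assoc, Int.units_mul_self, one_mul]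
        rw [Finset.ssubset_iff_of_subset]
        · refine ⟨v, by simp [fails, hv, hvt], ?_⟩
          simp [fails, hv1]
        · intro w hw
          simp only [fails, mem_filter, mem_univ, true_and] at hw ⊢
          refine ⟨hw.1, fun h => hw.2 ?_⟩
          by_cases e1 : w = v
          · rw [e1, hv1]
          by_cases e2 : w = t v
          · rw [e2, hv2]
          · have := hAt w ⟨hw.1, e1, e2⟩
            simp only [ζ', this]
            split_ifs
            · rw [h, mul_neg]
            · exact h
      have h6 : (J (χ, ζ')).card = (J (χ, ζ)).card := rfl
      rw [h6] at h5
      omega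
    · simp only [ζ', hAp, hζ]
      split_ifs <;> simp
    · have h7 : β w * (χ w * ζ w) * (χ (q w) * ζ (q w)) = 1 := hdef w
      simp only [D, defect, ζ', hAq]
      rw [← h7]
      split_ifs <;> simp

end Join

end SignedCubic

/-! ### Coloured systems, Kempe changes, and uniqueness of the unbalanced circuit. -/

namespace SignedCubic

open Finset

/-- A signed cubic graph with a proper edge-colouring by three colours: the vertex at the other end
of the edge of colour `i` at `v` is `c i v`, and `s i v` is the negative of its sign. -/
structure Sys (V : Type*) where
  c : Fin 3 → V → V
  s : Fin 3 → V → ℤˣ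
  fpf : ∀ i, FPF (c i)
  sinv : ∀ i v, s i (c i v) = s i v

namespace Sys

variable {V : Type*} (S : Sys V)

/-- The values `φ i v` of a flow on the half-edges `(v, i)`. -/
def IsFlow (φ : Fin 3 → V → ℤ) : Prop :=
  (∀ i v, φ i (S.c i v) = S.s i v * φ i v) ∧ ∀ v, φ 0 v + φ 1 v + φ 2 v = 0

/-- The existence of a nowhere-zero `k`-flow. -/
def HasNZ (k : ℤ) : Prop := ∃ φ, S.IsFlow φ ∧ ∀ i v, φ i v ≠ 0 ∧ |φ i v| < k

def Connected : Prop := ∀ u v, Relation.ReflTransGen (fun a b => ∃ i, b = S.c i a) u v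

/-- A change of the colouring, which permutes the colours at each vertex. -/
def recolor (ρ : V → Equiv.Perm (Fin 3)) (hρ : ∀ v i, ρ (S.c (ρ v i) v) i = ρ v i) : Sys V where
  c i v := S.c (ρ v i) v
  s i v := S.s (ρ v i) v
  fpf i := ⟨fun v => by rw [hρ, (S.fpf _).inv], fun v => (S.fpf _).ne v⟩
  sinv i v := by rw [hρ, S.sinv]

variable {S}

theorem IsFlow.of_recolor {ρ : V → Equiv.Perm (Fin 3)} {hρ} {φ : Fin 3 → V → ℤ}
    (h : (S.recolor ρ hρ).IsFlow φ) : S.IsFlow fun j v => φ ((ρ v).symm j) v := by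
  constructor
  · intro j v
    have h1 := h.1 ((ρ v).symm j) v
    have h2 := hρ v ((ρ v).symm j)
    simp only [recolor, Equiv.apply_symm_apply] at h1 h2
    have h3 : (ρ (S.c j v)).symm j = (ρ v).symm j := by
      rw [Equiv.symm_apply_eq, h2]
    simp only [h3, h1]
  · intro v
    have h1 := h.2 v
    have h2 := Equiv.sum_comp (ρ v).symm (fun i => φ i v)
    rw [Fin.sum_univ_three, Fin.sum_univ_three, h1] at h2
    exact h2

theorem HasNZ.of_recolor {ρ : V → Equiv.Perm (Fin 3)} {hρ} {k : ℤ}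
    (h : (S.recolor ρ hρ).HasNZ k) : S.HasNZ k := by
  obtain ⟨φ, h1, h2⟩ := h
  exact ⟨_, h1.of_recolor, fun i v => h2 _ v⟩

theorem Connected.recolor (h : S.Connected) (ρ : V → Equiv.Perm (Fin 3)) (hρ) :
    (S.recolor ρ hρ).Connected := by
  intro u v
  refine Relation.ReflTransGen.mono ?_ _ _ (h u v)
  rintro a b ⟨i, rfl⟩
  exact ⟨(ρ a).symm i, by simp [Sys.recolor]⟩

variable (S)

/-- The Kempe change of the colours `i` and `j` on a set of vertices. -/
def kempe [DecidableEq V] (i j : Fin 3) (N : Finset V) (hi : ∀ v, S.c i v ∈ N ↔ v ∈ N)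
    (hj : ∀ v, S.c j v ∈ N ↔ v ∈ N) : Sys V :=
  S.recolor (fun v => if v ∈ N then Equiv.swap i j else 1) (by
    intro v k
    have h : ∀ w, (if w ∈ N then Equiv.swap i j else 1) k =
        if w ∈ N then Equiv.swap i j k else k := fun w => by split_ifs <;> rfl
    simp only [h]
    by_cases hk : k = i
    · by_cases hv : v ∈ N <;> simp [hv, hk, hi, hj]
    by_cases hk' : k = j
    · by_cases hv : v ∈ N <;> simp [hv, hk', hi, hj]
    simp [Equiv.swap_apply_of_ne_of_ne hk hk'])

theorem kempe_s [DecidableEq V] (i j : Fin 3) (N : Finset V) (hi hj) (k : Fin 3) :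
    (S.kempe i j N hi hj).s k = fun v => if v ∈ N then S.s (Equiv.swap i j k) v else S.s k v := by
  funext v
  change S.s ((if v ∈ N then Equiv.swap i j else 1) k) v = _
  split_ifs <;> rfl

/-- The parity of the number of negative edges of a colour. -/
noncomputable def par [Fintype V] (i : Fin 3) : ZMod 4 := negs univ (S.s i)

theorem two_mul_par [Fintype V] (i : Fin 3) : 2 * S.par i = 0 :=
  two_mul_negs (S.fpf i) univ (fun _ _ => mem_univ _) _ (S.sinv i)

/-- The circuit of colours `i` and `j` through `v`. -/
noncomputable def orb [Fintype V] (i j : Fin 3) (v : V) : Finset V := by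
  classical exact univ.filter fun u => Conn (S.c i) (S.c j) v u

variable {S}

theorem mem_orb [Fintype V] {i j : Fin 3} {v u : V} :
    u ∈ S.orb i j v ↔ Conn (S.c i) (S.c j) v u := by
  simp [orb]

theorem orb_left [Fintype V] {i j : Fin 3} {v u : V} : S.c i u ∈ S.orb i j v ↔ u ∈ S.orb i j v := by
  rw [mem_orb, mem_orb]
  refine ⟨fun h => h.trans ?_, fun h => h.trans (Conn.left _)⟩
  have := Conn.left (p := S.c i) (q := S.c j) (S.c i u)
  rwa [(S.fpf i).inv] at this

theorem orb_right [Fintype V] {i j : Fin 3} {v u : V} :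
    S.c j u ∈ S.orb i j v ↔ u ∈ S.orb i j v := by
  rw [mem_orb, mem_orb]
  refine ⟨fun h => h.trans ?_, fun h => h.trans (Conn.right _)⟩
  have := Conn.right (p := S.c i) (q := S.c j) (S.c j u)
  rwa [(S.fpf j).inv] at this

theorem negs_ite [Fintype V] [DecidableEq V] (N : Finset V) (α β : V → ℤˣ) :
    negs univ (fun v => if v ∈ N then β v else α v) = negs univ α - negs N α + negs N β := by
  classical
  have h : ∀ f : V → ZMod 4, ∑ v ∈ N, f v = ∑ v, if v ∈ N then f v else 0 := fun f => by simp
  simp only [negs, h]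
  rw [← Finset.sum_sub_distrib, ← Finset.sum_add_distrib]
  refine Finset.sum_congr rfl fun v _ => ?_
  by_cases hv : v ∈ N <;> simp [hv]

theorem Connected.reach (h : S.Connected) (i j k : Fin 3) (hijk : ∀ l, l = i ∨ l = j ∨ l = k)
    (u v : V) : Reach (S.c i) (S.c j) (S.c k) (fun _ => True) u v := by
  refine Relation.ReflTransGen.mono ?_ _ _ (h u v)
  rintro a b ⟨l, rfl⟩
  rcases hijk l with rfl | rfl | rfl
  · exact Or.inl rfl
  · exact Or.inr (Or.inl rfl)
  · exact Or.inr (Or.inr ⟨trivial, rfl⟩)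

/-- If all three pairs of colours have an even number of negative edges, there is an 8-flow. -/
theorem Connected.hasNZ_of_even [Fintype V] (h : S.Connected) (h01 : S.par 0 + S.par 1 = 0)
    (h02 : S.par 0 + S.par 2 = 0) : S.HasNZ 8 := by
  obtain ⟨χ, ζ, h1, h2, h3, h4⟩ := exists_join (S.fpf 0) (S.fpf 1) (S.fpf 2) (S.s 0) (S.s 1) (S.s 2)
    (S.sinv 0) (S.sinv 1) (S.sinv 2) (h.reach 0 1 2 (by decide)) h01
  obtain ⟨χ', ζ', h1', h2', h3', h4'⟩ := exists_join (S.fpf 0) (S.fpf 2) (S.fpf 1) (S.s 0) (S.s 2)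
    (S.s 1) (S.sinv 0) (S.sinv 2) (S.sinv 1) (h.reach 0 2 1 (by decide)) h02
  -- Where `χ = -1` the value `(1 + χ) * ζ` is 0 at both ends, so the transfer across the third
  -- matching is needed only where `χ = 1`.
  have key : ∀ (x y : ℤˣ) (γ z w : ℤˣ), x = y → (y = 1 → z = γ * w) →
      (1 + (x : ℤ)) * z = γ * ((1 + y) * w) := by
    intro x y γ z w hxy hy
    rcases Int.units_eq_one_or y with rfl | rfl
    · rw [hxy, hy rfl]; push_cast; ring
    · rw [hxy]; simp
  -- The first join flow plus three times the second, whose colours 1 and 2 are exchanged. Colour 0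
  -- gets `±2` or `±4`, colour 1 gets `±1` plus 0 or `±6`, colour 2 gets `±3` plus 0 or `±2`.
  refine ⟨![fun v => ζ v + 3 * ζ' v, fun v => χ v * ζ v - 3 * ((1 + χ' v) * ζ' v),
    fun v => -((1 + χ v) * ζ v) + 3 * (χ' v * ζ' v)], ⟨fun i v => ?_, fun v => ?_⟩, fun i v => ?_⟩
  · fin_cases i
    · simp only [Fin.zero_eta, Matrix.cons_val_zero, h2, h2']
      push_cast; ring
    · change (χ (S.c 1 v) * ζ (S.c 1 v) - 3 * ((1 + χ' (S.c 1 v)) * ζ' (S.c 1 v)) : ℤ) =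
        S.s 1 v * (χ v * ζ v - 3 * ((1 + χ' v) * ζ' v))
      have e1 := congrArg (Units.val) (h3 v)
      have e2 := key _ _ _ _ _ (h1' v) (h4' v)
      push_cast at e1
      rw [e1, e2]; ring
    · have e1 := congrArg (Units.val) (h3' v)
      have e2 := key _ _ _ _ _ (h1 v) (h4 v)
      simp only [Fin.reduceFinMk, Matrix.cons_val]
      push_cast at e1
      rw [e1, e2]; ring
  · simp only [Matrix.cons_val]; ring
  · rcases Int.units_eq_one_or (χ v) with e1 | e1 <;> rcases Int.units_eq_one_or (χ' v) with e2 | e2 <;>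
    rcases Int.units_eq_one_or (ζ v) with e3 | e3 <;>
    rcases Int.units_eq_one_or (ζ' v) with e4 | e4 <;> fin_cases i <;> simp [e1, e2, e3, e4]

/-- Without an 8-flow, the circuits of a pair of colours are balanced as soon as the pair has an
even number of negative edges. -/
theorem Connected.bal_zero_one [Fintype V] (h : S.Connected) (hS : ¬ S.HasNZ 8)
    (h01 : S.par 0 + S.par 1 = 0) (v : V) : Bal (S.c 0) (S.c 1) (S.s 0) (S.s 1) v := by
  classical
  by_contra hcon
  have hN : negs (S.orb 0 1 v) (S.s 0) + negs (S.orb 0 1 v) (S.s 1) ≠ 0 := fun h' =>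
    hcon (bal_of_negs (S.fpf 0) (S.fpf 1) _ _ (S.sinv 0) (S.sinv 1) v _ (fun u => mem_orb) h')
  have h02 : S.par 0 + S.par 2 ≠ 0 := fun h' => hS (h.hasNZ_of_even h01 h')
  set N := S.orb 0 1 v
  -- On an unbalanced circuit exactly one of the two `negs` is 2. The change therefore shifts the
  -- parities of colours 0 and 1 together, and both come to agree with colour 2.
  let S' := S.kempe 0 1 N (fun _ => orb_left) (fun _ => orb_right)
  have p0 : S'.par 0 = S.par 0 - negs N (S.s 0) + negs N (S.s 1) := by
    rw [par, par, ← negs_ite]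
    congr 1
    simp [S', kempe_s]
  have p1 : S'.par 1 = S.par 1 - negs N (S.s 1) + negs N (S.s 0) := by
    rw [par, par, ← negs_ite]
    congr 1
    simp [S', kempe_s]
  have p2 : S'.par 2 = S.par 2 := by
    rw [par, par]
    congr 1
    simp [S', kempe_s, Equiv.swap_apply_of_ne_of_ne (show (2 : Fin 3) ≠ 0 by decide)
        (show (2 : Fin 3) ≠ 1 by decide)]
  refine hS (HasNZ.of_recolor (Connected.hasNZ_of_even (S := S') (h.recolor _ _) ?_ ?_))
  · rw [p0, p1, ← h01]; ring
  · rw [p0, p2]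
    have t0 := S.two_mul_par 0
    have t2 := S.two_mul_par 2
    have n0 := two_mul_negs (S.fpf 0) N (fun _ hu => orb_left.2 hu) _ (S.sinv 0)
    have n1 := two_mul_negs (S.fpf 1) N (fun _ hu => orb_right.2 hu) _ (S.sinv 1)
    generalize S.par 0 = a at *
    generalize S.par 2 = b at *
    generalize negs N (S.s 0) = x at *
    generalize negs N (S.s 1) = y at *
    clear hcon p0 p1 p2 S' h01
    revert a b x y
    decide

theorem Connected.bal [Fintype V] (h : S.Connected) (hS : ¬ S.HasNZ 8) {i j : Fin 3} (hij : i ≠ j)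
    (hpar : S.par i + S.par j = 0) (v : V) : Bal (S.c i) (S.c j) (S.s i) (S.s j) v := by
  obtain ⟨e, he0, he1⟩ : ∃ e : Equiv.Perm (Fin 3), e 0 = i ∧ e 1 = j := by
    clear hpar
    revert i j; decide
  have := Connected.bal_zero_one (S := S.recolor (fun _ => e) (fun _ _ => rfl)) (h.recolor _ _)
    (fun h' => hS h'.of_recolor) (by
      change S.par (e 0) + S.par (e 1) = 0
      rw [he0, he1, hpar]) v
  change Bal (S.c (e 0)) (S.c (e 1)) (S.s (e 0)) (S.s (e 1)) v at this
  rwa [he0, he1] at this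

/-- A Kempe change on the unbalanced 0-2-circuit gives colours 1 and 2 equal parity, so their new
circuits are balanced and carry a flow with values `±1`. In the old colours this flow uses colour 2
off the changed circuit and colour 0 on it. -/
theorem Connected.exists_flow_off_orb [Fintype V] (h : S.Connected) (hS : ¬ S.HasNZ 8)
    (h01 : S.par 0 + S.par 1 = 0) (h02 : S.par 0 + S.par 2 ≠ 0) (v : V)
    (hv : ¬ Bal (S.c 0) (S.c 2) (S.s 0) (S.s 2) v) :
    ∃ φ : Fin 3 → V → ℤ, S.IsFlow φ ∧ (∀ i u, |φ i u| ≤ 1) ∧ ∀ u, u ∉ S.orb 0 2 v → φ 2 u ≠ 0 := by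
  classical
  have hN : negs (S.orb 0 2 v) (S.s 0) + negs (S.orb 0 2 v) (S.s 2) ≠ 0 := fun h' =>
    hv (bal_of_negs (S.fpf 0) (S.fpf 2) _ _ (S.sinv 0) (S.sinv 2) v _ (fun u => mem_orb) h')
  set N := S.orb 0 2 v
  let S' := S.kempe 0 2 N (fun _ => orb_left) (fun _ => orb_right)
  have p2 : S'.par 2 = S.par 2 - negs N (S.s 2) + negs N (S.s 0) := by
    rw [par, par, ← negs_ite]
    congr 1
    simp [S', kempe_s]
  have p1 : S'.par 1 = S.par 1 := by
    rw [par, par]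
    congr 1
    simp [S', kempe_s, Equiv.swap_apply_of_ne_of_ne (show (1 : Fin 3) ≠ 0 by decide)
        (show (1 : Fin 3) ≠ 2 by decide)]
  have hpar : S'.par 1 + S'.par 2 = 0 := by
    rw [p1, p2]
    have t0 := S.two_mul_par 0
    have t1 := S.two_mul_par 1
    have t2 := S.two_mul_par 2
    have n0 := two_mul_negs (S.fpf 0) N (fun _ hu => orb_left.2 hu) _ (S.sinv 0)
    have n1 := two_mul_negs (S.fpf 2) N (fun _ hu => orb_right.2 hu) _ (S.sinv 2)
    generalize S.par 0 = a at *
    generalize S.par 1 = c at *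
    generalize S.par 2 = b at *
    generalize negs N (S.s 0) = x at *
    generalize negs N (S.s 2) = y at *
    clear p1 p2 S'
    revert a b c x y
    decide
  have hbal := Connected.bal (S := S') (h.recolor _ _) (fun h' => hS h'.of_recolor)
    (show (1 : Fin 3) ≠ 2 by decide) hpar
  obtain ⟨ε, hε⟩ := Bal.exists_global (S'.fpf 1) (S'.fpf 2) hbal
  have hflow : S'.IsFlow ![fun _ => 0, fun u => ε u, fun u => -ε u] := by
    constructor
    · intro i u
      fin_cases i
      · simp
      · simp [(hε u).1]
      · simp [(hε u).2]
    · intro u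
      simp
  refine ⟨_, hflow.of_recolor, fun i u => ?_, fun u hu => ?_⟩
  · generalize (_ : Equiv.Perm (Fin 3)) i = k
    fin_cases k <;> rcases Int.units_eq_one_or (ε u) with h' | h' <;> simp [h']
  · have h1 : (1 : Equiv.Perm (Fin 3)).symm 2 = 2 := rfl
    simp [hu, h1]

/-- Without an 8-flow, exactly one pair of colours has an even number of negative edges, its circuits
are balanced, and at most one circuit of each other pair of colours is not balanced. -/
theorem Connected.unique_unbalanced [Fintype V] (h : S.Connected) (hS : ¬ S.HasNZ 8)
    (h01 : S.par 0 + S.par 1 = 0) {u v : V}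
    (hu : ¬ Bal (S.c 0) (S.c 2) (S.s 0) (S.s 2) u) (hv : ¬ Bal (S.c 0) (S.c 2) (S.s 0) (S.s 2) v) :
    Conn (S.c 0) (S.c 2) u v := by
  have h02 : S.par 0 + S.par 2 ≠ 0 := fun h' => hS (h.hasNZ_of_even h01 h')
  by_contra hcon
  obtain ⟨ε, hε⟩ := Bal.exists_global (S.fpf 0) (S.fpf 1) (h.bal hS (by decide) h01)
  obtain ⟨φ, hφ, hφ1, hφ2⟩ := h.exists_flow_off_orb hS h01 h02 u hu
  obtain ⟨ψ, hψ, hψ1, hψ2⟩ := h.exists_flow_off_orb hS h01 h02 v hv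
  have hne : ∀ w, φ 2 w ≠ 0 ∨ ψ 2 w ≠ 0 := by
    intro w
    by_contra! hw
    have hw1 : w ∈ S.orb 0 2 u := by_contra fun h' => hφ2 w h' hw.1
    have hw2 : w ∈ S.orb 0 2 v := by_contra fun h' => hψ2 w h' hw.2
    exact hcon ((mem_orb.1 hw1).trans ((mem_orb.1 hw2).symm (S.fpf 0) (S.fpf 2)))
  let f : Fin 3 → V → ℤ := ![fun w => ε w, fun w => -ε w, fun _ => 0]
  -- Colours 0 and 1 get odd values. On colour 2 `f` vanishes, and `φ`, `ψ` do not vanish together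
  -- because their exceptional circuits are disjoint. The total is at most 1 + 2 + 4.
  refine hS ⟨fun i w => f i w + 2 * φ i w + 4 * ψ i w, ⟨fun i w => ?_, fun w => ?_⟩, fun i w => ?_⟩
  · have hf : f i (S.c i w) = S.s i w * f i w := by
      fin_cases i
      · simp [f, (hε w).1]
      · simp [f, (hε w).2]
      · simp [f]
    simp only [hf, hφ.1, hψ.1]; ring
  · have h1 := hφ.2 w
    have h2 := hψ.2 w
    have hf : f 0 w + f 1 w + f 2 w = 0 := by simp [f]
    linarith
  · have h1 := hφ1 i w
    have h2 := hψ1 i w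
    rw [abs_le] at h1 h2
    rw [abs_lt]
    have hε1 : (ε w : ℤ) = 1 ∨ (ε w : ℤ) = -1 := by
      rcases Int.units_eq_one_or (ε w) with h' | h' <;> simp [h']
    have hw := hne w
    fin_cases i <;> simp only [f, Fin.zero_eta, Fin.mk_one, Fin.reduceFinMk, Matrix.cons_val] at * <;>
    omega

end Sys

end SignedCubic

/-! ### Unit flow along an arc of a circuit. -/

namespace SignedCubic

section Segment

variable {V : Type*} {p q : V → V}

/-- The indicator of the `p`-edge at `u`. -/
noncomputable def ind (p : V → V) (u v : V) : ℤ := by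
  classical exact if v = u ∨ v = p u then 1 else 0

theorem ind_nonneg (u v : V) : 0 ≤ ind p u v := by
  unfold ind; split_ifs <;> norm_num

theorem ind_eq_zero {u v : V} (h : v ≠ u) (h' : v ≠ p u) : ind p u v = 0 := by
  simp [ind, h, h']

theorem ind_eq_one {u v : V} (h : v = u ∨ v = p u) : ind p u v = 1 := by
  simp [ind, h]

theorem ind_self (u : V) : ind p u u = 1 := ind_eq_one (Or.inl rfl)

theorem ind_of_closed {P : V → Prop} (hP : ∀ v, P v → P (p v)) {u v : V} (hu : P u) (hv : ¬ P v) :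
    ind p u v = 0 :=
  ind_eq_zero (fun h => hv (h ▸ hu)) (fun h => hv (h ▸ hP _ hu))

theorem ind_of_not_closed (hp : FPF p) {P : V → Prop} (hP : ∀ v, P v → P (p v)) {u v : V}
    (hu : ¬ P u) (hv : P v) : ind p u v = 0 :=
  ind_eq_zero (fun h => hu (h ▸ hv)) (fun h => hu (by have := hP _ hv; rwa [h, hp.inv] at this))

theorem ind_apply (hp : FPF p) (u v : V) : ind p u (p v) = ind p u v := by
  by_cases h : v = u ∨ v = p u
  · rw [ind_eq_one h, ind_eq_one]
    rcases h with rfl | rfl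
    · exact Or.inr rfl
    · exact Or.inl (hp.inv u)
  · push Not at h
    rw [ind_eq_zero h.1 h.2, ind_eq_zero]
    · intro h'
      apply h.2
      rw [← h', hp.inv]
    · intro h'
      exact h.1 (hp.inj h')

/-- Unit flow along an arc of a circuit, from the `p`-edge at `v₀` to the first `p`-edge in `X`. -/
theorem exists_segment [Finite V] (hp : FPF p) (hq : FPF q) (γ : V → ℤˣ) (v₀ : V)
    (hγ : ∀ v, Conn p q v₀ v → γ (p v) = -γ v ∧ γ (q v) = -γ v) (X : V → Prop)
    (hX : ∀ v, X v → X (p v)) (hX' : ∃ v, X v ∧ Conn p q v₀ v) :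
    ∃ u, X u ∧ Conn p q v₀ u ∧ ∃ g : V → ℤ, (∀ v, g v = 0 ∨ g v = 1) ∧
      (∀ v, ¬ Conn p q v₀ v → g v = 0) ∧ (∀ v, g (q v) = g v) ∧
      (∀ v, γ v * (g (p v) - g v) = ind p u v - ind p v₀ v) ∧
      ∃ a, (a = 0 ∨ a = 1) ∧ ∀ v, X v → Conn p q v₀ v → g v = a ∨ g (p v) = a := by
  classical
  by_cases hX0 : X v₀
  · exact ⟨v₀, hX0, Conn.refl _, fun _ => 0, by simp, by simp, by simp, by simp, 0, by simp⟩
  obtain ⟨m, a, idx, h⟩ := exists_isCircuit hp hq v₀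
  have hex : ∃ i, i < m ∧ X (a (2 * i)) := by
    obtain ⟨v, hv, hv'⟩ := hX'
    obtain ⟨k, hk, rfl | rfl⟩ := h.cases_vertex hv'
    · exact ⟨k, hk, hv⟩
    · refine ⟨k, hk, ?_⟩
      rw [← h.left' hp]
      exact hX _ hv
  obtain ⟨i, ⟨him, hiX⟩, himin⟩ : ∃ i, (i < m ∧ X (a (2 * i))) ∧ ∀ j, j < m → X (a (2 * j)) → i ≤ j :=
    ⟨Nat.find hex, Nat.find_spec hex, fun j h1 h2 => Nat.find_min' hex ⟨h1, h2⟩⟩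
  have hi0 : 0 < i := by
    rcases Nat.eq_zero_or_pos i with rfl | h'
    · rw [Nat.mul_zero, h.zero] at hiX
      exact absurd hiX hX0
    · exact h'
  -- The arc consists of the `q`-edges joining positions 1-2, 3-4, up to `2 * i`; the closing
  -- `q`-edge between `2 * m - 1` and 0 stays outside.
  let G : ℕ → ℤ := fun n => if 1 ≤ n ∧ n ≤ 2 * i then 1 else 0
  let g : V → ℤ := fun v => if Conn p q v₀ v then G (idx v) else 0
  have hga : ∀ n < 2 * m, g (a n) = G n := fun n hn => by
    simp only [g, if_pos (h.conn n), h.idx_a n hn]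
  have hcp : ∀ v, Conn p q v₀ (p v) ↔ Conn p q v₀ v := fun v =>
    ⟨fun h' => h'.trans ((Conn.left v).symm hp hq), fun h' => h'.trans (Conn.left v)⟩
  have hcq : ∀ v, Conn p q v₀ (q v) ↔ Conn p q v₀ v := fun v =>
    ⟨fun h' => h'.trans ((Conn.right v).symm hp hq), fun h' => h'.trans (Conn.right v)⟩
  have hgq : ∀ v, g (q v) = g v := by
    intro v
    by_cases hv : Conn p q v₀ v
    · obtain ⟨k, hk, rfl | rfl⟩ := h.cases_vertex hv
      · rcases Nat.eq_zero_or_pos k with rfl | hk0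
        · rw [Nat.mul_zero, h.right_zero hq, hga _ (by omega), hga _ (by omega)]
          simp only [G]
          rw [if_neg (by omega), if_neg (by omega)]
        · obtain ⟨j, rfl⟩ : ∃ j, k = j + 1 := ⟨k - 1, by omega⟩
          rw [show 2 * (j + 1) = 2 * j + 2 by ring, h.right' hq, hga _ (by omega), hga _ (by omega)]
          simp only [G]
          congr 1
          simp only [eq_iff_iff]
          omega
      · rw [h.right]
        by_cases hk' : 2 * k + 2 < 2 * m
        · rw [hga _ hk', hga _ (by omega)]
          simp only [G]
          congr 1
          simp only [eq_iff_iff]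
          omega
        · rw [show 2 * k + 2 = 2 * m by omega, h.last, ← h.zero, hga _ (by omega), hga _ (by omega)]
          simp only [G]
          rw [if_neg (by omega), if_neg (by omega)]
    · simp only [g, hcq, if_neg hv]
  have hind : ∀ j k, j < m → k < m → (ind p (a (2 * j)) (a (2 * k)) = if k = j then 1 else 0) ∧
      ind p (a (2 * j)) (a (2 * k + 1)) = if k = j then 1 else 0 := by
    intro j k hj hk
    rw [← h.left, ind_apply hp, and_self]
    by_cases hkj : k = j
    · rw [hkj, ind_self, if_pos rfl]
    · rw [if_neg hkj, ind_eq_zero]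
      · intro h'
        have := h.inj (by omega) (by omega) h'
        omega
      · rw [h.left]
        intro h'
        have := h.inj (by omega) (by omega) h'
        omega
  have hγa : ∀ k, γ (a (2 * k)) = γ v₀ ∧ γ (a (2 * k + 1)) = -γ v₀ := by
    intro k
    induction k with
    | zero =>
      have := (hγ _ (h.conn (2 * 0))).1
      rw [h.left] at this
      rw [this, Nat.mul_zero, h.zero]
      exact ⟨rfl, rfl⟩
    | succ k ih =>
      have h1 := (hγ _ (h.conn (2 * k + 1))).2
      rw [h.right, ih.2, neg_neg] at h1
      have h2 := (hγ _ (h.conn (2 * k + 2))).1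
      rw [show 2 * k + 2 = 2 * (k + 1) by ring] at h1 h2
      rw [h.left] at h2
      exact ⟨h1, by rw [h2, h1]⟩
  have hflux : ∀ v, γ v * (g (p v) - g v) = γ v₀ * (ind p v₀ v - ind p (a (2 * i)) v) := by
    intro v
    by_cases hv : Conn p q v₀ v
    · obtain ⟨k, hk, rfl | rfl⟩ := h.cases_vertex hv
      · have e1 := (hind 0 k (by omega) hk).1
        rw [Nat.mul_zero, h.zero] at e1
        rw [h.left, hga _ (by omega), hga _ (by omega), (hγa k).1, e1, (hind i k him hk).1]
        congr 1
        simp only [G]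
        split_ifs <;> omega
      · have e1 := (hind 0 k (by omega) hk).2
        rw [Nat.mul_zero, h.zero] at e1
        rw [h.left' hp, hga _ (by omega), hga _ (by omega), (hγa k).2, e1, (hind i k him hk).2,
          Units.val_neg, neg_mul, ← mul_neg]
        congr 1
        simp only [G]
        split_ifs <;> omega
    · simp only [g, hcp, if_neg hv]
      rw [ind_of_closed (P := Conn p q v₀) (fun v => (hcp v).2) (Conn.refl _) hv,
        ind_of_closed (P := Conn p q v₀) (fun v => (hcp v).2) (h.conn _) hv]
      simp
  have hg01 : ∀ v, g v = 0 ∨ g v = 1 := by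
    intro v
    simp only [g, G]
    split_ifs <;> simp
  have hg0 : ∀ v, ¬ Conn p q v₀ v → g v = 0 := fun v hv => by simp only [g, if_neg hv]
  have hgX : ∀ v, X v → Conn p q v₀ v → g v = 0 ∨ g (p v) = 0 := by
    intro v hvX hv
    have key : ∀ k < m, X (a (2 * k)) → g (a (2 * k + 1)) = 0 := by
      intro k hk hkX
      have := himin k hk hkX
      rw [hga _ (by omega)]
      simp only [G]
      rw [if_neg (by omega)]
    obtain ⟨k, hk, rfl | rfl⟩ := h.cases_vertex hv
    · right
      rw [h.left]
      exact key k hk hvX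
    · left
      refine key k hk ?_
      rw [← h.left' hp]
      exact hX _ hvX
  refine ⟨a (2 * i), hiX, h.conn _, ?_⟩
  -- The sign at `v₀` decides which of the two complementary arcs carries positive flow in the
  -- prescribed direction. For the complement, the value met at every `p`-edge in `X` is 1 instead
  -- of 0.
  rcases Int.units_eq_one_or (γ v₀) with h1 | h1
  · refine ⟨fun v => if Conn p q v₀ v then 1 - g v else 0, fun v => ?_, fun v hv => if_neg hv,
      fun v => ?_, fun v => ?_, 1, Or.inr rfl, fun v hvX hv => ?_⟩
    · rcases hg01 v with h2 | h2 <;> simp [h2, em']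
    · simp only [hcq, hgq]
    · have := hflux v
      rw [h1, Units.val_one, one_mul] at this
      simp only [hcp]
      split_ifs with hv
      · linear_combination -this
      · rw [hg0 v hv, hg0 (p v) (fun h' => hv ((hcp v).1 h'))] at this
        linear_combination -this
    · simp only [hcp, if_pos hv]
      rcases hgX v hvX hv with h2 | h2 <;> simp [h2]
  · refine ⟨g, hg01, hg0, hgq, fun v => ?_, 0, Or.inl rfl, hgX⟩
    have := hflux v
    rw [h1] at this
    push_cast at this
    linear_combination this

end Segment

end SignedCubic

/-! ### Configurations, partial flows with demands, and growing collections of circuits. -/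

namespace SignedCubic

/-- Three perfect matchings `r`, `b`, `t` with signs `s` on the `t`-edges, and a union `D` of
`r`-`t`-circuits outside which `θ` balances all `r`-`t`-circuits. -/
structure Cfg (V : Type*) where
  r : V → V
  b : V → V
  t : V → V
  hr : FPF r
  hb : FPF b
  ht : FPF t
  s : V → ℤˣ
  s_t : ∀ v, s (t v) = s v
  D : V → Prop
  D_r : ∀ v, D (r v) ↔ D v
  D_t : ∀ v, D (t v) ↔ D v
  θ : V → ℤˣ
  θ_r : ∀ v, ¬ D v → θ (r v) = θ v
  θ_t : ∀ v, ¬ D v → θ (t v) = s v * θ v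

namespace Cfg

variable {V : Type*} (S : Cfg V)

/-- The `r`-`b`-circuit through `v`. -/
def circC (v : V) : Set V := {w | Conn S.r S.b v w}

/-- The `r`-`t`-circuit through `v`. -/
def circO (v : V) : Set V := {w | Conn S.r S.t v w}

variable {S}

theorem not_D_of_mem_circO {v w : V} (h : w ∈ S.circO v) (hv : ¬ S.D v) : ¬ S.D w :=
  Conn.closed (P := fun w => ¬ S.D w) (fun v h => by rwa [S.D_r]) (fun v h => by rwa [S.D_t]) h hv

theorem circC_r {v w : V} : S.r w ∈ S.circC v ↔ w ∈ S.circC v :=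
  ⟨fun h => by have := Conn.trans h (Conn.left _); rwa [S.hr.inv] at this,
    fun h => Conn.trans h (Conn.left _)⟩

theorem circC_b {v w : V} : S.b w ∈ S.circC v ↔ w ∈ S.circC v :=
  ⟨fun h => by have := Conn.trans h (Conn.right _); rwa [S.hb.inv] at this,
    fun h => Conn.trans h (Conn.right _)⟩

theorem circO_r {v w : V} : S.r w ∈ S.circO v ↔ w ∈ S.circO v :=
  ⟨fun h => by have := Conn.trans h (Conn.left _); rwa [S.hr.inv] at this,
    fun h => Conn.trans h (Conn.left _)⟩

theorem circO_t {v w : V} : S.t w ∈ S.circO v ↔ w ∈ S.circO v :=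
  ⟨fun h => by have := Conn.trans h (Conn.right _); rwa [S.ht.inv] at this,
    fun h => Conn.trans h (Conn.right _)⟩

theorem circC_of_mem {v w : V} (h : w ∈ S.circC v) : S.circC w = S.circC v :=
  Set.ext fun _ => ⟨fun h' => Conn.trans h h', fun h' => Conn.trans (Conn.symm S.hr S.hb h) h'⟩

theorem circO_of_mem {v w : V} (h : w ∈ S.circO v) : S.circO w = S.circO v :=
  Set.ext fun _ => ⟨fun h' => Conn.trans h h', fun h' => Conn.trans (Conn.symm S.hr S.ht h) h'⟩

theorem mem_circC_self (v : V) : v ∈ S.circC v := Conn.refl v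

theorem mem_circO_self (v : V) : v ∈ S.circO v := Conn.refl v

variable (S)

/-- A pair of functions `lam` on the `b`-edges and `y` on the `t`-edges outside `D` whose
difference jumps by `dem` across the `r`-edges. -/
structure Part (κ : V → ℤˣ) (A B : Set V) (dem lam y : V → ℤ) : Prop where
  lam_b : ∀ v, lam (S.b v) = lam v
  lam_off : ∀ v, v ∉ A → lam v = 0
  y_t : ∀ v, y (S.t v) = S.s v * y v
  y_D : ∀ v, S.D v → y v = 0
  y_off : ∀ v, ¬ S.D v → v ∉ B → y v = S.θ v
  flux : ∀ v, κ v * ((lam (S.r v) - lam v) - (y (S.r v) - y v)) = dem v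

/-- Collections of `r`-`b`-circuits and `r`-`t`-circuits grown one by one from a root. -/
inductive Stage (κ : V → ℤˣ) (v₀ : V) : Set V → Set V → Prop
  | base (h : ∀ w ∈ S.circC v₀, κ (S.r w) = -κ w ∧ κ (S.b w) = -κ w) : Stage κ v₀ (S.circC v₀) ∅
  | addO {A B : Set V} (h : Stage κ v₀ A B) (v : V) (hA : v ∈ A) (hD : ¬ S.D v) (hB : v ∉ B)
      (hκ : ∀ w ∈ S.circO v, κ (S.r w) = -κ w ∧ κ (S.t w) = -S.s w * κ w) :
      Stage κ v₀ A (B ∪ S.circO v)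
  | addC {A B : Set V} (h : Stage κ v₀ A B) (v : V) (hB : v ∈ B) (hA : v ∉ A)
      (hκ : ∀ w ∈ S.circC v, κ (S.r w) = -κ w ∧ κ (S.b w) = -κ w) :
      Stage κ v₀ (A ∪ S.circC v) B

variable {S} {κ : V → ℤˣ} {A B : Set V} {dem lam y : V → ℤ}

theorem Part.base (hD : ∀ v, S.D v → y v = 0) (hy : ∀ v, ¬ S.D v → y v = S.θ v) (κ : V → ℤˣ) :
    S.Part κ A B 0 0 y where
  lam_b _ := rfl
  lam_off _ _ := rfl
  y_t v := by
    by_cases h : S.D v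
    · rw [hD _ h, hD _ ((S.D_t v).2 h), mul_zero]
    · rw [hy _ h, hy _ (fun h' => h ((S.D_t v).1 h')), S.θ_t v h, Units.val_mul]
  y_D := hD
  y_off v h _ := hy v h
  flux v := by
    by_cases h : S.D v
    · simp [hD _ h, hD _ ((S.D_r v).2 h)]
    · simp [hy _ h, hy _ (fun h' => h ((S.D_r v).1 h')), S.θ_r v h]

theorem Part.mono {A' B' : Set V} (h : S.Part κ A B dem lam y) (hA : A ⊆ A') (hB : B ⊆ B') :
    S.Part κ A' B' dem lam y :=
  ⟨h.lam_b, fun v hv => h.lam_off v fun h' => hv (hA h'), h.y_t, h.y_D,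
    fun v hv hv' => h.y_off v hv fun h' => hv' (hB h'), h.flux⟩

theorem Part.congr {dem' : V → ℤ} (h : S.Part κ A B dem lam y) (hd : ∀ v, dem v = dem' v) :
    S.Part κ A B dem' lam y := by
  have : dem = dem' := funext hd
  rwa [← this]

/-- Off `D`, `θ` is constant across `r`-edges, so adding `θ * G` to `y` produces a jump `θ` times
that of `G`. Hence the circuit is oriented by `κ * θ`, not by `κ`. -/
theorem Part.addO (h : S.Part κ A B dem lam y) {v : V} (hv : ¬ S.D v) {G f dem' : V → ℤ}
    (hGt : ∀ w, G (S.t w) = G w) (hG : ∀ w, w ∉ S.circO v → G w = 0)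
    (hf : ∀ w, ((κ w * S.θ w : ℤˣ) : ℤ) * (G (S.r w) - G w) = f w)
    (hd : ∀ w, dem' w = dem w - f w) :
    S.Part κ A (B ∪ S.circO v) dem' lam (fun w => y w + S.θ w * G w) where
  lam_b := h.lam_b
  lam_off := h.lam_off
  y_t w := by
    by_cases hw : w ∈ S.circO v
    · rw [h.y_t, hGt, S.θ_t w (not_D_of_mem_circO hw hv), Units.val_mul]
      ring
    · rw [h.y_t, hG w hw, hGt, hG w hw]
      ring
  y_D w hw := by
    have : w ∉ S.circO v := fun h' => not_D_of_mem_circO h' hv hw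
    rw [h.y_D w hw, hG w this, mul_zero, add_zero]
  y_off w hw hw' := by
    simp only [Set.mem_union, not_or] at hw'
    rw [h.y_off w hw hw'.1, hG w hw'.2, mul_zero, add_zero]
  flux w := by
    have h1 := h.flux w
    have h2 := hf w
    rw [Units.val_mul] at h2
    have h3 : (S.θ (S.r w) : ℤ) * G (S.r w) = S.θ w * G (S.r w) := by
      by_cases hw : w ∈ S.circO v
      · rw [S.θ_r w (not_D_of_mem_circO hw hv)]
      · rw [hG _ (fun h' => hw (circO_r.1 h'))]; simp
    rw [hd, h3]
    linear_combination h1 - h2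

theorem Part.addC (h : S.Part κ A B dem lam y) {v : V} {G f dem' : V → ℤ}
    (hGb : ∀ w, G (S.b w) = G w) (hG : ∀ w, w ∉ S.circC v → G w = 0)
    (hf : ∀ w, κ w * (G (S.r w) - G w) = f w)
    (hd : ∀ w, dem' w = dem w + f w) :
    S.Part κ (A ∪ S.circC v) B dem' (fun w => lam w + G w) y where
  lam_b w := by simp only [h.lam_b, hGb]
  lam_off w hw := by
    simp only [Set.mem_union, not_or] at hw
    rw [h.lam_off w hw.1, hG w hw.2, add_zero]
  y_t := h.y_t
  y_D := h.y_D
  y_off := h.y_off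
  flux w := by
    rw [hd]
    linear_combination h.flux w + hf w

variable {v₀ : V}

theorem Stage.circC_subset (h : S.Stage κ v₀ A B) : ∀ v ∈ A, S.circC v ⊆ A := by
  induction h with
  | base => exact fun v hv => (circC_of_mem hv).subset
  | addO _ _ _ _ _ _ ih => exact ih
  | addC _ v _ _ _ ih =>
    rintro w (hw | hw)
    · exact (ih w hw).trans Set.subset_union_left
    · rw [circC_of_mem hw]
      exact Set.subset_union_right

theorem Stage.circO_subset (h : S.Stage κ v₀ A B) : ∀ v ∈ B, S.circO v ⊆ B := by
  induction h with
  | base => exact fun v hv => hv.elim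
  | addC _ _ _ _ _ ih => exact ih
  | addO _ v _ _ _ _ ih =>
    rintro w (hw | hw)
    · exact (ih w hw).trans Set.subset_union_left
    · rw [circO_of_mem hw]
      exact Set.subset_union_right

theorem Stage.not_D (h : S.Stage κ v₀ A B) : ∀ v ∈ B, ¬ S.D v := by
  induction h with
  | base => exact fun v hv => hv.elim
  | addC _ _ _ _ _ ih => exact ih
  | addO _ v _ hD _ _ ih =>
    rintro w (hw | hw)
    · exact ih w hw
    · exact not_D_of_mem_circO hw hD

theorem Stage.root_mem (h : S.Stage κ v₀ A B) : v₀ ∈ A := by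
  induction h with
  | base => exact mem_circC_self _
  | addO _ _ _ _ _ _ ih => exact ih
  | addC _ _ _ _ _ ih => exact Or.inl ih

theorem Stage.circC_disjoint (h : S.Stage κ v₀ A B) {v w : V} (hv : v ∉ A) (hw : w ∈ S.circC v) :
    w ∉ A :=
  fun h' => hv (h.circC_subset w h' (by rw [circC_of_mem hw]; exact mem_circC_self v))

theorem Stage.circO_disjoint (h : S.Stage κ v₀ A B) {v w : V} (hv : v ∉ B) (hw : w ∈ S.circO v) :
    w ∉ B :=
  fun h' => hv (h.circO_subset w h' (by rw [circO_of_mem hw]; exact mem_circO_self v))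

theorem Stage.r_mem (h : S.Stage κ v₀ A B) {v : V} (hv : v ∈ A) : S.r v ∈ A :=
  h.circC_subset v hv (Conn.left v)

theorem Stage.r_mem_iff (h : S.Stage κ v₀ A B) {v : V} : S.r v ∈ A ↔ v ∈ A :=
  ⟨fun h' => by have := h.r_mem h'; rwa [S.hr.inv] at this, h.r_mem⟩

theorem Stage.b_mem_iff (h : S.Stage κ v₀ A B) {v : V} : S.b v ∈ A ↔ v ∈ A :=
  ⟨fun h' => by have := h.circC_subset _ h' (Conn.right _); rwa [S.hb.inv] at this,
    fun h' => h.circC_subset _ h' (Conn.right _)⟩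

/-- Only the values of `κ` on collected circuits matter, so `κ` may be redefined on a circuit about
to be added. -/
theorem Stage.congr {κ' : V → ℤˣ} (h : S.Stage κ v₀ A B) (hκ : ∀ v ∈ A ∪ B, κ' v = κ v) :
    S.Stage κ' v₀ A B := by
  induction h with
  | base h =>
    refine .base fun w hw => ?_
    rw [hκ w (.inl hw), hκ _ (.inl (circC_r.2 hw)), hκ _ (.inl (circC_b.2 hw))]
    exact h w hw
  | addO h v hA hD hB hκ' ih =>
    refine .addO (ih fun v hv => hκ v ?_) v hA hD hB fun w hw => ?_
    · exact hv.imp_right Or.inl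
    · rw [hκ w (.inr (.inr hw)), hκ _ (.inr (.inr (circO_r.2 hw))),
        hκ _ (.inr (.inr (circO_t.2 hw)))]
      exact hκ' w hw
  | addC h v hA hB hκ' ih =>
    refine .addC (ih fun v hv => hκ v ?_) v hA hB fun w hw => ?_
    · exact hv.imp_left Or.inl
    · rw [hκ w (.inl (.inr hw)), hκ _ (.inl (.inr (circC_r.2 hw))),
        hκ _ (.inl (.inr (circC_b.2 hw)))]
      exact hκ' w hw

theorem Stage.good (h : S.Stage κ v₀ A B) :
    (∀ w ∈ A, κ (S.r w) = -κ w ∧ κ (S.b w) = -κ w) ∧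
      ∀ w ∈ B, κ (S.r w) = -κ w ∧ κ (S.t w) = -S.s w * κ w := by
  induction h with
  | base h => exact ⟨h, fun w hw => hw.elim⟩
  | addO _ v _ _ _ hκ ih => exact ⟨ih.1, fun w hw => hw.elim (ih.2 w) (hκ w)⟩
  | addC _ v _ _ hκ ih => exact ⟨fun w hw => hw.elim (ih.1 w) (hκ w), ih.2⟩

variable (S)

/-- A part with demand `w` at the `r`-edge of `v`, and `-w` at the root. -/
def HasPath (κ : V → ℤˣ) (v₀ : V) (A B : Set V) (w : ℤ) (v : V) : Prop :=
  ∃ lam y : V → ℤ, S.Part κ A B (fun x => w * (ind S.r v x - ind S.r v₀ x)) lam y ∧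
    (∀ x, lam x = 0 ∨ lam x = w) ∧ ∀ x, ¬ S.D x → y x ≠ 0 ∧ |y x| + w ≤ 3

/-- A part with unit demands at the `r`-edges of `v₁` and `v₂`. -/
def HasPair (κ : V → ℤˣ) (v₀ : V) (A B : Set V) (v₁ v₂ : V) : Prop :=
  ∃ lam y lo : V → ℤ, S.Part κ A B (fun x => ind S.r v₁ x + ind S.r v₂ x - 2 * ind S.r v₀ x) lam y ∧
    (∀ x, 0 ≤ lam x ∧ lam x ≤ 2) ∧ (∀ x, ¬ S.D x → y x ≠ 0 ∧ |y x| ≤ 3) ∧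
    (∀ x, lo (S.r x) = lo x ∧ lo (S.b x) = lo x) ∧ (∀ x, lo x = -3 ∨ lo x = -2) ∧
    ∀ x, ¬ S.D x → lo x ≤ lam x - y x ∧ lam x - y x ≤ lo x + 7

/-- A double path to an edge of the `r`-`t`-circuit of `v` such that no `r`-edge of that circuit
lies inside the path. -/
def HasSpec (κ : V → ℤˣ) (v₀ : V) (A B : Set V) (v : V) : Prop :=
  ∃ u ∈ A, u ∈ S.circO v ∧ ∃ lam y a : V → ℤ,
    S.Part κ A B (fun x => 2 * (ind S.r u x - ind S.r v₀ x)) lam y ∧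
    (∀ x, lam x = 0 ∨ lam x = 2) ∧ (∀ x, ¬ S.D x → y x ≠ 0 ∧ |y x| ≤ 1) ∧
    (∀ x, a (S.r x) = a x ∧ a (S.b x) = a x) ∧ (∀ x, a x = 0 ∨ a x = 2) ∧
    (∀ x, x ∉ A → a x = 0) ∧ ∀ x ∈ S.circO v, lam x = a x ∨ lam (S.r x) = a x

variable {S}

theorem HasPair.symm {v₁ v₂ : V} (h : S.HasPair κ v₀ A B v₁ v₂) : S.HasPair κ v₀ A B v₂ v₁ := by
  obtain ⟨lam, y, lo, h1, h2⟩ := h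
  exact ⟨lam, y, lo, h1.congr fun v => by ring, h2⟩

theorem HasPair.mono {A' B' : Set V} {v₁ v₂ : V} (h : S.HasPair κ v₀ A B v₁ v₂) (hA : A ⊆ A')
    (hB : B ⊆ B') : S.HasPair κ v₀ A' B' v₁ v₂ := by
  obtain ⟨lam, y, lo, h1, h2⟩ := h
  exact ⟨lam, y, lo, h1.mono hA hB, h2⟩

theorem HasPath.mono {A' B' : Set V} {w : ℤ} {v : V} (h : S.HasPath κ v₀ A B w v) (hA : A ⊆ A')
    (hB : B ⊆ B') : S.HasPath κ v₀ A' B' w v := by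
  obtain ⟨lam, y, h1, h2⟩ := h
  exact ⟨lam, y, h1.mono hA hB, h2⟩

theorem HasSpec.mono {A' B' : Set V} {v : V} (h : S.HasSpec κ v₀ A B v) (hA : A ⊆ A')
    (hB : B ⊆ B') : S.HasSpec κ v₀ A' B' v := by
  obtain ⟨u, hu, hu', lam, y, a, h1, h2, h3, h4, h5, h6, h7⟩ := h
  exact ⟨u, hA hu, hu', lam, y, a, h1.mono hA hB, h2, h3, h4, h5, fun x hx => h6 x fun h => hx (hA h), h7⟩

/-- A unit segment along an `r`-`t`-circuit on which `κ` is good. -/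
theorem exists_segmentO [Finite V] {v : V} (hv : ¬ S.D v)
    (hκ : ∀ w ∈ S.circO v, κ (S.r w) = -κ w ∧ κ (S.t w) = -S.s w * κ w) {z u : V}
    (hz : z ∈ S.circO v) (hu : u ∈ S.circO v) :
    ∃ g : V → ℤ, (∀ x, g x = 0 ∨ g x = 1) ∧ (∀ x, x ∉ S.circO v → g x = 0) ∧
      (∀ x, g (S.t x) = g x) ∧
      ∀ x, ((κ x * S.θ x : ℤˣ) : ℤ) * (g (S.r x) - g x) = ind S.r u x - ind S.r z x := by
  have hzv := circO_of_mem hz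
  obtain ⟨u', hu', -, g, h1, h2, h3, h4, -⟩ := exists_segment S.hr S.ht (fun x => κ x * S.θ x) z
    (fun x hx => by
      have hx' : x ∈ S.circO v := hzv ▸ hx
      have hD := not_D_of_mem_circO hx' hv
      rw [(hκ x hx').1, (hκ x hx').2, S.θ_r x hD, S.θ_t x hD]
      refine ⟨by rw [neg_mul], ?_⟩
      rw [neg_mul, neg_mul, mul_mul_mul_comm, Int.units_mul_self, one_mul])
    (fun x => x = u ∨ x = S.r u) (by rintro x (rfl | rfl) <;> simp [S.hr.inv])
    ⟨u, Or.inl rfl, show u ∈ S.circO z by rwa [hzv]⟩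
  refine ⟨g, h1, fun x hx => h2 x (fun h => hx (hzv ▸ h)), h3, fun x => ?_⟩
  rw [h4]
  rcases hu' with rfl | rfl
  · rfl
  · congr 1
    by_cases hx : x = u ∨ x = S.r u
    · rw [ind_eq_one hx, ind_eq_one]
      rw [S.hr.inv]; exact hx.symm
    · push Not at hx
      rw [ind_eq_zero hx.1 hx.2, ind_eq_zero hx.2]
      rw [S.hr.inv]; exact hx.1

/-- A unit segment along an `r`-`b`-circuit on which `κ` is good. -/
theorem exists_segmentC [Finite V] {v : V}
    (hκ : ∀ w ∈ S.circC v, κ (S.r w) = -κ w ∧ κ (S.b w) = -κ w) {u : V} (hu : u ∈ S.circC v) :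
    ∃ g : V → ℤ, (∀ x, g x = 0 ∨ g x = 1) ∧ (∀ x, x ∉ S.circC v → g x = 0) ∧
      (∀ x, g (S.b x) = g x) ∧
      ∀ x, (κ x : ℤ) * (g (S.r x) - g x) = ind S.r u x - ind S.r v x := by
  obtain ⟨u', hu', -, g, h1, h2, h3, h4, -⟩ := exists_segment S.hr S.hb κ v hκ
    (fun x => x = u ∨ x = S.r u) (by rintro x (rfl | rfl) <;> simp [S.hr.inv])
    ⟨u, Or.inl rfl, hu⟩
  refine ⟨g, h1, h2, h3, fun x => ?_⟩
  rw [h4]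
  rcases hu' with rfl | rfl
  · rfl
  · congr 1
    by_cases hx : x = u ∨ x = S.r u
    · rw [ind_eq_one hx, ind_eq_one]
      rw [S.hr.inv]; exact hx.symm
    · push Not at hx
      rw [ind_eq_zero hx.1 hx.2, ind_eq_zero hx.2]
      rw [S.hr.inv]; exact hx.1

/-- The starting point: no flow on the `b`-edges, and `±1` given by `θ` around each `r`-`t`-circuit
outside `D`. -/
theorem exists_base (S : Cfg V) (κ : V → ℤˣ) (A B : Set V) : ∃ y : V → ℤ, S.Part κ A B 0 0 y ∧
    ∀ x, ¬ S.D x → y x ≠ 0 ∧ |y x| ≤ 1 := by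
  classical
  refine ⟨fun v => if S.D v then 0 else S.θ v, Part.base (fun v h => by simp [h])
    (fun v h => by simp [h]) κ, fun x hx => ?_⟩
  rcases Int.units_eq_one_or (S.θ x) with h | h <;> simp [hx, h]

end Cfg

end SignedCubic

/-! ### Extending paths and pairs of paths by one circuit. -/

namespace SignedCubic

namespace Cfg

variable {V : Type*} [Finite V] {S : Cfg V} {κ : V → ℤˣ} {v₀ : V} {A B : Set V}

theorem HasPath.addO (h : S.Stage κ v₀ A B) {v : V} (hv : ¬ S.D v) (hB : v ∉ B)
    (hκ : ∀ w ∈ S.circO v, κ (S.r w) = -κ w ∧ κ (S.t w) = -S.s w * κ w) {z u : V}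
    (hz : z ∈ S.circO v) (hu : u ∈ S.circO v) {w : ℤ} (hw : w = 1 ∨ w = 2)
    (hp : S.HasPath κ v₀ A B w z) : S.HasPath κ v₀ A (B ∪ S.circO v) w u := by
  classical
  obtain ⟨lam, y, h1, h2, h3⟩ := hp
  obtain ⟨g, g1, g2, g3, g4⟩ := exists_segmentO hv hκ hu hz
  -- For `w = 1` the new `y` is `θ * (1 + g)`, of size 1 or 2. For `w = 2` the shift by `-2`, which
  -- is constant on the circuit and has no flux, gives `θ * (2 * g - 1)`, of size 1. In both cases
  -- `|y| + w ≤ 3`.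
  let G : V → ℤ := fun x => w * g x - if x ∈ S.circO v then 2 * (w - 1) else 0
  refine ⟨lam, _, h1.addO hv (G := G) (f := fun x => w * (ind S.r z x - ind S.r u x)) (fun x => ?_)
    (fun x hx => ?_) (fun x => ?_) (fun x => ?_), h2, fun x hx => ?_⟩
  · simp only [G, g3, circO_t]
  · simp only [G, g2 x hx, if_neg hx]; ring
  · rw [← g4]
    simp only [G, circO_r]
    ring
  · ring
  · by_cases hxO : x ∈ S.circO v
    · simp only [G, if_pos hxO]
      rw [h1.y_off x hx (h.circO_disjoint hB hxO)]
      rcases g1 x with hg | hg <;> rcases Int.units_eq_one_or (S.θ x) with hθ | hθ <;>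
        rcases hw with rfl | rfl <;> simp [hg, hθ]
    · simp only [G, if_neg hxO, g2 x hxO]
      have := h3 x hx
      simpa using this

/-- One unit is passed along the new circuit, so there `|y| ≤ 2` with the sign of `θ`. With `lam`
between 0 and 2, `lam - y` lies in `[-2, 4]`, which fits both windows `[-3, 4]` and `[-2, 5]`. -/
theorem HasPair.addO (h : S.Stage κ v₀ A B) {v : V} (hv : ¬ S.D v) (hB : v ∉ B)
    (hκ : ∀ w ∈ S.circO v, κ (S.r w) = -κ w ∧ κ (S.t w) = -S.s w * κ w) {z u v₂ : V}
    (hz : z ∈ S.circO v) (hu : u ∈ S.circO v)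
    (hp : S.HasPair κ v₀ A B z v₂) : S.HasPair κ v₀ A (B ∪ S.circO v) u v₂ := by
  classical
  obtain ⟨lam, y, lo, h1, h2, h3, h4, h5, h6⟩ := hp
  obtain ⟨g, g1, g2, g3, g4⟩ := exists_segmentO hv hκ hu hz
  have hx : ∀ x ∈ S.circO v, y x + S.θ x * g x = S.θ x * (1 + g x) := fun x hx => by
    rw [h1.y_off x (not_D_of_mem_circO hx hv) (h.circO_disjoint hB hx)]; ring
  refine ⟨lam, _, lo, h1.addO hv g3 g2 g4 (fun x => by ring), h2, fun x hxD => ?_, h4, h5,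
    fun x hxD => ?_⟩
  · by_cases hxO : x ∈ S.circO v
    · rw [hx x hxO]
      rcases g1 x with hg | hg <;> rcases Int.units_eq_one_or (S.θ x) with hθ | hθ <;>
        simp [hg, hθ]
    · simpa [g2 x hxO] using h3 x hxD
  · by_cases hxO : x ∈ S.circO v
    · rw [hx x hxO]
      have := h2 x
      have := h5 x
      rcases g1 x with hg | hg <;> rcases Int.units_eq_one_or (S.θ x) with hθ | hθ <;>
        simp only [hg, hθ, Units.val_one, Units.val_neg] <;> omega
    · simpa [g2 x hxO] using h6 x hxD

/-- Both units travel on the new circuit, so `y` may reach `±3`, and `lam - y` could a priori range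
over the nine values of `[-3, 5]`. But each `r`-edge of the circuit has an end with `lam = a`, and
inside `A` no demand sits on these edges (the targets are outside `A`, the root is in `D`), so `lam
- y` agrees at both ends. It thus lies in `[a - 3, a + 3]`, and `lo = a / 2 - 3` works for `a = 0`
and `a = 2`. -/
theorem HasSpec.addO (h : S.Stage κ v₀ A B) (hv₀ : S.D v₀) {v : V} (hv : ¬ S.D v) (hB : v ∉ B)
    (hκ : ∀ w ∈ S.circO v, κ (S.r w) = -κ w ∧ κ (S.t w) = -S.s w * κ w) {v₁ v₂ : V}
    (hv₁ : v₁ ∈ S.circO v) (hv₂ : v₂ ∈ S.circO v) (hA₁ : v₁ ∉ A) (hA₂ : v₂ ∉ A)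
    (hp : S.HasSpec κ v₀ A B v) : S.HasPair κ v₀ A (B ∪ S.circO v) v₁ v₂ := by
  classical
  obtain ⟨u, huA, hu, lam, y, a, h1, h2, h3, h4, h5, h6, h7⟩ := hp
  obtain ⟨g, g1, g2, g3, g4⟩ := exists_segmentO hv hκ hv₁ hu
  obtain ⟨g', g1', g2', g3', g4'⟩ := exists_segmentO hv hκ hv₂ hu
  have hx : ∀ x ∈ S.circO v, y x + S.θ x * (g x + g' x) = S.θ x * (1 + g x + g' x) :=
    fun x hx => by
      rw [h1.y_off x (not_D_of_mem_circO hx hv) (h.circO_disjoint hB hx)]; ring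
  have hpart : S.Part κ A (B ∪ S.circO v) (fun x => ind S.r v₁ x + ind S.r v₂ x
      - 2 * ind S.r v₀ x) lam (fun x => y x + S.θ x * (g x + g' x)) :=
    h1.addO hv (G := fun x => g x + g' x)
      (f := fun x => 2 * ind S.r u x - ind S.r v₁ x - ind S.r v₂ x)
      (fun x => by simp only [g3, g3']) (fun x hx => by simp only [g2 x hx, g2' x hx, add_zero])
      (fun x => by linear_combination g4 x + g4' x) (fun x => by ring)
  have habs : ∀ x ∈ S.circO v, y x + S.θ x * (g x + g' x) ≠ 0 ∧
      |y x + S.θ x * (g x + g' x)| ≤ 3 := fun x hxO => by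
    rw [hx x hxO]
    rcases g1 x with hg | hg <;> rcases g1' x with hg' | hg' <;>
      rcases Int.units_eq_one_or (S.θ x) with hθ | hθ <;> simp [hg, hg', hθ]
  refine ⟨lam, _, fun x => a x / 2 - 3, hpart, fun x => ?_, fun x hxD => ?_, fun x => ?_,
    fun x => ?_, fun x hxD => ?_⟩
  · rcases h2 x with h | h <;> omega
  · by_cases hxO : x ∈ S.circO v
    · exact habs x hxO
    · have := h3 x hxD
      simp only [g2 x hxO, g2' x hxO, add_zero, mul_zero]
      exact ⟨this.1, by omega⟩
  · simp only [h4, and_self]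
  · beta_reduce
    rcases h5 x with h | h <;> rw [h] <;> norm_num
  · beta_reduce
    by_cases hxO : x ∈ S.circO v
    · have hb := abs_le.1 (habs x hxO).2
      by_cases hxA : x ∈ A
      · rcases h7 x hxO with h8 | h8
        · rw [h8]
          rcases h5 x with h9 | h9 <;> rw [h9] <;> omega
        · have hf := hpart.flux x
          have hrA : ∀ v ∈ A, S.r v ∈ A := fun v hv => h.r_mem hv
          have hnA : ∀ v, v ∉ A → S.r v ∉ A := fun v hv => fun h' => hv (h.r_mem_iff.1 h')
          rw [ind_of_not_closed S.hr hrA hA₁ hxA, ind_of_not_closed S.hr hrA hA₂ hxA,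
            ind_of_closed (P := S.D) (fun v h => (S.D_r v).2 h) hv₀ hxD] at hf
          simp only [add_zero, mul_zero, sub_zero, mul_eq_zero, Units.ne_zero, false_or] at hf
          have hb' := abs_le.1 (habs (S.r x) (circO_r.2 hxO)).2
          rw [h8] at hf
          rcases h5 x with h9 | h9 <;> rw [h9] at hf ⊢ <;> omega
      · rw [h1.lam_off x hxA, h6 x hxA]
        omega
    · have h8 := h3 x hxD
      have h9 := abs_le.1 h8.2
      simp only [g2 x hxO, g2' x hxO, add_zero, mul_zero]
      rcases h2 x with h | h <;> rcases h5 x with h' | h' <;> rw [h, h'] <;> omega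

theorem HasPath.addC (h : S.Stage κ v₀ A B) {v : V} (hA : v ∉ A)
    (hκ : ∀ w ∈ S.circC v, κ (S.r w) = -κ w ∧ κ (S.b w) = -κ w) {u : V} (hu : u ∈ S.circC v)
    {w : ℤ} (hp : S.HasPath κ v₀ A B w v) : S.HasPath κ v₀ (A ∪ S.circC v) B w u := by
  obtain ⟨lam, y, h1, h2, h3⟩ := hp
  obtain ⟨g, g1, g2, g3, g4⟩ := exists_segmentC hκ hu
  refine ⟨_, y, h1.addC (G := fun x => w * g x) (fun x => by simp only [g3])
    (fun x hx => by simp [g2 x hx]) (f := fun x => w * (ind S.r u x - ind S.r v x))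
    (fun x => by rw [← g4]; ring) (fun x => by ring), fun x => ?_, h3⟩
  by_cases hx : x ∈ S.circC v
  · rw [h1.lam_off x (h.circC_disjoint hA hx)]
    rcases g1 x with hg | hg <;> simp [hg]
  · rw [g2 x hx]
    simpa using h2 x

/-- On the new circuit `lam` is only 0 or 1, so the window from `-3` to `4` admits every `|y| ≤ 3`
there. -/
theorem HasPair.addC (h : S.Stage κ v₀ A B) {v : V} (hA : v ∉ A)
    (hκ : ∀ w ∈ S.circC v, κ (S.r w) = -κ w ∧ κ (S.b w) = -κ w) {u v₂ : V} (hu : u ∈ S.circC v)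
    (hp : S.HasPair κ v₀ A B v v₂) : S.HasPair κ v₀ (A ∪ S.circC v) B u v₂ := by
  classical
  obtain ⟨lam, y, lo, h1, h2, h3, h4, h5, h6⟩ := hp
  obtain ⟨g, g1, g2, g3, g4⟩ := exists_segmentC hκ hu
  refine ⟨_, y, fun x => if x ∈ S.circC v then -3 else lo x, h1.addC g3 g2 g4 (fun x => by ring),
    fun x => ?_, h3, fun x => ?_, fun x => ?_, fun x hxD => ?_⟩
  · by_cases hx : x ∈ S.circC v
    · rw [h1.lam_off x (h.circC_disjoint hA hx)]
      rcases g1 x with hg | hg <;> simp [hg]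
    · rw [g2 x hx]
      simpa using h2 x
  · simp only [circC_r, circC_b, h4, and_self]
  · beta_reduce
    split_ifs
    · exact Or.inl rfl
    · exact h5 x
  · beta_reduce
    by_cases hx : x ∈ S.circC v
    · rw [h1.lam_off x (h.circC_disjoint hA hx), if_pos hx]
      have := abs_le.1 (h3 x hxD).2
      rcases g1 x with hg | hg <;> rw [hg] <;> omega
    · rw [g2 x hx, if_neg hx, add_zero]
      exact h6 x hxD

/-- The double path splits on the new circuit into two unit paths. Its bound `|y| ≤ 1` leaves room
for `lam` up to 2. -/
theorem HasPath.pair_addC (h : S.Stage κ v₀ A B) {v : V} (hA : v ∉ A)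
    (hκ : ∀ w ∈ S.circC v, κ (S.r w) = -κ w ∧ κ (S.b w) = -κ w) {v₁ v₂ : V}
    (hv₁ : v₁ ∈ S.circC v) (hv₂ : v₂ ∈ S.circC v) (hp : S.HasPath κ v₀ A B 2 v) :
    S.HasPair κ v₀ (A ∪ S.circC v) B v₁ v₂ := by
  obtain ⟨lam, y, h1, h2, h3⟩ := hp
  obtain ⟨g, g1, g2, g3, g4⟩ := exists_segmentC hκ hv₁
  obtain ⟨g', g1', g2', g3', g4'⟩ := exists_segmentC hκ hv₂
  have hlam : ∀ x, 0 ≤ lam x + (g x + g' x) ∧ lam x + (g x + g' x) ≤ 2 := fun x => by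
    by_cases hx : x ∈ S.circC v
    · rw [h1.lam_off x (h.circC_disjoint hA hx)]
      rcases g1 x with hg | hg <;> rcases g1' x with hg' | hg' <;> simp [hg, hg']
    · rw [g2 x hx, g2' x hx]
      rcases h2 x with h | h <;> simp [h]
  refine ⟨_, y, fun _ => -3, h1.addC (G := fun x => g x + g' x)
    (f := fun x => ind S.r v₁ x + ind S.r v₂ x - 2 * ind S.r v x) (fun x => by simp only [g3, g3'])
    (fun x hx => by simp only [g2 x hx, g2' x hx, add_zero])
    (fun x => by linear_combination g4 x + g4' x) (fun x => by ring), hlam, fun x hx => ?_,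
    fun x => ⟨rfl, rfl⟩, fun x => Or.inl rfl, fun x hx => ?_⟩
  · have := h3 x hx
    exact ⟨this.1, by omega⟩
  · beta_reduce
    have := abs_le.1 (le_sub_iff_add_le.2 (h3 x hx).2)
    have := hlam x
    omega

/-- The segment stops at the first `r`-edge of the target `r`-t`-circuit, so none of that circuit's
`r`-edges is interior to it. As the target circuit misses `A`, the earlier part of the path does not
touch it either. -/
theorem HasPath.spec_addC (h : S.Stage κ v₀ A B) {v : V} (hA : v ∉ A)
    (hκ : ∀ w ∈ S.circC v, κ (S.r w) = -κ w ∧ κ (S.b w) = -κ w) (hp : S.HasPath κ v₀ A B 2 v)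
    {x : V} (hx : ∀ z ∈ S.circO x, z ∉ A) {z : V} (hz : z ∈ S.circO x) (hz' : z ∈ S.circC v) :
    S.HasSpec κ v₀ (A ∪ S.circC v) B x := by
  classical
  obtain ⟨lam, y, h1, h2, h3⟩ := hp
  obtain ⟨u, hu, hu', g, g1, g2, g3, g4, c, hc, g5⟩ := exists_segment S.hr S.hb κ v hκ
    (fun w => w ∈ S.circO x) (fun w hw => circO_r.2 hw) ⟨z, hz, hz'⟩
  refine ⟨u, Or.inr hu', hu, _, y, fun w => if w ∈ S.circC v then 2 * c else 0,
    h1.addC (G := fun x => 2 * g x) (fun x => by simp only [g3])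
    (fun x hx => by simp [g2 x hx]) (f := fun x => 2 * (ind S.r u x - ind S.r v x))
    (fun x => by rw [← g4]; ring) (fun x => by ring), fun w => ?_, fun w hw => ?_, fun w => ?_,
    fun w => ?_, fun w hw => ?_, fun w hw => ?_⟩
  · by_cases hw : w ∈ S.circC v
    · rw [h1.lam_off w (h.circC_disjoint hA hw)]
      rcases g1 w with hg | hg <;> simp [hg]
    · rw [g2 w hw]
      simpa using h2 w
  · have := h3 w hw
    exact ⟨this.1, by omega⟩
  · simp only [circC_r, circC_b, and_self]
  · beta_reduce
    split_ifs
    · rcases hc with rfl | rfl <;> simp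
    · exact Or.inl rfl
  · exact if_neg fun h' => hw (Or.inr h')
  · beta_reduce
    rw [h1.lam_off w (hx w hw), h1.lam_off _ (hx _ (circO_r.2 hw))]
    by_cases hwC : w ∈ S.circC v
    · rw [if_pos hwC]
      rcases g5 w hw hwC with h' | h' <;> simp [h']
    · rw [if_neg hwC, g2 w hwC]
      simp

theorem HasPath.base (hκ : ∀ w ∈ S.circC v₀, κ (S.r w) = -κ w ∧ κ (S.b w) = -κ w) {u : V}
    (hu : u ∈ S.circC v₀) {w : ℤ} (hw : w = 1 ∨ w = 2) :
    S.HasPath κ v₀ (S.circC v₀) ∅ w u := by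
  obtain ⟨y, h1, h2⟩ := exists_base S κ ∅ ∅
  obtain ⟨g, g1, g2, g3, g4⟩ := exists_segmentC hκ hu
  have h3 := h1.addC (v := v₀) (G := fun x => w * g x) (fun x => by simp only [g3])
    (fun x hx => by simp [g2 x hx]) (f := fun x => w * (ind S.r u x - ind S.r v₀ x))
    (dem' := fun x => w * (ind S.r u x - ind S.r v₀ x))
    (fun x => by rw [← g4]; ring) (fun x => by simp)
  rw [Set.empty_union] at h3
  refine ⟨_, y, h3, fun x => ?_, fun x hx => ?_⟩
  · rcases g1 x with hg | hg <;> simp [hg]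
  · have := h2 x hx
    exact ⟨this.1, by omega⟩

theorem HasPair.base (hκ : ∀ w ∈ S.circC v₀, κ (S.r w) = -κ w ∧ κ (S.b w) = -κ w) {v₁ v₂ : V}
    (hv₁ : v₁ ∈ S.circC v₀) (hv₂ : v₂ ∈ S.circC v₀) :
    S.HasPair κ v₀ (S.circC v₀) ∅ v₁ v₂ := by
  obtain ⟨y, h1, h2⟩ := exists_base S κ ∅ ∅
  obtain ⟨g, g1, g2, g3, g4⟩ := exists_segmentC hκ hv₁
  obtain ⟨g', g1', g2', g3', g4'⟩ := exists_segmentC hκ hv₂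
  have h3 := h1.addC (v := v₀) (G := fun x => g x + g' x) (fun x => by simp only [g3, g3'])
    (fun x hx => by simp [g2 x hx, g2' x hx])
    (f := fun x => ind S.r v₁ x + ind S.r v₂ x - 2 * ind S.r v₀ x)
    (dem' := fun x => ind S.r v₁ x + ind S.r v₂ x - 2 * ind S.r v₀ x)
    (fun x => by linear_combination g4 x + g4' x) (fun x => by simp)
  rw [Set.empty_union] at h3
  have hlam : ∀ x, 0 ≤ g x + g' x ∧ g x + g' x ≤ 2 := fun x => by
    rcases g1 x with hg | hg <;> rcases g1' x with hg' | hg' <;> simp [hg, hg']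
  refine ⟨_, y, fun _ => -3, h3, fun x => by simpa using hlam x, fun x hx => ?_,
    fun x => ⟨rfl, rfl⟩, fun x => Or.inl rfl, fun x hx => ?_⟩
  · have := h2 x hx
    exact ⟨this.1, by omega⟩
  · have := abs_le.1 (h2 x hx).2
    have := hlam x
    simp only [Pi.zero_apply]
    omega

theorem HasSpec.base (hκ : ∀ w ∈ S.circC v₀, κ (S.r w) = -κ w ∧ κ (S.b w) = -κ w) {x z : V}
    (hz : z ∈ S.circO x) (hz' : z ∈ S.circC v₀) :
    S.HasSpec κ v₀ (S.circC v₀) ∅ x := by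
  classical
  obtain ⟨y, h1, h2⟩ := exists_base S κ ∅ ∅
  obtain ⟨u, hu, hu', g, g1, g2, g3, g4, c, hc, g5⟩ := exists_segment S.hr S.hb κ v₀ hκ
    (fun w => w ∈ S.circO x) (fun w hw => circO_r.2 hw) ⟨z, hz, hz'⟩
  have h3 := h1.addC (v := v₀) (G := fun x => 2 * g x) (fun x => by simp only [g3])
    (fun x hx => by simp [g2 x hx]) (f := fun x => 2 * (ind S.r u x - ind S.r v₀ x))
    (dem' := fun x => 2 * (ind S.r u x - ind S.r v₀ x))
    (fun x => by rw [← g4]; ring) (fun x => by simp)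
  rw [Set.empty_union] at h3
  refine ⟨u, hu', hu, _, y, fun w => if w ∈ S.circC v₀ then 2 * c else 0, h3, fun w => ?_, h2,
    fun w => ?_, fun w => ?_, fun w hw => if_neg hw, fun w hw => ?_⟩
  · rcases g1 w with hg | hg <;> simp [hg]
  · simp only [circC_r, circC_b, and_self]
  · beta_reduce
    split_ifs
    · rcases hc with rfl | rfl <;> simp
    · exact Or.inl rfl
  · beta_reduce
    by_cases hwC : w ∈ S.circC v₀
    · rw [if_pos hwC]
      rcases g5 w hw hwC with h' | h' <;> simp [h']
    · rw [if_neg hwC, g2 w hwC]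
      simp

/-- The three statements need a joint induction: a pair with both ends on a new `r`-`b`-circuit
arises by splitting a double path, and one with both ends on a new `r`-`t`-circuit, off `A`,
requires `HasSpec`. -/
theorem Stage.hasPath_hasPair_hasSpec (h : S.Stage κ v₀ A B) (hv₀ : S.D v₀) :
    (∀ v, v ∈ A ∪ B → ∀ w : ℤ, w = 1 ∨ w = 2 → S.HasPath κ v₀ A B w v) ∧
    (∀ v₁ v₂, v₁ ∈ A ∪ B → v₂ ∈ A ∪ B → S.HasPair κ v₀ A B v₁ v₂) ∧
    ∀ x ∈ A, x ∉ B → S.HasSpec κ v₀ A B x := by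
  induction h with
  | base hκ =>
    simp only [Set.union_empty]
    exact ⟨fun v hv w hw => .base hκ hv hw, fun v₁ v₂ h₁ h₂ => .base hκ h₁ h₂,
      fun x hx _ => .base hκ (mem_circO_self x) hx⟩
  | @addO A B h v hA hD hB hκ ih =>
    obtain ⟨ih1, ih2, ih3⟩ := ih
    have hl : A ∪ B ⊆ A ∪ (B ∪ S.circO v) := Set.union_subset_union_right _ Set.subset_union_left
    have hv : v ∈ A ∪ B := Or.inl hA
    have hcases : ∀ x, x ∈ A ∪ (B ∪ S.circO v) → x ∈ A ∪ B ∨ x ∈ S.circO v ∧ x ∉ A := by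
      rintro x (hx | hx | hx)
      · exact Or.inl (Or.inl hx)
      · exact Or.inl (Or.inr hx)
      · by_cases hx' : x ∈ A
        · exact Or.inl (Or.inl hx')
        · exact Or.inr ⟨hx, hx'⟩
    have hB' : B ⊆ B ∪ S.circO v := Set.subset_union_left
    refine ⟨fun x hx w hw => ?_, fun v₁ v₂ h₁ h₂ => ?_, fun x hx hx' => ?_⟩
    · rcases hcases x hx with hx | ⟨hx, -⟩
      · exact (ih1 x hx w hw).mono subset_rfl hB'
      · exact (ih1 v hv w hw).addO h hD hB hκ (mem_circO_self v) hx hw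
    · rcases hcases _ h₁ with h₁ | ⟨h₁, h₁'⟩ <;> rcases hcases _ h₂ with h₂ | ⟨h₂, h₂'⟩
      · exact (ih2 _ _ h₁ h₂).mono subset_rfl hB'
      · exact ((ih2 _ _ hv h₁).addO h hD hB hκ (mem_circO_self v) h₂).symm
      · exact (ih2 _ _ hv h₂).addO h hD hB hκ (mem_circO_self v) h₁
      · exact (ih3 v hA hB).addO h hv₀ hD hB hκ h₁ h₂ h₁' h₂'
    · exact (ih3 x hx fun h' => hx' (Or.inl h')).mono subset_rfl hB'
  | @addC A B h v hB hA hκ ih =>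
    obtain ⟨ih1, ih2, ih3⟩ := ih
    have hv : v ∈ A ∪ B := Or.inr hB
    have hcases : ∀ x, x ∈ (A ∪ S.circC v) ∪ B → x ∈ A ∪ B ∨ x ∈ S.circC v := by
      rintro x ((hx | hx) | hx)
      exacts [Or.inl (Or.inl hx), Or.inr hx, Or.inl (Or.inr hx)]
    have hA' : A ⊆ A ∪ S.circC v := Set.subset_union_left
    refine ⟨fun x hx w hw => ?_, fun v₁ v₂ h₁ h₂ => ?_, fun x hx hx' => ?_⟩
    · rcases hcases x hx with hx | hx
      · exact (ih1 x hx w hw).mono hA' subset_rfl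
      · exact (ih1 v hv w hw).addC h hA hκ hx
    · rcases hcases _ h₁ with h₁ | h₁ <;> rcases hcases _ h₂ with h₂ | h₂
      · exact (ih2 _ _ h₁ h₂).mono hA' subset_rfl
      · exact ((ih2 _ _ hv h₁).addC h hA hκ h₂).symm
      · exact (ih2 _ _ hv h₂).addC h hA hκ h₁
      · exact (ih1 v hv 2 (Or.inr rfl)).pair_addC h hA hκ h₁ h₂
    · by_cases hz : ∃ z ∈ S.circO x, z ∈ A
      · obtain ⟨z, hz, hzA⟩ := hz
        have hzB : z ∉ B := fun h' => hx' (h.circO_subset z h' (by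
          rw [circO_of_mem hz]; exact mem_circO_self x))
        have := (ih3 z hzA hzB).mono hA' (subset_refl B)
        unfold HasSpec at this ⊢
        rwa [circO_of_mem hz] at this
      · push Not at hz
        refine (ih1 v hv 2 (Or.inr rfl)).spec_addC h hA hκ hz (mem_circO_self x) ?_
        exact hx.resolve_left (hz x (mem_circO_self x))

end Cfg

end SignedCubic

/-! ### Solutions from sign conflicts. -/

namespace SignedCubic

theorem units_eq_neg_of_ne {a b : ℤˣ} (h : a ≠ b) : a = -b := by
  rcases Int.units_eq_one_or a with rfl | rfl <;> rcases Int.units_eq_one_or b with rfl | rfl <;>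
    simp_all

theorem units_eq_mul_of_mul_eq {a b c : ℤˣ} (h : a * b = c) : a = c * b := by
  rw [← h, mul_assoc, Int.units_mul_self, mul_one]

/-- A sign function that alternates along all circuits. -/
theorem exists_alternating [Finite V] {p q : V → V} (hp : FPF p) (hq : FPF q) :
    ∃ χ : V → ℤˣ, ∀ v, χ (p v) = -χ v ∧ χ (q v) = -χ v := by
  classical
  have := Fintype.ofFinite V
  have hneg : ∀ N : Finset V, negs N (fun _ => -1) = N.card := fun N => by simp [negs]
  obtain ⟨ε, hε⟩ := Bal.exists_global hp hq (α := fun _ => -1) (β := fun _ => -1) fun v => by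
    refine bal_of_negs hp hq _ _ (fun _ => rfl) (fun _ => rfl) v
      (Finset.univ.filter fun w => Conn p q v w) (by simp) ?_
    rw [← two_mul]
    refine two_mul_negs hp _ (fun w hw => ?_) _ (fun _ => rfl)
    simp only [Finset.mem_filter, Finset.mem_univ, true_and] at hw ⊢
    exact hw.trans (Conn.left w)
  exact ⟨ε, fun v => by simpa using hε v⟩

namespace Cfg

variable {V : Type*} (S : Cfg V)

/-- The data from which a nowhere-zero 8-flow can be read off. -/
def Solved : Prop :=
  ∃ lam y lo : V → ℤ, (∀ v, lam (S.b v) = lam v) ∧ (∀ v, lo (S.r v) = lo v ∧ lo (S.b v) = lo v) ∧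
    (∀ v, lam (S.r v) - y (S.r v) = lam v - y v) ∧ (∀ v, y (S.t v) = S.s v * y v) ∧
    (∀ v, y v ≠ 0 ∧ |y v| ≤ 3) ∧ (∀ v, lo v ≤ lam v ∧ lam v ≤ lo v + 7) ∧
    ∀ v, lo v ≤ lam v - y v ∧ lam v - y v ≤ lo v + 7

/-- `D` is a single circuit, and it is unbalanced. -/
structure OddCircuit : Prop where
  conn : ∀ u v, S.D u → S.D v → v ∈ S.circO u
  odd : ∀ v, S.D v → ¬ Bal S.r S.t (fun _ => 1) S.s v

variable {S} {κ : V → ℤˣ} {A B : Set V} {dem lam y : V → ℤ} {v₀ : V}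

theorem Part.solved (h : S.Part κ A B dem lam y) {z lo : V → ℤ} (hz : ∀ v, ¬ S.D v → z v = 0)
    (hzt : ∀ v, S.D v → z (S.t v) = S.s v * z v)
    (hzr : ∀ v, S.D v → κ v * (z (S.r v) - z v) = dem v) (hdem : ∀ v, ¬ S.D v → dem v = 0)
    (hlo : ∀ v, lo (S.r v) = lo v ∧ lo (S.b v) = lo v)
    (hlam : ∀ v, lo v ≤ lam v ∧ lam v ≤ lo v + 7)
    (hy : ∀ v, ¬ S.D v → y v ≠ 0 ∧ |y v| ≤ 3)
    (hw : ∀ v, ¬ S.D v → lo v ≤ lam v - y v ∧ lam v - y v ≤ lo v + 7)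
    (hy' : ∀ v, S.D v → z v ≠ 0 ∧ |z v| ≤ 3)
    (hw' : ∀ v, S.D v → lo v ≤ lam v - z v ∧ lam v - z v ≤ lo v + 7) : S.Solved := by
  refine ⟨lam, fun v => y v + z v, lo, h.lam_b, hlo, fun v => ?_, fun v => ?_, fun v => ?_, hlam,
    fun v => ?_⟩
  · have h1 := h.flux v
    have h2 : κ v * (z (S.r v) - z v) = dem v := by
      by_cases hv : S.D v
      · exact hzr v hv
      · rw [hz v hv, hz _ (fun h => hv ((S.D_r v).1 h)), hdem v hv]; simp
    have h3 : (κ v : ℤ) * ((lam (S.r v) - lam v) - (y (S.r v) - y v) - (z (S.r v) - z v)) = 0 := by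
      linear_combination h1 - h2
    have h4 := (mul_eq_zero.1 h3).resolve_left (κ v).ne_zero
    linear_combination h4
  · simp only [h.y_t]
    by_cases hv : S.D v
    · rw [hzt v hv]; ring
    · rw [hz v hv, hz _ (fun h => hv ((S.D_t v).1 h))]; ring
  · by_cases hv : S.D v
    · simpa [h.y_D v hv] using hy' v hv
    · simpa [hz v hv] using hy v hv
  · by_cases hv : S.D v
    · simpa [h.y_D v hv] using hw' v hv
    · simpa [hz v hv] using hw v hv

/-- `D` is framed with its only cut at the `r`-edge of `v₀`. The sign must change there, since
otherwise the frame would balance `D`. -/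
theorem OddCircuit.exists_frame [Finite V] (hS : S.OddCircuit) (hv₀ : S.D v₀) :
    ∃ ω : V → ℤˣ, ω v₀ = 1 ∧ ω (S.r v₀) = -1 ∧
      (∀ v, S.D v → ω (S.t v) = S.s v * ω v) ∧
      ∀ v, S.D v → v ≠ v₀ → v ≠ S.r v₀ → ω (S.r v) = ω v := by
  obtain ⟨ω, hω⟩ := SignedCubic.exists_frame S.ht S.hr S.s (fun _ => 1) S.s_t (fun _ => rfl) v₀
  simp only [one_mul] at hω
  have hc : ∀ u, S.D u → Conn S.t S.r v₀ u := fun u hu => (hS.conn v₀ u hv₀ hu).swap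
  have h1 : ω (S.r v₀) ≠ ω v₀ := fun h1 => hS.odd v₀ hv₀ ⟨ω, fun u hu => by
    have h2 := hω u hu.swap
    refine ⟨?_, h2.1⟩
    rw [one_mul]
    by_cases h3 : u = v₀
    · rw [h3, h1]
    by_cases h4 : u = S.r v₀
    · rw [h4, S.hr.inv, h1]
    exact h2.2 h3 h4⟩
  have h2 := units_eq_neg_of_ne h1
  refine ⟨fun v => ω v₀ * ω v, Int.units_mul_self _, ?_, fun v hv => ?_, fun v hv h3 h4 => ?_⟩
  · beta_reduce
    rw [h2, mul_neg, Int.units_mul_self]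
  · beta_reduce
    rw [(hω v (hc v hv)).1]; ac_rfl
  · beta_reduce
    rw [(hω v (hc v hv)).2 h3 h4]

/-- Placing the frame cut at the root on `D` creates values `±1` whose only jump, weighted by `κ`,
is `-2` at the root: exactly the demand left over. -/
theorem Part.solved_of_root [Finite V] (hS : S.OddCircuit) (hv₀ : S.D v₀)
    (hκ : κ (S.r v₀) = -κ v₀)
    (h : S.Part κ A B (fun x => -2 * ind S.r v₀ x) lam y) {lo : V → ℤ}
    (hlo : ∀ v, lo (S.r v) = lo v ∧ lo (S.b v) = lo v) (hlo' : ∀ v, lo v = -3 ∨ lo v = -2)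
    (hlam : ∀ v, 0 ≤ lam v ∧ lam v ≤ 2)
    (hy : ∀ v, ¬ S.D v → y v ≠ 0 ∧ |y v| ≤ 3)
    (hw : ∀ v, ¬ S.D v → lo v ≤ lam v - y v ∧ lam v - y v ≤ lo v + 7) : S.Solved := by
  classical
  obtain ⟨ω, h0, h1, h2, h3⟩ := hS.exists_frame hv₀
  refine h.solved (z := fun v => if S.D v then (κ v₀ * ω v : ℤˣ) else 0) (lo := lo)
    (fun v hv => if_neg hv) (fun v hv => ?_) (fun v hv => ?_) (fun v hv => ?_) hlo (fun v => ?_) hy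
    hw (fun v hv => ?_) (fun v hv => ?_)
  · simp only [S.D_t, if_pos hv, h2 v hv, Units.val_mul]; ring
  · simp only [S.D_r, if_pos hv]
    by_cases h4 : v = v₀
    · rw [h4, h0, h1, ind_self]
      rcases Int.units_eq_one_or (κ v₀) with h | h <;> simp [h]
    by_cases h5 : v = S.r v₀
    · rw [h5, S.hr.inv, h0, h1, ind_apply S.hr, ind_self, hκ]
      rcases Int.units_eq_one_or (κ v₀) with h | h <;> simp [h]
    · rw [h3 v hv h4 h5, ind_eq_zero h4 h5]
      ring
  · rw [ind_of_closed (P := S.D) (fun v h => (S.D_r v).2 h) hv₀ hv, mul_zero]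
  · have := hlam v
    rcases hlo' v with h | h <;> omega
  · simp only [if_pos hv]
    rcases Int.units_eq_one_or (κ v₀ * ω v) with h | h <;> simp [h]
  · simp only [if_pos hv]
    have := hlam v
    rcases Int.units_eq_one_or (κ v₀ * ω v) with h | h <;> rcases hlo' v with h' | h' <;>
      simp only [h, Units.val_one, Units.val_neg] <;> omega

/-- Send a unit to each of `v₁` and `v₂`. The sign `κ * θ` disagrees with the alternating
orientation `χ` at one of them and agrees at the other, so a unit segment joining them absorbs both
units rather than passing one on. Only the demand at the root remains. -/
theorem Stage.solved_of_conflictO [Finite V] (h : S.Stage κ v₀ A B) (hS : S.OddCircuit)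
    (hv₀ : S.D v₀) {χ : V → ℤˣ} (hχ : ∀ v, χ (S.r v) = -χ v ∧ χ (S.t v) = -χ v) {v₁ v₂ : V}
    (hD : ¬ S.D v₁) (hB : v₁ ∉ B) (h₁ : v₁ ∈ A) (h₂ : v₂ ∈ A) (hO : v₂ ∈ S.circO v₁)
    (hκ₁ : κ v₁ * S.θ v₁ * χ v₁ = -1) (hκ₂ : κ v₂ * S.θ v₂ * χ v₂ = 1) : S.Solved := by
  classical
  obtain ⟨lam, y, lo, h1, h2, h3, h4, h5, h6⟩ :=
    (h.hasPath_hasPair_hasSpec hv₀).2.1 v₁ v₂ (Or.inl h₁) (Or.inl h₂)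
  obtain ⟨u, hu, -, g, g1, g2, g3, g4, -⟩ := exists_segment S.hr S.ht χ v₁
    (fun v _ => hχ v) (fun x => x = v₂ ∨ x = S.r v₂) (by rintro x (rfl | rfl) <;> simp [S.hr.inv])
    ⟨v₂, Or.inl rfl, hO⟩
  have hD₂ := not_D_of_mem_circO hO hD
  have hne : ∀ x, x = v₁ ∨ x = S.r v₁ → κ x * S.θ x = -χ x := by
    rintro x (rfl | rfl)
    · rw [units_eq_mul_of_mul_eq hκ₁, neg_one_mul]
    · rw [(h.good.1 _ h₁).1, S.θ_r _ hD, (hχ _).1, neg_mul, units_eq_mul_of_mul_eq hκ₁, neg_one_mul]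
  have heq : ∀ x, x = v₂ ∨ x = S.r v₂ → κ x * S.θ x = χ x := by
    rintro x (rfl | rfl)
    · rw [units_eq_mul_of_mul_eq hκ₂, one_mul]
    · rw [(h.good.1 _ h₂).1, S.θ_r _ hD₂, (hχ _).1, neg_mul, units_eq_mul_of_mul_eq hκ₂, one_mul]
  have hu' : ∀ x, (x = u ∨ x = S.r u) ↔ (x = v₂ ∨ x = S.r v₂) := fun x => by
    rcases hu with rfl | rfl
    · rfl
    · rw [S.hr.inv]; exact or_comm
  have hf : ∀ x, ((κ x * S.θ x : ℤˣ) : ℤ) * (g (S.r x) - g x)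
      = ind S.r v₁ x + ind S.r v₂ x := fun x => by
    have h7 := g4 x
    by_cases hx1 : x = v₁ ∨ x = S.r v₁
    · have hx2 : ¬ (x = v₂ ∨ x = S.r v₂) := fun h' => by
        have := (hne x hx1).symm.trans (heq x h')
        rcases Int.units_eq_one_or (χ x) with h8 | h8 <;> rw [h8] at this <;> simp at this
      have hx3 := hx2
      rw [← hu'] at hx3
      push Not at hx2 hx3
      rw [ind_eq_one hx1, ind_eq_zero hx3.1 hx3.2] at h7
      rw [hne x hx1, ind_eq_one hx1, ind_eq_zero hx2.1 hx2.2, Units.val_neg]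
      linarith
    · by_cases hx2 : x = v₂ ∨ x = S.r v₂
      · rw [ind_eq_one ((hu' x).2 hx2)] at h7
        rw [heq x hx2, h7, ind_eq_one hx2]
        push Not at hx1
        rw [ind_eq_zero hx1.1 hx1.2]
        ring
      · have hx3 := hx2
        rw [← hu'] at hx3
        push Not at hx1 hx2 hx3
        rw [ind_eq_zero hx1.1 hx1.2, ind_eq_zero hx3.1 hx3.2, sub_zero, mul_eq_zero] at h7
        rw [ind_eq_zero hx1.1 hx1.2, ind_eq_zero hx2.1 hx2.2, h7.resolve_left (χ x).ne_zero]
        ring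
  have hx : ∀ x ∈ S.circO v₁, y x + S.θ x * g x = S.θ x * (1 + g x) := fun x hx => by
    rw [h1.y_off x (not_D_of_mem_circO hx hD) (h.circO_disjoint hB hx)]; ring
  refine Part.solved_of_root hS hv₀ (h.good.1 _ h.root_mem).1
    (h1.addO hD g3 g2 hf (fun x => by ring)) h4 h5 h2 (fun x hxD => ?_) (fun x hxD => ?_)
  · by_cases hxO : x ∈ S.circO v₁
    · rw [hx x hxO]
      rcases g1 x with hg | hg <;> rcases Int.units_eq_one_or (S.θ x) with hθ | hθ <;>
        simp [hg, hθ]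
    · simpa [g2 x hxO] using h3 x hxD
  · by_cases hxO : x ∈ S.circO v₁
    · rw [hx x hxO]
      have := h2 x
      have := h5 x
      rcases g1 x with hg | hg <;> rcases Int.units_eq_one_or (S.θ x) with hθ | hθ <;>
        simp only [hg, hθ, Units.val_one, Units.val_neg] <;> omega
    · simpa [g2 x hxO] using h6 x hxD

/-- Here the absorbing segment lies on an `r`-`b`-circuit outside `A`. There `lam` becomes 0 or 1,
and `lo` is reset to `-3`. -/
theorem Stage.solved_of_conflictC [Finite V] (h : S.Stage κ v₀ A B) (hS : S.OddCircuit)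
    (hv₀ : S.D v₀) {χ : V → ℤˣ} (hχ : ∀ v, χ (S.r v) = -χ v ∧ χ (S.b v) = -χ v) {v₁ v₂ : V}
    (hA : v₁ ∉ A) (h₁ : v₁ ∈ B) (h₂ : v₂ ∈ B) (hC : v₂ ∈ S.circC v₁)
    (hκ₁ : κ v₁ * χ v₁ = 1) (hκ₂ : κ v₂ * χ v₂ = -1) : S.Solved := by
  classical
  obtain ⟨lam, y, lo, h1, h2, h3, h4, h5, h6⟩ :=
    (h.hasPath_hasPair_hasSpec hv₀).2.1 v₁ v₂ (Or.inr h₁) (Or.inr h₂)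
  obtain ⟨u, hu, -, g, g1, g2, g3, g4, -⟩ := exists_segment S.hr S.hb χ v₁
    (fun v _ => hχ v) (fun x => x = v₂ ∨ x = S.r v₂) (by rintro x (rfl | rfl) <;> simp [S.hr.inv])
    ⟨v₂, Or.inl rfl, hC⟩
  have heq : ∀ x, x = v₁ ∨ x = S.r v₁ → κ x = χ x := by
    rintro x (rfl | rfl)
    · rw [units_eq_mul_of_mul_eq hκ₁, one_mul]
    · rw [(h.good.2 _ h₁).1, (hχ _).1, units_eq_mul_of_mul_eq hκ₁, one_mul]
  have hne : ∀ x, x = v₂ ∨ x = S.r v₂ → κ x = -χ x := by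
    rintro x (rfl | rfl)
    · rw [units_eq_mul_of_mul_eq hκ₂, neg_one_mul]
    · rw [(h.good.2 _ h₂).1, (hχ _).1, units_eq_mul_of_mul_eq hκ₂, neg_one_mul]
  have hu' : ∀ x, (x = u ∨ x = S.r u) ↔ (x = v₂ ∨ x = S.r v₂) := fun x => by
    rcases hu with rfl | rfl
    · rfl
    · rw [S.hr.inv]; exact or_comm
  have hf : ∀ x, (κ x : ℤ) * (g (S.r x) - g x) = -(ind S.r v₁ x + ind S.r v₂ x) := fun x => by
    have h7 := g4 x
    by_cases hx1 : x = v₁ ∨ x = S.r v₁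
    · have hx2 : ¬ (x = v₂ ∨ x = S.r v₂) := fun h' => by
        have := (hne x h').symm.trans (heq x hx1)
        rcases Int.units_eq_one_or (χ x) with h8 | h8 <;> rw [h8] at this <;> simp at this
      have hx3 := hx2
      rw [← hu'] at hx3
      push Not at hx2 hx3
      rw [ind_eq_one hx1, ind_eq_zero hx3.1 hx3.2] at h7
      rw [heq x hx1, ind_eq_one hx1, ind_eq_zero hx2.1 hx2.2]
      linarith
    · by_cases hx2 : x = v₂ ∨ x = S.r v₂
      · rw [ind_eq_one ((hu' x).2 hx2)] at h7
        push Not at hx1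
        rw [ind_eq_zero hx1.1 hx1.2] at h7 ⊢
        rw [hne x hx2, ind_eq_one hx2, Units.val_neg]
        linarith
      · have hx3 := hx2
        rw [← hu'] at hx3
        push Not at hx1 hx2 hx3
        rw [ind_eq_zero hx1.1 hx1.2, ind_eq_zero hx3.1 hx3.2, sub_zero, mul_eq_zero] at h7
        rw [ind_eq_zero hx1.1 hx1.2, ind_eq_zero hx2.1 hx2.2, h7.resolve_left (χ x).ne_zero]
        ring
  refine Part.solved_of_root hS hv₀ (h.good.1 _ h.root_mem).1
    (h1.addC g3 g2 hf (fun x => by ring)) (lo := fun x => if x ∈ S.circC v₁ then -3 else lo x)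
    (fun x => ?_) (fun x => ?_) (fun x => ?_) h3 (fun x hxD => ?_)
  · simp only [circC_r, circC_b, h4, and_self]
  · split_ifs
    · exact Or.inl rfl
    · exact h5 x
  · by_cases hx : x ∈ S.circC v₁
    · rw [h1.lam_off x (h.circC_disjoint hA hx)]
      rcases g1 x with hg | hg <;> simp [hg]
    · rw [g2 x hx]
      simpa using h2 x
  · by_cases hx : x ∈ S.circC v₁
    · rw [h1.lam_off x (h.circC_disjoint hA hx), if_pos hx]
      have := abs_le.1 (h3 x hxD).2
      rcases g1 x with hg | hg <;> rw [hg] <;> omega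
    · rw [g2 x hx, if_neg hx, add_zero]
      exact h6 x hxD

end Cfg

end SignedCubic

/-! ### Components off the `t`-edges of `D`, and consistent signs. -/

namespace SignedCubic

namespace Cfg

variable {V : Type*} (S : Cfg V)

/-- Reachability along `r`, along `b`, and along `t` outside `D`. -/
def Cmp : V → V → Prop :=
  Relation.ReflTransGen fun a c => c = S.r a ∨ c = S.b a ∨ (¬ S.D a ∧ c = S.t a)

/-- The sign changes of `κ` at `v` are as required. -/
def Good (κ : V → ℤˣ) (v : V) : Prop :=
  κ (S.r v) = -κ v ∧ κ (S.b v) = -κ v ∧ (¬ S.D v → κ (S.t v) = -S.s v * κ v)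

variable {S} {κ : V → ℤˣ} {A B : Set V} {v₀ : V}

theorem Cmp.refl (v : V) : S.Cmp v v := Relation.ReflTransGen.refl

theorem Cmp.trans {u v w : V} (h : S.Cmp u v) (h' : S.Cmp v w) : S.Cmp u w :=
  Relation.ReflTransGen.trans h h'

theorem Cmp.r (v : V) : S.Cmp v (S.r v) := Relation.ReflTransGen.single (Or.inl rfl)

theorem Cmp.b (v : V) : S.Cmp v (S.b v) := Relation.ReflTransGen.single (Or.inr (Or.inl rfl))

theorem Cmp.t {v : V} (hv : ¬ S.D v) : S.Cmp v (S.t v) :=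
  Relation.ReflTransGen.single (Or.inr (Or.inr ⟨hv, rfl⟩))

theorem Cmp.closed {P : V → Prop} (hr : ∀ v, P v → P (S.r v)) (hb : ∀ v, P v → P (S.b v))
    (ht : ∀ v, ¬ S.D v → P v → P (S.t v)) {u v : V} (h : S.Cmp u v) (hu : P u) : P v := by
  induction h with
  | refl => exact hu
  | tail _ h ih =>
    rcases h with rfl | rfl | ⟨h, rfl⟩
    exacts [hr _ ih, hb _ ih, ht _ h ih]

theorem Cmp.symm {u v : V} (h : S.Cmp u v) : S.Cmp v u := by
  refine Cmp.closed (P := fun w => S.Cmp w u) (fun w hw => ?_) (fun w hw => ?_) (fun w hD hw => ?_)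
    h (Cmp.refl u)
  · refine Cmp.trans ?_ hw
    have := Cmp.r (S := S) (S.r w)
    rwa [S.hr.inv] at this
  · refine Cmp.trans ?_ hw
    have := Cmp.b (S := S) (S.b w)
    rwa [S.hb.inv] at this
  · refine Cmp.trans ?_ hw
    have := Cmp.t (S := S) (v := S.t w) (by rwa [S.D_t])
    rwa [S.ht.inv] at this

theorem Cmp.congr {u v w : V} (h : S.Cmp u v) : S.Cmp w u ↔ S.Cmp w v :=
  ⟨fun h' => h'.trans h, fun h' => h'.trans h.symm⟩

theorem exists_good_of_forall_cmp (h : ∀ v, ∃ κ : V → ℤˣ, ∀ w, S.Cmp v w → S.Good κ w) :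
    ∃ κ : V → ℤˣ, ∀ w, S.Good κ w := by
  let T : Setoid V := ⟨S.Cmp, ⟨Cmp.refl, Cmp.symm, Cmp.trans⟩⟩
  have hrep : ∀ v, S.Cmp (Quotient.mk T v).out v := fun v => Quotient.mk_out (s := T) v
  have hq : ∀ {u v}, S.Cmp u v → Quotient.mk T v = Quotient.mk T u := fun h =>
    (Quotient.sound (s := T) h).symm
  choose κ hκ using h
  refine ⟨fun v => κ (Quotient.mk T v).out v, fun v => ?_⟩
  obtain ⟨h1, h2, h3⟩ := hκ _ v (hrep v)
  refine ⟨?_, ?_, fun hv => ?_⟩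
  · beta_reduce
    rw [hq (Cmp.r v)]; exact h1
  · beta_reduce
    rw [hq (Cmp.b v)]; exact h2
  · beta_reduce
    rw [hq (Cmp.t hv)]; exact h3 hv

theorem Stage.cmp (h : S.Stage κ v₀ A B) : ∀ v ∈ A ∪ B, S.Cmp v₀ v := by
  have hC : ∀ u v, v ∈ S.circC u → S.Cmp u v := fun u v h =>
    Conn.closed (P := S.Cmp u) (fun v h => h.trans (Cmp.r v)) (fun v h => h.trans (Cmp.b v)) h
      (Cmp.refl u)
  have hO : ∀ u v, ¬ S.D u → v ∈ S.circO u → S.Cmp u v := fun u v hu h =>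
    (Conn.closed (P := fun v => S.Cmp u v ∧ ¬ S.D v)
      (fun v h => ⟨h.1.trans (Cmp.r v), by rw [S.D_r]; exact h.2⟩)
      (fun v h => ⟨h.1.trans (Cmp.t h.2), by rw [S.D_t]; exact h.2⟩) h
      ⟨Cmp.refl u, hu⟩).1
  induction h with
  | base => exact fun v hv => hv.elim (hC _ v) fun h => h.elim
  | addO _ v hA hD hB _ ih =>
    rintro w (hw | hw | hw)
    exacts [ih w (Or.inl hw), ih w (Or.inr hw), (ih v (Or.inl hA)).trans (hO v w hD hw)]
  | addC _ v hB hA _ ih =>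
    rintro w ((hw | hw) | hw)
    exacts [ih w (Or.inl hw), (ih v (Or.inr hB)).trans (hC v w hw), ih w (Or.inr hw)]

theorem Stage.mem_of_cmp (h : S.Stage κ v₀ A B) (hAB : ∀ v ∈ A, ¬ S.D v → v ∈ B) (hBA : B ⊆ A)
    {v : V} (hv : S.Cmp v₀ v) : v ∈ A := by
  refine Cmp.closed (P := fun v => v ∈ A) (fun v hv => h.r_mem hv) (fun v hv => h.b_mem_iff.2 hv)
    (fun v hD hv => hBA (h.circO_subset v (hAB v hv hD) ?_)) hv h.root_mem
  exact circO_t.2 (mem_circO_self v)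

theorem ncard_compl_lt [Finite V] {B C : Set V} {v : V} (hv : v ∉ B) (hv' : v ∈ C) :
    (B ∪ C)ᶜ.ncard < Bᶜ.ncard := by
  refine Set.ncard_lt_ncard ⟨?_, fun h => ?_⟩ (Set.toFinite _)
  · exact Set.compl_subset_compl.2 Set.subset_union_left
  · exact h hv (Or.inr hv')

/-- A maximal stage is considered. A circuit that meets it without being collected could be added by
continuing `κ` around it, unless two contacts demand opposite continuations; that is a conflict and
gives a solution. -/
theorem solved_or_exists_stage [Finite V] (hS : S.OddCircuit) (hv₀ : S.D v₀) :
    S.Solved ∨ ∃ κ A B, S.Stage κ v₀ A B ∧ (∀ v ∈ A, ¬ S.D v → v ∈ B) ∧ B ⊆ A := by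
  classical
  by_cases hsol : S.Solved
  · exact Or.inl hsol
  right
  obtain ⟨χ, hχ⟩ := exists_alternating S.hr S.ht
  obtain ⟨β, hβ⟩ := exists_alternating S.hr S.hb
  obtain ⟨⟨κ, A, B⟩, h, hmin⟩ := exists_minimizer
    (fun p : (V → ℤˣ) × Set V × Set V => S.Stage p.1 v₀ p.2.1 p.2.2)
    (fun p => p.2.1ᶜ.ncard + p.2.2ᶜ.ncard) ⟨(β, S.circC v₀, ∅), .base fun w _ => hβ w⟩
  dsimp only at h hmin
  refine ⟨κ, A, B, h, fun v hA hD => ?_, fun v hB => ?_⟩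
  · by_contra hB
    have hc : ∀ w ∈ S.circO v, w ∈ A → κ w * S.θ w * χ w = κ v * S.θ v * χ v := by
      intro w hw hwA
      by_contra hne
      apply hsol
      rcases Int.units_eq_one_or (κ v * S.θ v * χ v) with h1 | h1
      · have h2 := units_eq_neg_of_ne hne
        rw [h1] at h2
        refine h.solved_of_conflictO hS hv₀ hχ (not_D_of_mem_circO hw hD) (h.circO_disjoint hB hw)
          hwA hA ?_ h2 h1
        rw [circO_of_mem hw]
        exact mem_circO_self v
      · have h2 := units_eq_neg_of_ne hne
        rw [h1, neg_neg] at h2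
        exact h.solved_of_conflictO hS hv₀ hχ hD hB hA hwA hw h1 h2
    -- On the new circuit `κ' * θ` is a constant multiple of the alternating `χ`, normalised to
    -- agree with `κ` at `v` and hence, by `hc`, at every contact.
    let κ' : V → ℤˣ := fun w => if w ∈ S.circO v then κ v * S.θ v * χ v * S.θ w * χ w else κ w
    have h1 : S.Stage κ' v₀ A (B ∪ S.circO v) := by
      refine .addO (h.congr fun w hw => ?_) v hA hD hB fun w hw => ?_
      · by_cases hwO : w ∈ S.circO v
        · have hwA := hw.resolve_right (h.circO_disjoint hB hwO)
          simp only [κ', if_pos hwO]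
          rw [← hc w hwO hwA, mul_assoc, mul_assoc, mul_assoc]
          rw [show S.θ w * (χ w * (S.θ w * χ w)) = (S.θ w * S.θ w) * (χ w * χ w) by ac_rfl]
          simp
        · simp only [κ', if_neg hwO]
      · have hwD := not_D_of_mem_circO hw hD
        simp only [κ', if_pos hw, circO_r, circO_t, S.θ_r w hwD, S.θ_t w hwD, hχ, mul_neg, neg_mul,
          true_and]
        congr 1
        ac_rfl
    have := hmin (κ', A, B ∪ S.circO v) h1
    have h2 := ncard_compl_lt hB (mem_circO_self (S := S) v)
    dsimp only at this
    omega
  · by_contra hA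
    have hc : ∀ w ∈ S.circC v, w ∈ B → κ w * β w = κ v * β v := by
      intro w hw hwB
      by_contra hne
      apply hsol
      rcases Int.units_eq_one_or (κ v * β v) with h1 | h1
      · have h2 := units_eq_neg_of_ne hne
        rw [h1] at h2
        exact h.solved_of_conflictC hS hv₀ hβ hA hB hwB hw h1 h2
      · have h2 := units_eq_neg_of_ne hne
        rw [h1, neg_neg] at h2
        refine h.solved_of_conflictC hS hv₀ hβ (h.circC_disjoint hA hw) hwB hB ?_ h2 h1
        rw [circC_of_mem hw]
        exact mem_circC_self v
    let κ' : V → ℤˣ := fun w => if w ∈ S.circC v then κ v * β v * β w else κ w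
    have h1 : S.Stage κ' v₀ (A ∪ S.circC v) B := by
      refine .addC (h.congr fun w hw => ?_) v hB hA fun w hw => ?_
      · by_cases hwC : w ∈ S.circC v
        · have hwB := hw.resolve_left (h.circC_disjoint hA hwC)
          simp only [κ', if_pos hwC]
          rw [← hc w hwC hwB, mul_assoc, Int.units_mul_self, mul_one]
        · simp only [κ', if_neg hwC]
      · simp only [κ', if_pos hw, circC_r, circC_b, hβ, mul_neg, and_self]
    have := hmin (κ', A ∪ S.circC v, B) h1
    have h2 := ncard_compl_lt hA (mem_circC_self (S := S) v)
    dsimp only at this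
    omega

theorem solved_or_exists_good [Finite V] (hS : S.OddCircuit)
    (hD : ∀ v, ∃ d, S.D d ∧ S.Cmp v d) : S.Solved ∨ ∃ κ : V → ℤˣ, ∀ w, S.Good κ w := by
  by_cases hsol : S.Solved
  · exact Or.inl hsol
  refine Or.inr (exists_good_of_forall_cmp fun v => ?_)
  obtain ⟨d, hd, hvd⟩ := hD v
  obtain ⟨κ, A, B, h, hAB, hBA⟩ := (solved_or_exists_stage hS hd).resolve_left hsol
  refine ⟨κ, fun w hw => ?_⟩
  have hwA := h.mem_of_cmp hAB hBA (hvd.symm.trans hw)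
  exact ⟨(h.good.1 w hwA).1, (h.good.1 w hwA).2, fun hwD => (h.good.2 w (hAB w hwA hwD)).2⟩

/-- For good signs no extension is obstructed, so a maximal stage fills the component. This makes
paths and pairs available between arbitrary `r`-edges of a component with any root on `D`. -/
theorem exists_stage_of_good [Finite V] (hκ : ∀ w, S.Good κ w) (v₀ : V) :
    S.Stage κ v₀ {w | S.Cmp v₀ w} {w | S.Cmp v₀ w ∧ ¬ S.D w} := by
  classical
  obtain ⟨⟨A, B⟩, h, hmin⟩ := exists_minimizer
    (fun p : Set V × Set V => S.Stage κ v₀ p.1 p.2)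
    (fun p => p.1ᶜ.ncard + p.2ᶜ.ncard)
    ⟨(S.circC v₀, ∅), .base fun w _ => ⟨(hκ w).1, (hκ w).2.1⟩⟩
  dsimp only at h hmin
  have hAB : ∀ v ∈ A, ¬ S.D v → v ∈ B := fun v hA hD => by
    by_contra hB
    have := hmin (A, B ∪ S.circO v) (h.addO v hA hD hB fun w hw =>
      ⟨(hκ w).1, (hκ w).2.2 (not_D_of_mem_circO hw hD)⟩)
    have h2 := ncard_compl_lt hB (mem_circO_self (S := S) v)
    dsimp only at this
    omega
  have hBA : B ⊆ A := fun v hB => by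
    by_contra hA
    have := hmin (A ∪ S.circC v, B) (h.addC v hB hA fun w _ => ⟨(hκ w).1, (hκ w).2.1⟩)
    have h2 := ncard_compl_lt hA (mem_circC_self (S := S) v)
    dsimp only at this
    omega
  have hA : A = {w | S.Cmp v₀ w} :=
    Set.ext fun w => ⟨fun hw => h.cmp w (Or.inl hw), fun hw => h.mem_of_cmp hAB hBA hw⟩
  have hB : B = {w | S.Cmp v₀ w ∧ ¬ S.D w} :=
    Set.ext fun w => ⟨fun hw => ⟨h.cmp w (Or.inr hw), h.not_D w hw⟩,
      fun hw => hAB w (h.mem_of_cmp hAB hBA hw.1) hw.2⟩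
  rwa [← hA, ← hB]

end Cfg

end SignedCubic

/-! ### Interval covers and potentials along a circuit. -/

namespace SignedCubic

/-- The signs `τ` on `M`, switched before the gap `n`, are not all equal. -/
def Incons (M : ℕ → Prop) (τ : ℕ → ℤˣ) (n : ℕ) : Prop :=
  ∃ j k, M j ∧ M k ∧ (if j < n then -τ j else τ j) ≠ if k < n then -τ k else τ k

/-- Data assigning to each set of a minimal family an interval, with all but one of the sets having
constant sign. -/
structure Cover {ι : Type*} [DecidableEq ι] (m : ℕ) (F : Finset ι) (M : ι → ℕ → Prop) (τ : ℕ → ℤˣ)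
    (z₀ : ι) : Prop where
  lt : ∀ z ∈ F, ∀ k, M z k → k < m
  disj : ∀ z ∈ F, ∀ z' ∈ F, ∀ k, M z k → M z' k → z = z'
  cover : ∀ n < m, ∃ z ∈ F, Incons (M z) τ n
  priv : ∀ z ∈ F, ∃ n < m, Incons (M z) τ n ∧ ∀ z' ∈ F, Incons (M z') τ n → z' = z
  mem : z₀ ∈ F
  pos : 0 < m
  cons : ∀ z ∈ F, z ≠ z₀ → ¬ Incons (M z) τ 0
  switch : ∀ i j k, M z₀ i → M z₀ j → M z₀ k → i < j → j < k → τ i = -τ j → τ k = τ j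

namespace Cover

variable {ι : Type*} [DecidableEq ι] {m : ℕ} {F : Finset ι} {M : ι → ℕ → Prop} {τ : ℕ → ℤˣ} {z₀ : ι}

/-- A set of constant sign is inconsistent precisely at the gaps separating its least from its
greatest element. -/
theorem exists_interval (h : Cover m F M τ z₀) {z : ι} (hz : z ∈ F) (hz' : z ≠ z₀) :
    ∃ lo hi, M z lo ∧ M z hi ∧ lo < hi ∧ (∀ k, M z k → lo ≤ k ∧ k ≤ hi ∧ τ k = τ lo) ∧
      ∀ n, Incons (M z) τ n ↔ lo < n ∧ n ≤ hi := by
  classical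
  have hc : ∀ j k, M z j → M z k → τ j = τ k := fun j k hj hk => by
    by_contra hne
    exact h.cons z hz hz' ⟨j, k, hj, hk, by simpa using hne⟩
  obtain ⟨n, -, ⟨j, k, hj, hk, hjk⟩, -⟩ := h.priv z hz
  have hex : ∃ k, M z k := ⟨j, hj⟩
  have hM : ∀ k, M z k → k ≤ m := fun k hk => (h.lt z hz k hk).le
  have hlo := Nat.find_spec hex
  have hhi := Nat.findGreatest_spec (P := M z) (hM _ hlo) hlo
  have hle : ∀ k, M z k → Nat.find hex ≤ k ∧ k ≤ Nat.findGreatest (M z) m := fun k hk =>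
    ⟨Nat.find_min' hex hk, Nat.le_findGreatest (hM k hk) hk⟩
  have hiff : ∀ n, Incons (M z) τ n ↔ Nat.find hex < n ∧ n ≤ Nat.findGreatest (M z) m := by
    intro n
    constructor
    · rintro ⟨j, k, hj, hk, hjk⟩
      rw [hc j k hj hk] at hjk
      have h1 := hle j hj
      have h2 := hle k hk
      split_ifs at hjk
      · exact absurd rfl hjk
      · omega
      · omega
      · exact absurd rfl hjk
    · rintro ⟨h1, h2⟩
      refine ⟨_, _, hlo, hhi, ?_⟩
      rw [if_pos h1, if_neg (not_lt.2 h2), hc _ _ hlo hhi]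
      rcases Int.units_eq_one_or (τ (Nat.findGreatest (M z) m)) with h3 | h3 <;> rw [h3] <;> decide
  have := (hiff n).1 ⟨j, k, hj, hk, hjk⟩
  exact ⟨_, _, hlo, hhi, by omega, fun k hk => ⟨(hle k hk).1, (hle k hk).2, hc _ _ hk hlo⟩, hiff⟩

/-- The one set with a change of sign. -/
theorem exists_switch (h : Cover m F M τ z₀) :
    ∃ σ α β, M z₀ α ∧ M z₀ β ∧ α < β ∧ τ α = σ ∧ τ β = -σ ∧
      (∀ k, M z₀ k → k < β → τ k = σ) ∧ (∀ k, M z₀ k → α < k → τ k = -σ) ∧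
      ∀ n, Incons (M z₀) τ n ↔ n ≤ α ∨ β < n := by
  classical
  obtain ⟨z, hz, hI⟩ := h.cover 0 h.pos
  have hz0 : z = z₀ := by
    by_contra hne
    exact h.cons z hz hne hI
  rw [hz0] at hI
  obtain ⟨j, k, hj, hk, hjk⟩ := hI
  simp only [not_lt_zero, if_false] at hjk
  have hM : ∀ k, M z₀ k → k ≤ m := fun k hk => (h.lt z₀ h.mem k hk).le
  have hex : ∃ k, M z₀ k := ⟨j, hj⟩
  set i := Nat.find hex with hi
  have hiM : M z₀ i := Nat.find_spec hex
  have hex' : ∃ k, M z₀ k ∧ τ k = -τ i := by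
    by_cases h1 : τ j = τ i
    · exact ⟨k, hk, units_eq_neg_of_ne fun h2 => hjk (h1.trans h2.symm)⟩
    · exact ⟨j, hj, units_eq_neg_of_ne h1⟩
  set β := Nat.find hex' with hβ
  have hβM : M z₀ β ∧ τ β = -τ i := Nat.find_spec hex'
  have hlt : ∀ k, M z₀ k → k < β → τ k = τ i := fun k hk hkβ => by
    by_contra hne
    exact Nat.find_min hex' hkβ ⟨hk, units_eq_neg_of_ne hne⟩
  have hge : ∀ k, M z₀ k → β ≤ k → τ k = -τ i := fun k hk hkβ => by
    rcases hkβ.eq_or_lt with rfl | hlt'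
    · exact hβM.2
    · rw [← hβM.2]
      have hiβ : i ≤ β := Nat.find_min' hex hβM.1
      have hne : i ≠ β := fun h1 => by
        have := hβM.2
        rw [← h1] at this
        rcases Int.units_eq_one_or (τ i) with h3 | h3 <;> rw [h3] at this <;>
          exact absurd this (by decide)
      exact h.switch i β k hiM hβM.1 hk (by omega) hlt' (by rw [hβM.2, neg_neg])
  have hneg : τ i ≠ -τ i := by
    rcases Int.units_eq_one_or (τ i) with h3 | h3 <;> rw [h3] <;> decide
  have hαs := Nat.findGreatest_spec (P := fun k => M z₀ k ∧ τ k = τ i) (hM _ hiM) ⟨hiM, rfl⟩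
  set α := Nat.findGreatest (fun k => M z₀ k ∧ τ k = τ i) m with hα
  have hαβ : α < β := by
    by_contra h1
    have := hge α hαs.1 (by omega)
    rw [hαs.2] at this
    exact hneg this
  have hgt : ∀ k, M z₀ k → α < k → τ k = -τ i := fun k hk hkα => by
    refine units_eq_neg_of_ne fun h1 => ?_
    have : k ≤ α := Nat.le_findGreatest (hM k hk) ⟨hk, h1⟩
    omega
  refine ⟨τ i, α, β, hαs.1, hβM.1, hαβ, hαs.2, hβM.2, hlt, hgt, fun n => ⟨?_, ?_⟩⟩
  · rintro ⟨j, k, hj, hk, hjk⟩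
    by_contra hcon
    push Not at hcon
    have key : ∀ k, M z₀ k → (if k < n then -τ k else τ k) = -τ i := fun k hk => by
      split_ifs with h1
      · rw [hlt k hk (by omega)]
      · exact hgt k hk (by omega)
    exact hjk ((key j hj).trans (key k hk).symm)
  · rintro (h1 | h1)
    · refine ⟨α, β, hαs.1, hβM.1, ?_⟩
      rw [if_neg (by omega), if_neg (by omega), hαs.2, hβM.2]
      exact hneg
    · refine ⟨α, β, hαs.1, hβM.1, ?_⟩
      rw [if_pos (by omega), if_pos (by omega), hαs.2, hβM.2]
      exact fun h2 => hneg (neg_injective h2)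

/-- Potentials along the circuit that realise the cover by unit and double paths. -/
theorem exists_potential (h : Cover m F M τ z₀) :
    ∃ ξ : ℕ → ℤ, ξ m = -ξ 0 ∧ (∀ n, ξ n ≠ 0 ∧ |ξ n| ≤ 3) ∧
      (∀ k, (∀ z ∈ F, ¬ M z k) → ξ (k + 1) = ξ k) ∧
      (∀ z ∈ F, z ≠ z₀ → ∃ p q, M z p ∧ M z q ∧ ∀ k, M z k →
        τ k * (ξ (k + 1) - ξ k) = (if k = p then 1 else 0) - if k = q then 1 else 0) ∧
      ∃ p q, M z₀ p ∧ M z₀ q ∧ ∀ k, M z₀ k →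
        τ k * (ξ (k + 1) - ξ k) = 2 * ((if k = p then 1 else 0) - if k = q then 1 else 0) ∧
        (|ξ k| ≤ 2 ∨ |ξ (k + 1)| ≤ 2) := by
  classical
  have hint : ∀ z, ∃ lo hi, z ∈ F.erase z₀ → M z lo ∧ M z hi ∧ lo < hi ∧
      (∀ k, M z k → lo ≤ k ∧ k ≤ hi ∧ τ k = τ lo) ∧ ∀ n, Incons (M z) τ n ↔ lo < n ∧ n ≤ hi := by
    intro z
    by_cases hz : z ∈ F.erase z₀
    · obtain ⟨lo, hi, h1⟩ := h.exists_interval (Finset.mem_of_mem_erase hz)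
        (Finset.ne_of_mem_erase hz)
      exact ⟨lo, hi, fun _ => h1⟩
    · exact ⟨0, 0, fun h => absurd h hz⟩
  choose lo hi hl using hint
  obtain ⟨σ, α, β, hα, hβ, hαβ, hσα, hσβ, hlt, hgt, hz₀⟩ := h.exists_switch
  let L : ℕ → Finset ι := fun n => (F.erase z₀).filter fun z => lo z < n ∧ n ≤ hi z
  have hL : ∀ {n z}, z ∈ L n ↔ z ∈ F.erase z₀ ∧ lo z < n ∧ n ≤ hi z := fun {n z} => by simp [L]
  -- A private gap of an interval lies in `(α, β]`, because elsewhere `z₀` is inconsistent as well.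
  have hpriv : ∀ z ∈ F.erase z₀, ∃ p, lo z < p ∧ p ≤ hi z ∧ α < p ∧ p ≤ β ∧
      ∀ z' ∈ F.erase z₀, lo z' < p → p ≤ hi z' → z' = z := by
    intro z hz
    obtain ⟨p, -, h1, h2⟩ := h.priv z (Finset.mem_of_mem_erase hz)
    have h3 := ((hl z hz).2.2.2.2 p).1 h1
    have h4 : ¬ Incons (M z₀) τ p := fun h4 => Finset.ne_of_mem_erase hz (h2 z₀ h.mem h4).symm
    rw [hz₀] at h4
    push Not at h4
    exact ⟨p, h3.1, h3.2, h4.1, h4.2, fun z' hz' h5 h6 =>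
      h2 z' (Finset.mem_of_mem_erase hz') (((hl z' hz').2.2.2.2 p).2 ⟨h5, h6⟩)⟩
  have hcov : ∀ n, α < n → n ≤ β → 1 ≤ (L n).card := by
    intro n h1 h2
    obtain ⟨z, hz, hI⟩ := h.cover n (h2.trans_lt (h.lt z₀ h.mem β hβ))
    have hne : z ≠ z₀ := fun h3 => by
      rw [h3, hz₀] at hI
      omega
    have hz' := Finset.mem_erase.2 ⟨hne, hz⟩
    exact Finset.card_pos.2 ⟨z, hL.2 ⟨hz', ((hl z hz').2.2.2.2 n).1 hI⟩⟩
  have hmax : ∀ n, (L n).Nonempty → ∃ z₁ ∈ L n, ∃ z₂ ∈ L n,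
      ∀ z ∈ L n, lo z₁ ≤ lo z ∧ hi z ≤ hi z₂ := fun n hn => by
    obtain ⟨z₁, h1, h2⟩ := Finset.exists_min_image (L n) lo hn
    obtain ⟨z₂, h3, h4⟩ := Finset.exists_max_image (L n) hi hn
    exact ⟨z₁, h1, z₂, h3, fun z hz => ⟨h2 z hz, h4 z hz⟩⟩
  -- Let `z₁` start first and `z₂` end last among the intervals over `n`. Any third one has its
  -- private gap covered by `z₁` or `z₂`, according to the side of `n`. For `n` outside `(α, β]` all
  -- private gaps lie on one side, so one interval remains.
  have hL2 : ∀ n, (L n).card ≤ 2 ∧ (n ≤ α ∨ β < n → (L n).card ≤ 1) := by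
    intro n
    rcases (L n).eq_empty_or_nonempty with h0 | h0
    · simp [h0]
    obtain ⟨z₁, h1, z₂, h2, hz⟩ := hmax n h0
    have h1' := hL.1 h1
    have h2' := hL.1 h2
    constructor
    · refine (Finset.card_le_card (t := {z₁, z₂}) fun z hzL => ?_).trans Finset.card_le_two
      have h3 := hL.1 hzL
      obtain ⟨p, p1, p2, p3, p4, p5⟩ := hpriv z h3.1
      have h4 := hz z hzL
      rw [Finset.mem_insert, Finset.mem_singleton]
      rcases le_or_gt p n with h5 | h5
      · exact Or.inl (p5 z₁ h1'.1 (by omega) (by omega)).symm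
      · exact Or.inr (p5 z₂ h2'.1 (by omega) (by omega)).symm
    · rintro (hn | hn)
      · refine (Finset.card_le_card (t := {z₂}) fun z hzL => ?_).trans (by simp)
        have h3 := hL.1 hzL
        obtain ⟨p, p1, p2, p3, p4, p5⟩ := hpriv z h3.1
        have h4 := hz z hzL
        exact Finset.mem_singleton.2 (p5 z₂ h2'.1 (by omega) (by omega)).symm
      · refine (Finset.card_le_card (t := {z₁}) fun z hzL => ?_).trans (by simp)
        have h3 := hL.1 hzL
        obtain ⟨p, p1, p2, p3, p4, p5⟩ := hpriv z h3.1
        have h4 := hz z hzL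
        exact Finset.mem_singleton.2 (p5 z₁ h1'.1 (by omega) (by omega)).symm
  -- `α'` is the earliest position of `z₀` from which the intervals cover every gap up to `β`.
  -- Taking it earliest keeps the potential small next to the positions of `z₀` before it.
  have hex : ∃ k, M z₀ k ∧ ∀ n, k < n → n ≤ β → 1 ≤ (L n).card := ⟨α, hα, hcov⟩
  set α' := Nat.find hex with hα'
  obtain ⟨hα'M, hα'c⟩ := Nat.find_spec hex
  rw [← hα'] at hα'M hα'c
  have hα'α : α' ≤ α := Nat.find_min' hex ⟨hα, hcov⟩
  -- changes of the number of intervals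
  have hsame : ∀ k, (∀ z ∈ F.erase z₀, k ≠ lo z ∧ k ≠ hi z) → L (k + 1) = L k := by
    intro k hk
    ext z
    simp only [hL]
    refine and_congr_right fun hz => ?_
    have := hk z hz
    omega
  have hstep : ∀ z ∈ F.erase z₀, ∀ k, M z k → ((L (k + 1)).card : ℤ) - (L k).card
      = (if k = lo z then 1 else 0) - if k = hi z then 1 else 0 := by
    intro z hz k hk
    have hzl := hl z hz
    have hother : ∀ z' ∈ F.erase z₀, z' ≠ z → k ≠ lo z' ∧ k ≠ hi z' := fun z' hz' hne => by
      constructor <;> rintro rfl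
      · exact hne (h.disj z' (Finset.mem_of_mem_erase hz') z (Finset.mem_of_mem_erase hz) _
          (hl z' hz').1 hk)
      · exact hne (h.disj z' (Finset.mem_of_mem_erase hz') z (Finset.mem_of_mem_erase hz) _
          (hl z' hz').2.1 hk)
    have hsplit : ∀ n, ((L n).card : ℤ) = ((L n).erase z).card
        + if lo z < n ∧ n ≤ hi z then 1 else 0 := fun n => by
      split_ifs with h1
      · have h2 := Finset.card_erase_add_one (hL.2 ⟨hz, h1⟩)
        rw [← h2]; push_cast; rfl
      · rw [Finset.erase_eq_of_notMem fun h2 => h1 (hL.1 h2).2, add_zero]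
    have heq : (L (k + 1)).erase z = (L k).erase z := by
      ext z'
      simp only [Finset.mem_erase, hL]
      refine and_congr_right fun hne => and_congr_right fun hz' => ?_
      have := hother z' (Finset.mem_erase.2 hz') hne
      omega
    rw [hsplit, hsplit k, heq]
    have h1 := hzl.2.2.1
    split_ifs <;> omega
  have hzero : (L 0).card = 0 := by
    rw [Finset.card_eq_zero, Finset.eq_empty_iff_forall_notMem]
    intro z hz
    have := (hL.1 hz).2
    omega
  have hm : (L m).card = 0 := by
    rw [Finset.card_eq_zero, Finset.eq_empty_iff_forall_notMem]
    intro z hz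
    have h1 := hL.1 hz
    have := h.lt z (Finset.mem_of_mem_erase h1.1) _ (hl z h1.1).2.1
    omega
  have hβm := h.lt z₀ h.mem β hβ
  have hz₀F : ∀ k, M z₀ k → ∀ z ∈ F.erase z₀, k ≠ lo z ∧ k ≠ hi z := fun k hk z hz => by
    constructor <;> rintro rfl
    · exact Finset.ne_of_mem_erase hz (h.disj z (Finset.mem_of_mem_erase hz) z₀ h.mem _
        (hl z hz).1 hk)
    · exact Finset.ne_of_mem_erase hz (h.disj z (Finset.mem_of_mem_erase hz) z₀ h.mem _
        (hl z hz).2.1 hk)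
  -- The values are 2 or 3 up to `α'`, then 1 or 2 up to `β`, then `-2` or `-1`. Intervals
  -- contribute unit jumps, and `z₀` contributes a jump of `-2` at each of `α'` and `β`.
  let ξ : ℕ → ℤ := fun n => (L n).card + (if n ≤ α' then 2 else 0) - if β < n then 2 else 0
  have hξ : ∀ n, ξ n = (L n).card + (if n ≤ α' then 2 else 0) - if β < n then 2 else 0 :=
    fun n => rfl
  have hjump : ∀ k, k ≠ α' → k ≠ β → ξ (k + 1) - ξ k = (L (k + 1)).card - (L k).card := by
    intro k h1 h2
    rw [hξ, hξ]
    split_ifs <;> omega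
  refine ⟨ξ, ?_, fun n => ?_, fun k hk => ?_, fun z hz hne => ?_, ?_⟩
  · rw [hξ, hξ, hzero, hm, if_neg (by omega), if_pos hβm, if_pos (by omega), if_neg (by omega)]
    norm_num
  · have h1 := hL2 n
    rw [abs_le, hξ]
    by_cases h2 : n ≤ α'
    · have := h1.2 (Or.inl (by omega))
      rw [if_pos h2, if_neg (by omega)]
      omega
    · by_cases h3 : β < n
      · have := h1.2 (Or.inr h3)
        rw [if_neg h2, if_pos h3]
        omega
      · have := hα'c n (by omega) (by omega)
        rw [if_neg h2, if_neg h3]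
        omega
  · have h1 : k ≠ α' := fun h1 => hk z₀ h.mem (h1 ▸ hα'M)
    have h2 : k ≠ β := fun h2 => hk z₀ h.mem (h2 ▸ hβ)
    have h3 := hjump k h1 h2
    rw [hsame k fun z hz => ⟨?_, ?_⟩] at h3
    · linarith
    · rintro rfl
      exact hk z (Finset.mem_of_mem_erase hz) (hl z hz).1
    · rintro rfl
      exact hk z (Finset.mem_of_mem_erase hz) (hl z hz).2.1
  · have hz' := Finset.mem_erase.2 ⟨hne, hz⟩
    have hzl := hl z hz'
    have key : ∀ k, M z k → τ k * (ξ (k + 1) - ξ k)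
        = τ (lo z) * ((if k = lo z then 1 else 0) - if k = hi z then 1 else 0) := fun k hk => by
      have h1 : k ≠ α' := fun h1 => hne (h.disj z hz z₀ h.mem k hk (h1 ▸ hα'M))
      have h2 : k ≠ β := fun h2 => hne (h.disj z hz z₀ h.mem k hk (h2 ▸ hβ))
      rw [hjump k h1 h2, hstep z hz' k hk, (hzl.2.2.2.1 k hk).2.2]
    rcases Int.units_eq_one_or (τ (lo z)) with h1 | h1
    · exact ⟨lo z, hi z, hzl.1, hzl.2.1, fun k hk => by rw [key k hk, h1]; simp⟩
    · exact ⟨hi z, lo z, hzl.2.1, hzl.1, fun k hk => by rw [key k hk, h1]; simp⟩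
  · have key : ∀ k, M z₀ k → τ k * (ξ (k + 1) - ξ k)
        = σ * (2 * ((if k = β then 1 else 0) - if k = α' then 1 else 0)) := fun k hk => by
      have h1 := hsame k (hz₀F k hk)
      have h4 : ξ (k + 1) - ξ k = (if k + 1 ≤ α' then 2 else 0) - (if β < k + 1 then 2 else 0)
          - (if k ≤ α' then 2 else 0) + if β < k then 2 else 0 := by
        rw [hξ, hξ, h1]; ring
      rw [h4]
      by_cases h2 : k = α'
      · rw [if_neg (by omega), if_neg (by omega), if_pos (by omega), if_neg (by omega),
          if_neg (by omega), if_pos h2, hlt k hk (by omega)]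
        ring
      by_cases h3 : k = β
      · rw [if_neg (by omega), if_pos (by omega), if_neg (by omega), if_neg (by omega),
          if_pos h3, if_neg h2, h3, hσβ, Units.val_neg]
        ring
      rw [if_neg h2, if_neg h3]
      split_ifs <;> omega
    have hsmall : ∀ k, M z₀ k → |ξ k| ≤ 2 ∨ |ξ (k + 1)| ≤ 2 := fun k hk => by
      rcases lt_trichotomy k α' with h1 | h1 | h1
      · right
        -- An interval over gap `k + 1` reaches its private gap beyond `α`, from where `hcov` takes
        -- over; then `k` would contradict the minimality of `α'`.
        have h2 : (L (k + 1)).card = 0 := by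
          by_contra h2
          obtain ⟨z, hz⟩ := Finset.card_pos.1 (Nat.pos_of_ne_zero h2)
          have h3 := hL.1 hz
          obtain ⟨p, p1, p2, p3, p4, p5⟩ := hpriv z h3.1
          refine Nat.find_min hex h1 ⟨hk, fun n hn hn' => ?_⟩
          rcases le_or_gt n p with h5 | h5
          · exact Finset.card_pos.2 ⟨z, hL.2 ⟨h3.1, by omega, by omega⟩⟩
          · exact hcov n (by omega) hn'
        rw [hξ, h2, if_pos (by omega), if_neg (by omega)]
        norm_num
      · right
        have h2 := (hL2 (k + 1)).1
        rw [hξ, if_neg (by omega), if_neg (by omega), abs_le]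
        omega
      · left
        have h2 := hL2 k
        rw [hξ, if_neg (by omega), abs_le]
        split_ifs with h3
        · have := h2.2 (Or.inr h3)
          omega
        · omega
    rcases Int.units_eq_one_or σ with h1 | h1
    · exact ⟨β, α', hβ, hα'M, fun k hk => ⟨by rw [key k hk, h1]; simp, hsmall k hk⟩⟩
    · refine ⟨α', β, hα'M, hβ, fun k hk => ⟨?_, hsmall k hk⟩⟩
      rw [key k hk, h1, Units.val_neg, Units.val_one]
      ring

end Cover

end SignedCubic

/-! ### Frames of `D`, consistency of components, and local solutions. -/

namespace SignedCubic

namespace Cfg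

variable {V : Type*} (S : Cfg V)

/-- An alternating frame of `D`, cut at the `t`-edge of `e`. -/
def Frame (e : V) (ω : V → ℤˣ) : Prop :=
  ∀ x, S.D x → ω (S.r x) = -ω x ∧ (x ≠ e → x ≠ S.t e → ω (S.t x) = -S.s x * ω x)

/-- The signs `κ` on the component of `z` agree up to sign with a frame cut at the edge of `e`. -/
def Cons (κ : V → ℤˣ) (z e : V) : Prop :=
  ∀ ω, S.Frame e ω → ∀ x y, S.D x → S.D y → S.Cmp z x → S.Cmp z y → κ x * ω x = κ y * ω y

/-- A solution on the component of `v` with prescribed values `z` on `D`. -/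
def LocalSol (z : V → ℤ) (v : V) : Prop :=
  ∃ lam y lo : V → ℤ, ∀ x, S.Cmp v x → lam (S.b x) = lam x ∧ (lo (S.r x) = lo x ∧ lo (S.b x) = lo x) ∧
    lam (S.r x) - y (S.r x) = lam x - y x ∧ (¬ S.D x → y (S.t x) = S.s x * y x) ∧
    (S.D x → y x = z x) ∧ (y x ≠ 0 ∧ |y x| ≤ 3) ∧ (lo x ≤ lam x ∧ lam x ≤ lo x + 7) ∧
    (lo x ≤ lam x - y x ∧ lam x - y x ≤ lo x + 7)

variable {S} {κ : V → ℤˣ} {A B : Set V} {dem lam y z : V → ℤ}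

theorem solved_of_local (hz : ∀ x, S.D x → z (S.t x) = S.s x * z x) (h : ∀ v, S.LocalSol z v) :
    S.Solved := by
  let T : Setoid V := ⟨S.Cmp, ⟨Cmp.refl, Cmp.symm, Cmp.trans⟩⟩
  have hrep : ∀ v, S.Cmp (Quotient.mk T v).out v := fun v => Quotient.mk_out (s := T) v
  have hq : ∀ {u v}, S.Cmp u v → Quotient.mk T v = Quotient.mk T u := fun h =>
    (Quotient.sound (s := T) h).symm
  choose lam y lo h using h
  have h' := fun x => h _ x (hrep x)
  have er : ∀ x, Quotient.mk T (S.r x) = Quotient.mk T x := fun x => hq (Cmp.r x)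
  have eb : ∀ x, Quotient.mk T (S.b x) = Quotient.mk T x := fun x => hq (Cmp.b x)
  refine ⟨fun x => lam (Quotient.mk T x).out x, fun x => y (Quotient.mk T x).out x,
    fun x => lo (Quotient.mk T x).out x, fun x => ?_, fun x => ?_, fun x => ?_, fun x => ?_,
    fun x => (h' x).2.2.2.2.2.1, fun x => (h' x).2.2.2.2.2.2.1, fun x => (h' x).2.2.2.2.2.2.2⟩
  · beta_reduce
    rw [eb]; exact (h' x).1
  · beta_reduce
    rw [er, eb]; exact (h' x).2.1
  · beta_reduce
    rw [er]; exact (h' x).2.2.1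
  · beta_reduce
    by_cases hD : S.D x
    · rw [(h' x).2.2.2.2.1 hD, (h' (S.t x)).2.2.2.2.1 ((S.D_t x).2 hD), hz x hD]
    · rw [hq (Cmp.t hD)]; exact (h' x).2.2.2.1 hD

/-- The prescribed values on `D` complete `y`; on the component of `v` their jumps cancel the demand
of the part. -/
theorem Part.localSol (h : S.Part κ A B dem lam y) (v : V) (hz : ∀ x, ¬ S.D x → z x = 0)
    (hflux : ∀ x, S.D x → S.Cmp v x → κ x * (z (S.r x) - z x) = dem x)
    (hdem : ∀ x, ¬ S.D x → dem x = 0) {lo : V → ℤ}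
    (hlo : ∀ x, lo (S.r x) = lo x ∧ lo (S.b x) = lo x)
    (hlam : ∀ x, lo x ≤ lam x ∧ lam x ≤ lo x + 7)
    (hy : ∀ x, ¬ S.D x → y x ≠ 0 ∧ |y x| ≤ 3)
    (hw : ∀ x, ¬ S.D x → lo x ≤ lam x - y x ∧ lam x - y x ≤ lo x + 7)
    (hz' : ∀ x, S.D x → z x ≠ 0 ∧ |z x| ≤ 3)
    (hw' : ∀ x, S.D x → S.Cmp v x → lo x ≤ lam x - z x ∧ lam x - z x ≤ lo x + 7) :
    S.LocalSol z v := by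
  refine ⟨lam, fun x => y x + z x, lo, fun x hx => ⟨h.lam_b x, hlo x, ?_, fun hD => ?_,
    fun hD => ?_, ?_, hlam x, ?_⟩⟩
  · have h1 := h.flux x
    have h2 : κ x * (z (S.r x) - z x) = dem x := by
      by_cases hD : S.D x
      · exact hflux x hD hx
      · rw [hz x hD, hz _ (fun h => hD ((S.D_r x).1 h)), hdem x hD]; simp
    have h3 : (κ x : ℤ) * ((lam (S.r x) - lam x) - (y (S.r x) - y x) - (z (S.r x) - z x)) = 0 := by
      linear_combination h1 - h2
    have h4 := (mul_eq_zero.1 h3).resolve_left (κ x).ne_zero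
    linear_combination h4
  · simp only [h.y_t]
    rw [hz x hD, hz _ (fun h => hD ((S.D_t x).1 h)), add_zero, add_zero]
  · simp only [h.y_D x hD, zero_add]
  · by_cases hD : S.D x
    · simpa [h.y_D x hD] using hz' x hD
    · simpa [hz x hD] using hy x hD
  · by_cases hD : S.D x
    · simpa [h.y_D x hD] using hw' x hD hx
    · simpa [hz x hD] using hw x hD

variable {e : V} {ω ω' : V → ℤˣ}

theorem Frame.symm (h : S.Frame e ω) : S.Frame (S.t e) ω := fun x hx =>
  ⟨(h x hx).1, fun h1 h2 => (h x hx).2 (by rwa [S.ht.inv] at h2) h1⟩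

theorem OddCircuit.exists_tframe [Finite V] (hS : S.OddCircuit) (he : S.D e) :
    ∃ ω, S.Frame e ω := by
  obtain ⟨ω, hω⟩ := SignedCubic.exists_frame S.hr S.ht (fun _ => -1) (fun v => -S.s v)
    (fun _ => rfl) (fun v => by rw [S.s_t]) e
  refine ⟨ω, fun x hx => ?_⟩
  have := hω x (hS.conn e x he hx)
  exact ⟨by rw [this.1, neg_one_mul], this.2⟩

theorem D_of_conn {u v : V} (h : Conn S.r S.t u v) (hu : S.D u) : S.D v :=
  Conn.closed (P := S.D) (fun v h => (S.D_r v).2 h) (fun v h => (S.D_t v).2 h) h hu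

/-- If the alternation also held across the cut, multiplying by a sign that alternates along every
edge of `D` would balance `D`. -/
theorem Frame.cut [Finite V] (h : S.Frame e ω) (hS : S.OddCircuit) (he : S.D e) :
    ω (S.t e) = S.s e * ω e := by
  by_contra hne
  have h1 : ω (S.t e) = -S.s e * ω e := by
    rw [units_eq_neg_of_ne hne, neg_mul]
  obtain ⟨χ, hχ⟩ := exists_alternating S.hr S.ht
  refine hS.odd e he ⟨fun x => χ x * ω x, fun x hx => ?_⟩
  have hD := D_of_conn hx he
  have h2 : ω (S.t x) = -S.s x * ω x := by
    by_cases hx1 : x = e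
    · rw [hx1, h1]
    by_cases hx2 : x = S.t e
    · rw [hx2, S.ht.inv, h1, S.s_t, ← mul_assoc, neg_mul_neg, Int.units_mul_self, one_mul]
    exact (h x hD).2 hx1 hx2
  beta_reduce
  rw [(hχ x).1, (hχ x).2, (h x hD).1, h2]
  refine ⟨by rw [neg_mul_neg, one_mul], ?_⟩
  rw [neg_mul, neg_mul, mul_neg, neg_neg]
  ac_rfl

/-- By `Frame.cut` both frames behave alike even across the cut, so their ratio is constant on `D`.
Consistency can therefore be tested on a single frame. -/
theorem Frame.mul_eq [Finite V] (h : S.Frame e ω) (h' : S.Frame e ω') (hS : S.OddCircuit)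
    (he : S.D e) {x : V} (hx : S.D x) : ω x * ω' x = ω e * ω' e := by
  refine (Conn.closed (P := fun x => S.D x ∧ ω x * ω' x = ω e * ω' e) (fun x hx => ?_)
    (fun x hx => ?_) (hS.conn e x he hx) ⟨he, rfl⟩).2
  · rw [S.D_r, (h x hx.1).1, (h' x hx.1).1, neg_mul_neg]
    exact hx
  · rw [S.D_t]
    refine ⟨hx.1, ?_⟩
    by_cases hx1 : x = e
    · rw [hx1, h.cut hS he, h'.cut hS he, mul_mul_mul_comm, Int.units_mul_self, one_mul]
    by_cases hx2 : x = S.t e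
    · rw [hx2, S.ht.inv]
    · rw [((h x hx.1).2 hx1 hx2), ((h' x hx.1).2 hx1 hx2), mul_mul_mul_comm, neg_mul_neg,
        Int.units_mul_self, one_mul, hx.2]

theorem Frame.cons [Finite V] (h : S.Frame e ω) (hS : S.OddCircuit) (he : S.D e) {z : V}
    (hc : ∀ x y, S.D x → S.D y → S.Cmp z x → S.Cmp z y → κ x * ω x = κ y * ω y) :
    S.Cons κ z e := fun ω' h' x y hx hy hzx hzy => by
  have h1 : ∀ x, S.D x → κ x * ω' x = (κ x * ω x) * (ω e * ω' e) := fun x hx => by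
    rw [← h.mul_eq h' hS he hx, mul_assoc, ← mul_assoc (ω x), Int.units_mul_self, one_mul]
  rw [h1 x hx, h1 y hy, hc x y hx hy hzx hzy]

theorem cons_t {z : V} : S.Cons κ z (S.t e) ↔ S.Cons κ z e :=
  ⟨fun h ω hω => h ω hω.symm, fun h ω hω => h ω (by have := hω.symm; rwa [S.ht.inv] at this)⟩

theorem Cons.congr {z z' : V} (h : S.Cons κ z e) (hz : S.Cmp z z') : S.Cons κ z' e :=
  fun ω hω x y hx hy hzx hzy => h ω hω x y hx hy (hz.trans hzx) (hz.trans hzy)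

theorem sum_eq_zero_of_anti [Fintype V] {p : V → V} (hp : FPF p) (f : V → ℤ)
    (h : ∀ v, f (p v) = -f v) : ∑ v, f v = 0 :=
  Finset.sum_involution (fun v _ => p v) (fun v _ => by rw [h]; ring) (fun v _ _ => hp.ne v)
    (fun v _ => Finset.mem_univ _) (fun v _ => hp.inv v)

/-- A flow that does not vanish on `D` forces an inconsistency at every `t`-edge of `D`. -/
theorem exists_not_cons [Finite V] (hS : S.OddCircuit) (hκ : ∀ w, S.Good κ w) {z₀ z₁ z₂ : V → ℤ}
    (h₀ : ∀ v, z₀ (S.r v) = z₀ v) (h₁ : ∀ v, z₁ (S.b v) = z₁ v)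
    (h₂ : ∀ v, z₂ (S.t v) = S.s v * z₂ v) (hsum : ∀ v, z₀ v + z₁ v + z₂ v = 0)
    (hne : ∀ v, z₂ v ≠ 0) (he : S.D e) : ∃ z, S.D z ∧ ¬ S.Cons κ z e := by
  classical
  have := Fintype.ofFinite V
  by_contra hcon
  push Not at hcon
  obtain ⟨ω, hω⟩ := hS.exists_tframe he
  let T : Setoid V := ⟨S.Cmp, ⟨Cmp.refl, Cmp.symm, Cmp.trans⟩⟩
  have hrep : ∀ v, S.Cmp (Quotient.mk T v).out v := fun v => Quotient.mk_out (s := T) v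
  have hq : ∀ {u v}, S.Cmp u v → Quotient.mk T v = Quotient.mk T u := fun h =>
    (Quotient.sound (s := T) h).symm
  have hc : ∀ q : V, ∃ c : ℤˣ, ∀ x, S.D x → S.Cmp q x → c * κ x = ω x := fun q => by
    by_cases h : ∃ d, S.D d ∧ S.Cmp q d
    · obtain ⟨d, hd, hqd⟩ := h
      refine ⟨κ d * ω d, fun x hx hqx => ?_⟩
      rw [hcon d hd ω hω d x hd hx (Cmp.refl d) (hqd.symm.trans hqx), mul_right_comm,
        Int.units_mul_self, one_mul]
    · exact ⟨1, fun x hx hqx => absurd ⟨x, hx, hqx⟩ h⟩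
  choose c hc using hc
  -- If every component is consistent at `e`, rescaling `κ` component by component gives signs that
  -- cancel the two end values on every edge but the `t`-edge of `e`. Summing `k` times the flow
  -- over all vertices then forces `z₂ e = 0`.
  let k : V → ℤˣ := fun v => c (Quotient.mk T v).out * κ v
  have kr : ∀ v, k (S.r v) = -k v := fun v => by
    simp only [k]
    rw [hq (Cmp.r v), (hκ v).1, mul_neg]
  have kb : ∀ v, k (S.b v) = -k v := fun v => by
    simp only [k]
    rw [hq (Cmp.b v), (hκ v).2.1, mul_neg]
  have kD : ∀ v, S.D v → k v = ω v := fun v hv => hc _ v hv (hrep v)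
  have kt : ∀ v, v ≠ e → v ≠ S.t e → k (S.t v) = -S.s v * k v := fun v h1 h2 => by
    by_cases hD : S.D v
    · rw [kD v hD, kD _ ((S.D_t v).2 hD), (hω v hD).2 h1 h2]
    · simp only [k]
      rw [hq (Cmp.t hD), (hκ v).2.2 hD]
      ac_rfl
  have ke : k (S.t e) = S.s e * k e := by
    rw [kD e he, kD _ ((S.D_t e).2 he), hω.cut hS he]
  clear_value k
  have ss : ∀ v, (S.s v : ℤ) * S.s v = 1 := fun v => by
    rw [← Units.val_mul, Int.units_mul_self, Units.val_one]
  have s0 : ∑ v, (k v : ℤ) * z₀ v = 0 := sum_eq_zero_of_anti S.hr _ fun v => by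
    rw [kr, h₀, Units.val_neg]; ring
  have s1 : ∑ v, (k v : ℤ) * z₁ v = 0 := sum_eq_zero_of_anti S.hb _ fun v => by
    rw [kb, h₁, Units.val_neg]; ring
  have s2 : ∑ v, ((k v : ℤ) * z₂ v - ind S.t e v * (k e * z₂ e)) = 0 :=
    sum_eq_zero_of_anti S.ht _ fun v => by
      by_cases h1 : v = e
      · rw [h1, ind_apply S.ht, ind_self, ke, h₂, Units.val_mul]
        linear_combination (k e : ℤ) * z₂ e * ss e
      by_cases h2 : v = S.t e
      · rw [h2, S.ht.inv, ind_apply S.ht, ind_self, ke, h₂, Units.val_mul]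
        linear_combination (k e : ℤ) * z₂ e * ss e
      · rw [ind_apply S.ht, ind_eq_zero h1 h2, kt v h1 h2, h₂, Units.val_mul, Units.val_neg]
        linear_combination -(k v : ℤ) * z₂ v * ss v
  have s3 : ∑ v, (k v : ℤ) * z₂ v = 0 := by
    have : ∑ v, ((k v : ℤ) * z₀ v + k v * z₁ v + k v * z₂ v) = 0 :=
      Finset.sum_eq_zero fun v _ => by linear_combination (k v : ℤ) * hsum v
    rw [Finset.sum_add_distrib, Finset.sum_add_distrib, s0, s1] at this
    linarith
  rw [Finset.sum_sub_distrib, s3, ← Finset.sum_mul, zero_sub, neg_eq_zero, mul_eq_zero] at s2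
  have hpos : 0 < ∑ v, ind S.t e v :=
    Finset.sum_pos' (fun v _ => ind_nonneg e v) ⟨e, Finset.mem_univ e, by rw [ind_self]; norm_num⟩
  rcases s2 with h | h
  · omega
  · rcases mul_eq_zero.1 h with h | h
    · exact (k e).ne_zero h
    · exact hne e h

end Cfg

end SignedCubic

/-! ### Parametrizing `D` and realising potentials on it. -/

namespace SignedCubic

namespace Cfg

variable {V : Type*} {S : Cfg V} {κ : V → ℤˣ} {e : V} {m : ℕ} {a : ℕ → V} {idx : V → ℕ} {W : V → ℤˣ}

/-- A parametrization of `D` starting at the `t`-edge of `e`, with a frame cut there. -/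
structure Chart (S : Cfg V) (e : V) (m : ℕ) (a : ℕ → V) (idx : V → ℕ) (W : V → ℤˣ) : Prop where
  odd : S.OddCircuit
  mem : S.D e
  circ : IsCircuit S.r S.t e m a idx
  frame : S.Frame e W

theorem OddCircuit.exists_chart [Finite V] (hS : S.OddCircuit) (he : S.D e) :
    ∃ m a idx W, S.Chart e m a idx W := by
  obtain ⟨m, a, idx, h⟩ := exists_isCircuit S.hr S.ht e
  obtain ⟨W, hW⟩ := hS.exists_tframe he
  exact ⟨m, a, idx, W, hS, he, h, hW⟩

namespace Chart

theorem D_a (h : S.Chart e m a idx W) (i : ℕ) : S.D (a i) := D_of_conn (h.circ.conn i) h.mem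

theorem cases (h : S.Chart e m a idx W) {x : V} (hx : S.D x) :
    ∃ k < m, x = a (2 * k) ∨ x = a (2 * k + 1) :=
  h.circ.cases_vertex (h.odd.conn e x h.mem hx)

theorem W_odd (h : S.Chart e m a idx W) (k : ℕ) : W (a (2 * k + 1)) = -W (a (2 * k)) := by
  rw [← h.circ.left, (h.frame _ (h.D_a _)).1]

theorem κ_odd (h : S.Chart e m a idx W) (hκ : ∀ w, S.Good κ w) (k : ℕ) :
    κ (a (2 * k + 1)) = -κ (a (2 * k)) := by
  rw [← h.circ.left, (hκ _).1]

theorem cmp_odd (h : S.Chart e m a idx W) {v : V} (k : ℕ) :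
    S.Cmp v (a (2 * k + 1)) ↔ S.Cmp v (a (2 * k)) := by
  rw [← h.circ.left]
  exact Cmp.congr (Cmp.r _).symm

theorem ind_even (h : S.Chart e m a idx W) {p k : ℕ} (hp : p < m) (hk : k < m) :
    ind S.r (a (2 * p)) (a (2 * k)) = if k = p then 1 else 0 := by
  split_ifs with h1
  · rw [h1, ind_self]
  · refine ind_eq_zero (fun h2 => ?_) (fun h2 => ?_)
    · have := h.circ.inj (by omega) (by omega) h2
      omega
    · rw [h.circ.left] at h2
      have := h.circ.inj (by omega) (by omega) h2
      omega

theorem ind_odd (h : S.Chart e m a idx W) {p k : ℕ} (hp : p < m) (hk : k < m) :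
    ind S.r (a (2 * p)) (a (2 * k + 1)) = if k = p then 1 else 0 := by
  rw [← h.circ.left, ind_apply S.hr, h.ind_even hp hk]

/-- Edge values on `D` given by potentials at the `t`-edges. -/
theorem exists_values [Finite V] (h : S.Chart e m a idx W) {ξ : ℕ → ℤ} (hξ : ξ m = -ξ 0) :
    ∃ z : V → ℤ, (∀ x, ¬ S.D x → z x = 0) ∧ (∀ x, S.D x → z (S.t x) = S.s x * z x) ∧
      ∀ k < m, z (a (2 * k)) = W (a (2 * k)) * ξ k ∧
        z (a (2 * k + 1)) = W (a (2 * k)) * ξ (k + 1) := by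
  classical
  -- Positions `2 * k - 1` and `2 * k` are joined by a `t`-edge and both receive `ξ k`, whence `(idx
  -- x + 1) / 2`. At odd positions `-W` is the frame sign of the other end of the `r`-edge.
  let z : V → ℤ := fun x => if S.D x then
    (if idx x % 2 = 0 then (W x : ℤ) else -W x) * ξ ((idx x + 1) / 2) else 0
  have hval : ∀ k < m, z (a (2 * k)) = W (a (2 * k)) * ξ k ∧
      z (a (2 * k + 1)) = W (a (2 * k)) * ξ (k + 1) := fun k hk => by
    constructor
    · simp only [z, if_pos (h.D_a _)]
      rw [h.circ.idx_a _ (by omega), if_pos (by omega)]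
      congr 2
      omega
    · simp only [z, if_pos (h.D_a _)]
      rw [h.circ.idx_a _ (by omega), if_neg (by omega), h.W_odd, Units.val_neg, neg_neg]
      congr 2
      omega
  have ss : ∀ v, (S.s v : ℤ) * S.s v = 1 := fun v => by
    rw [← Units.val_mul, Int.units_mul_self, Units.val_one]
  have hodd : ∀ k < m, z (S.t (a (2 * k + 1))) = S.s (a (2 * k + 1)) * z (a (2 * k + 1)) := by
    intro k hk
    rw [(hval k hk).2, h.circ.right]
    rcases Nat.lt_or_ge (k + 1) m with h1 | h1
    · have h2 := (h.frame (a (2 * k + 1)) (h.D_a _)).2 (fun h3 => by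
        rw [← h.circ.zero] at h3
        have := h.circ.inj (by omega) (by omega) h3
        omega) (fun h3 => by
        rw [← h.circ.zero, h.circ.right_zero S.ht] at h3
        have := h.circ.inj (by omega) (by omega) h3
        omega)
      rw [h.circ.right, h.W_odd, neg_mul_neg] at h2
      have h3 := (hval (k + 1) h1).1
      rw [show 2 * (k + 1) = 2 * k + 2 by ring] at h3
      rw [h3, h2, Units.val_mul]
      ring
    -- This is the cut edge: its frame sign is opposite to that of the other `t`-edges, which is
    -- compensated by `ξ m = -ξ 0`.
    · have h2 : 2 * k + 2 = 2 * m := by omega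
      have h3 := h.frame.cut h.odd h.mem
      have h4 : a (2 * k + 1) = S.t e := by
        rw [← h.circ.zero, h.circ.right_zero S.ht]
        congr 1
        omega
      have h5 := h.W_odd k
      rw [h4, h3] at h5
      have h6 := (hval 0 h.circ.pos).1
      rw [mul_zero, h.circ.zero] at h6
      rw [h2, h.circ.last, h6, show k + 1 = m by omega, hξ, h4, S.s_t]
      have h7 : (W (a (2 * k)) : ℤ) = -(S.s e * W e) := by
        have := congrArg (fun u : ℤˣ => (u : ℤ)) h5
        push_cast at this
        linarith
      rw [h7]
      linear_combination -(W e : ℤ) * ξ 0 * ss e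
  refine ⟨z, fun x hx => by simp only [z, if_neg hx], fun x hx => ?_, hval⟩
  obtain ⟨k, hk, rfl | rfl⟩ := h.cases hx
  · obtain ⟨j, hj, hj' | hj'⟩ := h.cases ((S.D_t (a (2 * k))).2 hx)
    · exfalso
      have h1 : S.t (a (2 * j)) = a (2 * k) := by rw [← hj', S.ht.inv]
      rcases Nat.eq_zero_or_pos j with rfl | h0
      · rw [mul_zero, h.circ.right_zero S.ht] at h1
        have := h.circ.inj (by omega) (by omega) h1
        omega
      · have h2 := h.circ.right' S.ht (j - 1)
        rw [show 2 * (j - 1) + 2 = 2 * j by omega, h1] at h2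
        have := h.circ.inj (by omega) (by omega) h2
        omega
    · have h1 := hodd j hj
      rw [← hj', S.ht.inv, S.s_t] at h1
      rw [h1, ← mul_assoc, ss, one_mul]
  · exact hodd k hk

/-- Moving the cut from gap 0 to gap `n` negates the frame on the positions passed over. -/
theorem frame_shift [Finite V] (h : S.Chart e m a idx W) {n : ℕ} (hn : n < m) :
    S.Frame (a (2 * n)) (fun x => if idx x < 2 * n then -W x else W x) := by
  rcases Nat.eq_zero_or_pos n with rfl | h0
  · simpa [h.circ.zero] using h.frame
  have hodd : ∀ k < m, a (2 * k + 1) ≠ S.t (a (2 * n)) →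
      (if idx (S.t (a (2 * k + 1))) < 2 * n then -W (S.t (a (2 * k + 1)))
        else W (S.t (a (2 * k + 1))))
      = -S.s (a (2 * k + 1)) * (if idx (a (2 * k + 1)) < 2 * n then -W (a (2 * k + 1))
        else W (a (2 * k + 1))) := by
    intro k hk hne
    have hne' : k + 1 ≠ n := by
      rintro rfl
      apply hne
      rw [show 2 * (k + 1) = 2 * k + 2 by ring, h.circ.right' S.ht]
    rcases Nat.lt_or_ge (k + 1) m with h1 | h1
    · have h2 := (h.frame (a (2 * k + 1)) (h.D_a _)).2 (fun h3 => by
        rw [← h.circ.zero] at h3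
        have := h.circ.inj (by omega) (by omega) h3
        omega) (fun h3 => by
        rw [← h.circ.zero, h.circ.right_zero S.ht] at h3
        have := h.circ.inj (by omega) (by omega) h3
        omega)
      rw [h2, h.circ.right, h.circ.idx_a _ (by omega), h.circ.idx_a _ (by omega)]
      split_ifs
      · rw [mul_neg]
      · omega
      · omega
      · rfl
    · have h2 : 2 * k + 2 = 2 * m := by omega
      have h4 : a (2 * k + 1) = S.t e := by
        rw [← h.circ.zero, h.circ.right_zero S.ht]
        congr 1
        omega
      have h5 := h.circ.idx_a (2 * k + 1) (by omega)
      have h6 := h.circ.idx_a 0 (by omega)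
      rw [h.circ.zero] at h6
      rw [h4] at h5 ⊢
      rw [S.ht.inv, h5, h6, if_pos (by omega), if_neg (by omega), h.frame.cut h.odd h.mem, S.s_t,
        neg_mul, ← mul_assoc, Int.units_mul_self, one_mul]
  intro x hx
  beta_reduce
  obtain ⟨k, hk, rfl | rfl⟩ := h.cases hx
  · refine ⟨?_, fun h1 h2 => ?_⟩
    · rw [h.circ.left, h.W_odd, h.circ.idx_a _ (by omega), h.circ.idx_a _ (by omega)]
      split_ifs <;> first | rfl | omega
    · obtain ⟨j, hj, hj' | hj'⟩ := h.cases ((S.D_t (a (2 * k))).2 hx)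
      · exfalso
        have h1 : S.t (a (2 * j)) = a (2 * k) := by rw [← hj', S.ht.inv]
        rcases Nat.eq_zero_or_pos j with rfl | h0
        · rw [mul_zero, h.circ.right_zero S.ht] at h1
          have := h.circ.inj (by omega) (by omega) h1
          omega
        · have h2 := h.circ.right' S.ht (j - 1)
          rw [show 2 * (j - 1) + 2 = 2 * j by omega, h1] at h2
          have := h.circ.inj (by omega) (by omega) h2
          omega
      · have h3 := hodd j hj (by
          rw [← hj']
          exact fun h3 => h1 (S.ht.inj h3))
        rw [← hj', S.ht.inv, S.s_t] at h3
        rw [h3, ← mul_assoc, neg_mul_neg, Int.units_mul_self, one_mul]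
  · refine ⟨?_, fun h1 h2 => hodd k hk h2⟩
    rw [h.circ.left' S.hr, h.W_odd, h.circ.idx_a _ (by omega), h.circ.idx_a _ (by omega)]
    split_ifs <;> first | rfl | omega | exact (neg_neg _).symm

/-- The sign of the edge number `k` of `D` in the chart. -/
def τ (κ : V → ℤˣ) (a : ℕ → V) (W : V → ℤˣ) (k : ℕ) : ℤˣ := κ (a (2 * k)) * W (a (2 * k))

/-- By `frame_shift` and `Frame.cons` it is enough to test the shifted frame. Since `κ` and the
frame both change sign across an `r`-edge of `D`, their product depends only on the edge number. -/
theorem not_cons_iff [Finite V] (h : S.Chart e m a idx W) (hκ : ∀ w, S.Good κ w) {n : ℕ}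
    (hn : n < m) (z : V) :
    ¬ S.Cons κ z (a (2 * n)) ↔ Incons (fun k => k < m ∧ S.Cmp z (a (2 * k))) (τ κ a W) n := by
  have hf := h.frame_shift hn
  have hval : ∀ k < m, κ (a (2 * k)) * (if idx (a (2 * k)) < 2 * n then -W (a (2 * k))
      else W (a (2 * k))) = if k < n then -τ κ a W k else τ κ a W k := fun k hk => by
    rw [h.circ.idx_a _ (by omega)]
    unfold τ
    split_ifs
    · rw [mul_neg]
    · omega
    · omega
    · rfl
  have hval' : ∀ k < m, κ (a (2 * k + 1)) * (if idx (a (2 * k + 1)) < 2 * n then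
      -W (a (2 * k + 1)) else W (a (2 * k + 1))) = if k < n then -τ κ a W k else τ κ a W k :=
    fun k hk => by
      rw [h.circ.idx_a _ (by omega), h.κ_odd hκ, h.W_odd]
      unfold τ
      split_ifs
      · rw [neg_mul, neg_neg]
      · omega
      · omega
      · rw [neg_mul_neg]
  constructor
  · intro h1
    by_contra h2
    refine h1 (hf.cons h.odd (h.D_a _) fun x y hx hy hzx hzy => ?_)
    by_contra h3
    apply h2
    obtain ⟨j, hj, hj'⟩ := h.cases hx
    obtain ⟨k, hk, hk'⟩ := h.cases hy
    refine ⟨j, k, ⟨hj, ?_⟩, ⟨hk, ?_⟩, fun h4 => h3 ?_⟩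
    · rcases hj' with rfl | rfl
      exacts [hzx, (h.cmp_odd j).1 hzx]
    · rcases hk' with rfl | rfl
      exacts [hzy, (h.cmp_odd k).1 hzy]
    · rcases hj' with rfl | rfl <;> rcases hk' with rfl | rfl <;>
        simp only [hval j hj, hval k hk, hval' j hj, hval' k hk, h4]
  · rintro ⟨j, k, ⟨hj, hzj⟩, ⟨hk, hzk⟩, hjk⟩ h1
    have := h1 _ hf _ _ (h.D_a _) (h.D_a _) hzj hzk
    beta_reduce at this
    rw [hval j hj, hval k hk] at this
    exact hjk this

theorem flux_values (h : S.Chart e m a idx W) (hκ : ∀ w, S.Good κ w) {ξ : ℕ → ℤ} {z : V → ℤ}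
    (hz : ∀ k < m, z (a (2 * k)) = W (a (2 * k)) * ξ k ∧
        z (a (2 * k + 1)) = W (a (2 * k)) * ξ (k + 1)) {k : ℕ} (hk : k < m) :
    κ (a (2 * k)) * (z (S.r (a (2 * k))) - z (a (2 * k))) = τ κ a W k * (ξ (k + 1) - ξ k) ∧
    κ (a (2 * k + 1)) * (z (S.r (a (2 * k + 1))) - z (a (2 * k + 1)))
      = τ κ a W k * (ξ (k + 1) - ξ k) := by
  rw [h.circ.left, h.circ.left' S.hr, (hz k hk).1, (hz k hk).2, h.κ_odd hκ, τ, Units.val_mul,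
    Units.val_neg]
  constructor <;> ring

theorem abs_values {ξ : ℕ → ℤ} {z : V → ℤ} (u : ℤˣ) {n : ℕ} {x : V} (hz : z x = u * ξ n) :
    |z x| = |ξ n| := by
  rw [hz, abs_mul]
  rcases Int.units_eq_one_or u with h | h <;> simp [h]

/-- The values on `D` extend to a component that contains no change of the potential. -/
theorem localSol_of_const [Finite V] (h : S.Chart e m a idx W) (hκ : ∀ w, S.Good κ w) {ξ : ℕ → ℤ}
    {z : V → ℤ} (hz0 : ∀ x, ¬ S.D x → z x = 0)
    (hz : ∀ k < m, z (a (2 * k)) = W (a (2 * k)) * ξ k ∧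
        z (a (2 * k + 1)) = W (a (2 * k)) * ξ (k + 1))
    (hz' : ∀ x, S.D x → z x ≠ 0 ∧ |z x| ≤ 3) {v : V}
    (hc : ∀ k < m, S.Cmp v (a (2 * k)) → ξ (k + 1) = ξ k) : S.LocalSol z v := by
  obtain ⟨y, h1, h2⟩ := exists_base S κ ∅ ∅
  refine h1.localSol v hz0 (fun x hx hvx => ?_) (fun _ _ => rfl) (lo := fun _ => -3)
    (fun _ => ⟨rfl, rfl⟩) (fun _ => by simp) (fun x hx => ?_) (fun x hx => ?_) hz'
    (fun x hx _ => ?_)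
  · obtain ⟨k, hk, rfl | rfl⟩ := h.cases hx
    · rw [(h.flux_values hκ hz hk).1, hc k hk hvx]; simp
    · rw [(h.flux_values hκ hz hk).2, hc k hk ((h.cmp_odd k).1 hvx)]; simp
  · have := h2 x hx
    exact ⟨this.1, by omega⟩
  · have := abs_le.1 (h2 x hx).2
    simp only [Pi.zero_apply]
    omega
  · have := abs_le.1 (hz' x hx).2
    simp only [Pi.zero_apply]
    omega

/-- The values on `D` extend to a component with a single or double path. -/
theorem localSol_of_path [Finite V] (h : S.Chart e m a idx W) (hκ : ∀ w, S.Good κ w) {ξ : ℕ → ℤ}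
    {z : V → ℤ} (hz0 : ∀ x, ¬ S.D x → z x = 0)
    (hz : ∀ k < m, z (a (2 * k)) = W (a (2 * k)) * ξ k ∧
        z (a (2 * k + 1)) = W (a (2 * k)) * ξ (k + 1))
    (hz' : ∀ x, S.D x → z x ≠ 0 ∧ |z x| ≤ 3) {v : V} {w : ℤ} (hw : w = 1 ∨ w = 2) {p q : ℕ}
    (hp : p < m) (hq : q < m) (hvp : S.Cmp v (a (2 * p))) (hvq : S.Cmp v (a (2 * q)))
    (hc : ∀ k < m, S.Cmp v (a (2 * k)) → τ κ a W k * (ξ (k + 1) - ξ k)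
      = w * ((if k = p then 1 else 0) - if k = q then 1 else 0))
    (hs : ∀ k < m, S.Cmp v (a (2 * k)) → |ξ k| + w ≤ 4 ∨ |ξ (k + 1)| + w ≤ 4) :
    S.LocalSol z v := by
  have hst := exists_stage_of_good hκ (a (2 * q))
  obtain ⟨lam, y, h1, h2, h3⟩ := (hst.hasPath_hasPair_hasSpec (h.D_a _)).1 (a (2 * p))
    (Or.inl (hvq.symm.trans hvp)) w hw
  have hlam : ∀ x, 0 ≤ lam x ∧ lam x ≤ w := fun x => by
    rcases h2 x with h | h <;> rcases hw with rfl | rfl <;> omega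
  have hflux : ∀ x, S.D x → S.Cmp v x → κ x * (z (S.r x) - z x)
      = w * (ind S.r (a (2 * p)) x - ind S.r (a (2 * q)) x) := fun x hx hvx => by
    obtain ⟨k, hk, rfl | rfl⟩ := h.cases hx
    · rw [(h.flux_values hκ hz hk).1, hc k hk hvx, h.ind_even hp hk, h.ind_even hq hk]
    · rw [(h.flux_values hκ hz hk).2, hc k hk ((h.cmp_odd k).1 hvx), h.ind_odd hp hk,
        h.ind_odd hq hk]
  have hinv : ∀ x, S.D x → S.Cmp v x → lam (S.r x) - z (S.r x) = lam x - z x := fun x hx hvx => by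
    have h4 := h1.flux x
    rw [h1.y_D x hx, h1.y_D _ ((S.D_r x).2 hx), ← hflux x hx hvx] at h4
    have h5 := mul_left_cancel₀ (κ x).ne_zero h4
    linarith
  refine h1.localSol v hz0 hflux (fun x hx => ?_) (lo := fun _ => -3)
    (fun _ => ⟨rfl, rfl⟩) (fun x => ?_) (fun x hx => ?_) (fun x hx => ?_) hz'
    (fun x hx hvx => ?_)
  · have hD : ∀ v, S.D v → S.D (S.r v) := fun v h => (S.D_r v).2 h
    rw [ind_of_closed hD (h.D_a _) hx, ind_of_closed hD (h.D_a _) hx, sub_self, mul_zero]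
  · have := hlam x
    omega
  · have := h3 x hx
    exact ⟨this.1, by omega⟩
  · have := h3 x hx
    have h4 := hlam x
    have h5 := neg_abs_le (y x)
    have h6 := le_abs_self (y x)
    omega
  · have key : ∀ x, |z x| + w ≤ 4 → -3 ≤ lam x - z x ∧ lam x - z x ≤ -3 + 7 := fun x hx => by
      have h4 := hlam x
      have h5 := neg_abs_le (z x)
      have h6 := le_abs_self (z x)
      omega
    obtain ⟨k, hk, hxk⟩ := h.cases hx
    have hvk : S.Cmp v (a (2 * k)) := by
      rcases hxk with rfl | rfl
      exacts [hvx, (h.cmp_odd k).1 hvx]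
    -- By `hinv`, `lam - z` agrees at the two ends of an `r`-edge, so a bound at one end serves
    -- both.
    have hboth : (-3 ≤ lam (a (2 * k)) - z (a (2 * k)) ∧ lam (a (2 * k)) - z (a (2 * k)) ≤ -3 + 7)
        ∨ -3 ≤ lam (a (2 * k + 1)) - z (a (2 * k + 1)) ∧
          lam (a (2 * k + 1)) - z (a (2 * k + 1)) ≤ -3 + 7 :=
      (hs k hk hvk).imp (fun h4 => key _ (by rwa [abs_values _ (hz k hk).1]))
        (fun h4 => key _ (by rwa [abs_values _ (hz k hk).2]))
    have hinv' := hinv _ (h.D_a (2 * k)) hvk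
    rw [h.circ.left] at hinv'
    rcases hxk with rfl | rfl
    · rcases hboth with h4 | h4
      · exact h4
      · rwa [hinv'] at h4
    · rcases hboth with h4 | h4
      · rwa [← hinv'] at h4
      · exact h4

end Chart

end Cfg

end SignedCubic

/-! ### Solving the case of consistent signs. -/

namespace SignedCubic

namespace Cfg

variable {V : Type*} {S : Cfg V} {κ : V → ℤˣ} {e : V} {m : ℕ} {a : ℕ → V} {idx : V → ℕ} {W : V → ℤˣ}

namespace Chart

/-- Three edges of `D` with alternating signs in one component. -/
theorem solved_of_alternating [Finite V] (h : S.Chart e m a idx W) (hκ : ∀ w, S.Good κ w)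
    {i j k : ℕ} (hij : i < j) (hjk : j < k) (hk : k < m) (hci : S.Cmp (a (2 * j)) (a (2 * i)))
    (hck : S.Cmp (a (2 * j)) (a (2 * k))) (hi : τ κ a W i = -τ κ a W j)
    (hk' : τ κ a W k = -τ κ a W j) : S.Solved := by
  set σ := τ κ a W j with hσ
  -- The potential takes the values 2, 1, -1, -2 up to the sign `σ`. With the alternating `τ`, its
  -- jumps become unit demands at `i` and `k` and a demand of `-2` at `j`, as supplied by a pair of
  -- paths rooted at `j`.
  let ξ : ℕ → ℤ := fun n => σ * ((if n ≤ i then 2 else if n ≤ j then 1 else if n ≤ k then -1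
    else -2))
  have hξ : ∀ n, ξ n = σ * ((if n ≤ i then 2 else if n ≤ j then 1 else if n ≤ k then -1
    else -2)) := fun n => rfl
  have hξ2 : ∀ n, ξ n ≠ 0 ∧ |ξ n| ≤ 2 := fun n => by
    rw [hξ]
    rcases Int.units_eq_one_or σ with h | h <;> rw [h] <;> split_ifs <;> norm_num
  obtain ⟨z, hz0, hzt, hz⟩ := h.exists_values (ξ := ξ) (by
    rw [hξ, hξ, if_neg (by omega), if_neg (by omega), if_neg (by omega), if_pos (by omega)]; ring)
  have hz2 : ∀ x, S.D x → z x ≠ 0 ∧ |z x| ≤ 2 := fun x hx => by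
    obtain ⟨k, hk, rfl | rfl⟩ := h.cases hx
    · rw [abs_values _ (hz k hk).1, (hz k hk).1]
      exact ⟨mul_ne_zero (Units.ne_zero _) (hξ2 _).1, (hξ2 _).2⟩
    · rw [abs_values _ (hz k hk).2, (hz k hk).2]
      exact ⟨mul_ne_zero (Units.ne_zero _) (hξ2 _).1, (hξ2 _).2⟩
  have hz' : ∀ x, S.D x → z x ≠ 0 ∧ |z x| ≤ 3 := fun x hx =>
    ⟨(hz2 x hx).1, (hz2 x hx).2.trans (by norm_num)⟩
  refine solved_of_local hzt fun v => ?_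
  by_cases hv : S.Cmp v (a (2 * j))
  · have hst := exists_stage_of_good hκ (a (2 * j))
    obtain ⟨lam, y, lo, h1, h2, h3, h4, h5, h6⟩ := (hst.hasPath_hasPair_hasSpec (h.D_a _)).2.1
      (a (2 * i)) (a (2 * k)) (Or.inl hci) (Or.inl hck)
    have hjump : ∀ n, τ κ a W n * (ξ (n + 1) - ξ n)
        = (if n = i then 1 else 0) + (if n = k then 1 else 0) - 2 * if n = j then 1 else 0 := by
      have hσσ : (σ : ℤ) * σ = 1 := by rw [← Units.val_mul, Int.units_mul_self, Units.val_one]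
      intro n
      rw [hξ, hξ]
      by_cases e1 : n = i
      · subst e1
        rw [hi, if_neg (by omega), if_pos (by omega), if_pos le_rfl, if_pos rfl,
          if_neg (by omega), if_neg (by omega), Units.val_neg]
        linear_combination hσσ
      by_cases e2 : n = j
      · subst e2
        rw [← hσ, if_neg (by omega), if_neg (by omega), if_pos (by omega), if_neg (by omega),
          if_pos le_rfl, if_neg (by omega), if_neg (by omega), if_pos rfl]
        linear_combination (-2) * hσσ
      by_cases e3 : n = k
      · subst e3
        rw [hk', if_neg (by omega), if_neg (by omega), if_neg (by omega), if_neg (by omega),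
          if_neg (by omega), if_pos le_rfl, if_neg (by omega), if_pos rfl, if_neg (by omega),
          Units.val_neg]
        linear_combination hσσ
      rw [if_neg e1, if_neg e2, if_neg e3]
      have : ∀ c, n ≠ c → (n + 1 ≤ c ↔ n ≤ c) := fun c hc => by omega
      simp only [this i e1, this j e2, this k e3]
      ring
    refine h1.localSol v hz0 (fun x hx hvx => ?_) (fun x hx => ?_) h4 (fun x => ?_) h3 h6 hz'
      (fun x hx hvx => ?_)
    · obtain ⟨n, hn, rfl | rfl⟩ := h.cases hx
      · rw [(h.flux_values hκ hz hn).1, hjump, h.ind_even (by omega) hn,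
          h.ind_even (by omega) hn, h.ind_even (by omega) hn]
      · rw [(h.flux_values hκ hz hn).2, hjump, h.ind_odd (by omega) hn,
          h.ind_odd (by omega) hn, h.ind_odd (by omega) hn]
    · have hD : ∀ v, S.D v → S.D (S.r v) := fun v h => (S.D_r v).2 h
      rw [ind_of_closed hD (h.D_a _) hx, ind_of_closed hD (h.D_a _) hx,
        ind_of_closed hD (h.D_a _) hx]
      ring
    · have := h2 x
      have := h5 x
      omega
    · have := h2 x
      have := h5 x
      have := abs_le.1 (hz2 x hx).2
      omega
  · refine h.localSol_of_const hκ hz0 hz hz' fun n hn hvn => ?_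
    have : ∀ c, S.Cmp (a (2 * j)) (a (2 * c)) → (n + 1 ≤ c ↔ n ≤ c) := fun c hc => by
      have : n ≠ c := by
        rintro rfl
        exact hv (hvn.trans hc.symm)
      omega
    rw [hξ, hξ]
    simp only [this i hci, this j (Cmp.refl _), this k hck]

end Chart

/-- The case of globally consistent signs `κ`. -/
theorem solved_of_good [Finite V] (hS : S.OddCircuit) (hκ : ∀ w, S.Good κ w) {z₀ z₁ z₂ : V → ℤ}
    (h₀ : ∀ v, z₀ (S.r v) = z₀ v) (h₁ : ∀ v, z₁ (S.b v) = z₁ v)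
    (h₂ : ∀ v, z₂ (S.t v) = S.s v * z₂ v) (hsum : ∀ v, z₀ v + z₁ v + z₂ v = 0)
    (hne : ∀ v, z₂ v ≠ 0) {d : V} (hd : S.D d) : S.Solved := by
  classical
  have := Fintype.ofFinite V
  -- `F` is a smallest set of representatives of components such that each `t`-edge of `D` has an
  -- inconsistent one; minimality gives every member a `t`-edge of its own.
  obtain ⟨F, ⟨hFD, hF⟩, hmin⟩ := exists_minimizer
    (fun F : Finset V => (∀ z ∈ F, S.D z) ∧ ∀ e, S.D e → ∃ z ∈ F, ¬ S.Cons κ z e) Finset.card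
    ⟨Finset.univ.filter S.D, by simp, fun e he => by
      obtain ⟨z, hz, hze⟩ := exists_not_cons hS hκ h₀ h₁ h₂ hsum hne he
      exact ⟨z, by simp [hz], hze⟩⟩
  have hpriv : ∀ z ∈ F, ∃ e, S.D e ∧ ∀ z' ∈ F, ¬ S.Cons κ z' e → z' = z := by
    intro z hz
    by_contra hcon
    push Not at hcon
    have := hmin (F.erase z) ⟨fun z' hz' => hFD z' (Finset.mem_of_mem_erase hz'), fun e he => by
      obtain ⟨z', hz', h1, h2⟩ := hcon e he
      exact ⟨z', Finset.mem_erase.2 ⟨h2, hz'⟩, h1⟩⟩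
    have := Finset.card_erase_lt_of_mem hz
    omega
  obtain ⟨z₀', hz₀', -⟩ := hF d hd
  obtain ⟨e, he, hez⟩ := hpriv z₀' hz₀'
  -- Cutting `D` at a private edge of `z₀'` makes every other member consistent at gap 0, hence of
  -- constant sign.
  obtain ⟨m, a, idx, W, h⟩ := hS.exists_chart he
  by_cases halt : ∃ i j k, i < j ∧ j < k ∧ k < m ∧ S.Cmp (a (2 * j)) (a (2 * i)) ∧
      S.Cmp (a (2 * j)) (a (2 * k)) ∧ Chart.τ κ a W i = -Chart.τ κ a W j ∧
      Chart.τ κ a W k = -Chart.τ κ a W j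
  · obtain ⟨i, j, k, h1, h2, h3, h4, h5, h6, h7⟩ := halt
    exact h.solved_of_alternating hκ h1 h2 h3 h4 h5 h6 h7
  have hcover : Cover m F (fun z k => k < m ∧ S.Cmp z (a (2 * k))) (Chart.τ κ a W) z₀' := by
    refine ⟨fun z _ k hk => hk.1, fun z hz z' hz' k hk hk' => ?_, fun n hn => ?_, fun z hz => ?_,
      hz₀', h.circ.pos, fun z hz hne hI => ?_, fun i j k hi hj hk hij hjk h1 => ?_⟩
    · obtain ⟨e', he', h1⟩ := hpriv z hz
      obtain ⟨z'', hz'', h2⟩ := hF e' he'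
      have h3 := h1 z'' hz'' h2
      subst h3
      exact (h1 z' hz' fun h4 => h2 (h4.congr (hk'.2.trans hk.2.symm))).symm
    · obtain ⟨z, hz, h1⟩ := hF _ (h.D_a (2 * n))
      exact ⟨z, hz, (h.not_cons_iff hκ hn z).1 h1⟩
    · obtain ⟨e', he', h1⟩ := hpriv z hz
      obtain ⟨n, hn, hn'⟩ : ∃ n < m, ∀ z, S.Cons κ z (a (2 * n)) ↔ S.Cons κ z e' := by
        obtain ⟨n, hn, rfl | rfl⟩ := h.cases he'
        · exact ⟨n, hn, fun z => Iff.rfl⟩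
        · rcases Nat.lt_or_ge (n + 1) m with h2 | h2
          · refine ⟨n + 1, h2, fun z => ?_⟩
            rw [← cons_t, show 2 * (n + 1) = 2 * n + 2 by ring, h.circ.right' S.ht]
          · refine ⟨0, h.circ.pos, fun z => ?_⟩
            rw [← cons_t, h.circ.right_zero S.ht]
            rw [show 2 * m - 1 = 2 * n + 1 by omega]
      obtain ⟨z', hz', h2⟩ := hF _ (h.D_a (2 * n))
      have h3 := h1 z' hz' (by rwa [← hn'])
      subst h3
      refine ⟨n, hn, (h.not_cons_iff hκ hn _).1 h2, fun z'' hz'' h3 => h1 z'' hz'' ?_⟩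
      rw [← hn']
      exact (h.not_cons_iff hκ hn _).2 h3
    · refine hne (hez z hz ?_)
      have := (h.not_cons_iff hκ h.circ.pos z).2 hI
      rwa [mul_zero, h.circ.zero] at this
    · by_contra h2
      exact halt ⟨i, j, k, hij, hjk, hk.1, hj.2.symm.trans hi.2, hj.2.symm.trans hk.2, h1,
        units_eq_neg_of_ne h2⟩
  obtain ⟨ξ, hξm, hξ, hconst, hlight, p, q, hp, hq, hheavy⟩ := hcover.exists_potential
  obtain ⟨z, hz0, hzt, hz⟩ := h.exists_values hξm
  have hz' : ∀ x, S.D x → z x ≠ 0 ∧ |z x| ≤ 3 := fun x hx => by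
    obtain ⟨k, hk, rfl | rfl⟩ := h.cases hx
    · rw [Chart.abs_values _ (hz k hk).1, (hz k hk).1]
      exact ⟨mul_ne_zero (Units.ne_zero _) (hξ _).1, (hξ _).2⟩
    · rw [Chart.abs_values _ (hz k hk).2, (hz k hk).2]
      exact ⟨mul_ne_zero (Units.ne_zero _) (hξ _).1, (hξ _).2⟩
  refine solved_of_local hzt fun v => ?_
  -- The component of `z₀'` carries a double path, every other member of the family a unit path, and
  -- the potential is constant across the `r`-edges of `D` in all remaining components.
  by_cases hv : ∃ z ∈ F, S.Cmp v z
  · obtain ⟨z', hz'F, hvz⟩ := hv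
    by_cases h0 : z' = z₀'
    · subst h0
      refine h.localSol_of_path hκ hz0 hz hz' (w := 2) (Or.inr rfl) hp.1 hq.1 (hvz.trans hp.2)
        (hvz.trans hq.2) (fun k hk hvk => (hheavy k ⟨hk, hvz.symm.trans hvk⟩).1)
        (fun k hk hvk => ?_)
      have := (hheavy k ⟨hk, hvz.symm.trans hvk⟩).2
      omega
    · obtain ⟨p, q, hp, hq, hpq⟩ := hlight z' hz'F h0
      refine h.localSol_of_path hκ hz0 hz hz' (w := 1) (Or.inl rfl) hp.1 hq.1 (hvz.trans hp.2)
        (hvz.trans hq.2) (fun k hk hvk => ?_) (fun k hk hvk => ?_)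
      · rw [one_mul]
        exact hpq k ⟨hk, hvz.symm.trans hvk⟩
      · have := (hξ k).2
        omega
  · push Not at hv
    exact h.localSol_of_const hκ hz0 hz hz' fun k hk hvk => hconst k fun z' hz'F hk' =>
      hv z' hz'F (hvk.trans hk'.2.symm)

theorem solved_of_flow [Finite V] (hS : S.OddCircuit) {z₀ z₁ z₂ : V → ℤ}
    (h₀ : ∀ v, z₀ (S.r v) = z₀ v) (h₁ : ∀ v, z₁ (S.b v) = z₁ v)
    (h₂ : ∀ v, z₂ (S.t v) = S.s v * z₂ v) (hsum : ∀ v, z₀ v + z₁ v + z₂ v = 0)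
    (hne : ∀ v, z₂ v ≠ 0) {d : V} (hd : S.D d) (hD : ∀ v, ∃ d, S.D d ∧ S.Cmp v d) : S.Solved := by
  rcases solved_or_exists_good hS hD with h | ⟨κ, hκ⟩
  · exact h
  · exact solved_of_good hS hκ h₀ h₁ h₂ hsum hne hd

end Cfg

end SignedCubic

/-! ### Assembling the 8-flow of a coloured system. -/

namespace SignedCubic

theorem Bal.of_conn {V : Type*} {p q : V → V} {α β : V → ℤˣ} {u v : V} (h : Bal p q α β u)
    (huv : Conn p q u v) : Bal p q α β v := by
  obtain ⟨ε, hε⟩ := h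
  exact ⟨ε, fun w hw => hε w (huv.trans hw)⟩

theorem Bal.exists_partial {V : Type*} {p q : V → V} (hp : FPF p) (hq : FPF q) (α β : V → ℤˣ) :
    ∃ ε : V → ℤˣ, ∀ u, Bal p q α β u → ε (p u) = α u * ε u ∧ ε (q u) = β u * ε u := by
  classical
  let S : Setoid V := ⟨Conn p q, ⟨Conn.refl, fun h => h.symm hp hq, fun h h' => h.trans h'⟩⟩
  have hrep : ∀ v, Conn p q (Quotient.mk S v).out v := fun v => Quotient.mk_out (s := S) v
  have hl : ∀ v, Quotient.mk S (p v) = Quotient.mk S v := fun v =>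
    Quotient.sound ((Conn.left v).symm hp hq)
  have hr : ∀ v, Quotient.mk S (q v) = Quotient.mk S v := fun v =>
    Quotient.sound ((Conn.right v).symm hp hq)
  have h : ∀ v, ∃ ε : V → ℤˣ, Bal p q α β v → ∀ u, Conn p q v u →
      ε (p u) = α u * ε u ∧ ε (q u) = β u * ε u := fun v => by
    by_cases h : Bal p q α β v
    · obtain ⟨ε, hε⟩ := h
      exact ⟨ε, fun _ => hε⟩
    · exact ⟨1, fun h' => absurd h' h⟩
  choose ε hε using h
  refine ⟨fun v => ε (Quotient.mk S v).out v, fun v hv => ?_⟩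
  simp only [hl, hr]
  exact hε _ (hv.of_conn ((hrep v).symm hp hq)) v (hrep v)

namespace Sys

variable {V : Type*} {S : Sys V}

theorem bal_conn_iff {u v : V} (h : Conn (S.c 0) (S.c 2) u v) :
    Bal (S.c 0) (S.c 2) (S.s 0) (S.s 2) v ↔ Bal (S.c 0) (S.c 2) (S.s 0) (S.s 2) u :=
  ⟨fun h' => h'.of_conn (h.symm (S.fpf 0) (S.fpf 2)), fun h' => h'.of_conn h⟩

theorem Connected.hasNZ_of_par [Fintype V] (h : S.Connected) (h01 : S.par 0 + S.par 1 = 0) {k : ℤ}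
    (hk : S.HasNZ k) : S.HasNZ 8 := by
  classical
  by_contra hS
  have h02 : S.par 0 + S.par 2 ≠ 0 := fun h' => hS (h.hasNZ_of_even h01 h')
  obtain ⟨ε, hε⟩ := Bal.exists_global (S.fpf 0) (S.fpf 1) (h.bal hS (by decide) h01)
  obtain ⟨δ, hδ⟩ := Bal.exists_partial (S.fpf 0) (S.fpf 2) (S.s 0) (S.s 2)
  obtain ⟨φ, ⟨hφ, hφs⟩, hφ0⟩ := hk
  have us : ∀ a : ℤˣ, (a : ℤ) * a = 1 := fun a => by
    rw [← Units.val_mul, Int.units_mul_self, Units.val_one]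
  have hεt : ∀ v, ε v * ε v = 1 := fun v => Int.units_mul_self _
  -- Switching by `ε` removes the signs of colours 0 and 1, as all 0-1-circuits are balanced. The
  -- union `D` of unbalanced 0-2-circuits is a single circuit by `unique_unbalanced`, and nonempty
  -- because colours 0 and 2 differ in parity.
  let T : Cfg V :=
    { r := S.c 0
      b := S.c 1
      t := S.c 2
      hr := S.fpf 0
      hb := S.fpf 1
      ht := S.fpf 2
      s := fun v => S.s 2 v * (ε v * ε (S.c 2 v))
      s_t := fun v => by rw [S.sinv, (S.fpf 2).inv, mul_comm (ε (S.c 2 v))]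
      D := fun v => ¬ Bal (S.c 0) (S.c 2) (S.s 0) (S.s 2) v
      D_r := fun v => not_congr (bal_conn_iff (Conn.left v))
      D_t := fun v => not_congr (bal_conn_iff (Conn.right v))
      θ := fun v => ε v * δ v
      θ_r := fun v hv => by
        rw [(hε v).1, (hδ v (not_not.1 hv)).1, mul_mul_mul_comm, Int.units_mul_self, one_mul]
      θ_t := fun v hv => by
        rw [(hδ v (not_not.1 hv)).2]
        calc ε (S.c 2 v) * (S.s 2 v * δ v) = (ε v * ε v) * (ε (S.c 2 v) * (S.s 2 v * δ v)) := by
              rw [hεt, one_mul]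
          _ = _ := by ac_rfl }
  have hTs : ∀ v, T.s v = S.s 2 v * (ε v * ε (S.c 2 v)) := fun v => rfl
  have hT : T.OddCircuit := by
    refine ⟨fun u v hu hv => h.unique_unbalanced hS h01 hu hv, fun v hv hb => hv ?_⟩
    obtain ⟨ω, hω⟩ := hb
    refine ⟨fun v => ε v * ω v, fun u hu => ⟨?_, ?_⟩⟩
    · have := (hω u hu).1
      rw [one_mul] at this
      change ω (S.c 0 u) = ω u at this
      beta_reduce
      rw [(hε u).1, this, mul_assoc]
    · have := (hω u hu).2
      change ω (S.c 2 u) = S.s 2 u * (ε u * ε (S.c 2 u)) * ω u at this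
      beta_reduce
      rw [this]
      calc ε (S.c 2 u) * (S.s 2 u * (ε u * ε (S.c 2 u)) * ω u)
          = (ε (S.c 2 u) * ε (S.c 2 u)) * (S.s 2 u * (ε u * ω u)) := by ac_rfl
        _ = _ := by rw [hεt, one_mul]
  obtain ⟨d, hd⟩ : ∃ d, T.D d := by
    by_contra hcon
    push Not at hcon
    apply h02
    have hb : ∀ v, Bal (S.c 0) (S.c 2) (S.s 0) (S.s 2) v := fun v => not_not.1 (hcon v)
    have h1 := negs_of_balanced (S.fpf 0) (S.fpf 2) Finset.univ (fun _ _ => Finset.mem_univ _)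
      (fun _ _ => Finset.mem_univ _) (S.s 0) (S.s 2) (S.sinv 0) (S.sinv 2) δ
      (fun v _ => (hδ v (hb v)).1)
    rw [Finset.sum_eq_zero fun v _ => if_neg (not_not.2 (hδ v (hb v)).2)] at h1
    exact h1.symm
  -- A component avoiding `D` is closed under all three colours, so by connectedness it would
  -- contain `d`.
  have hD : ∀ v, ∃ d, T.D d ∧ T.Cmp v d := fun v => by
    by_contra hcon
    push Not at hcon
    have : ∀ u, T.Cmp v u := fun u => by
      have h1 := h v u
      induction h1 with
      | refl => exact Cfg.Cmp.refl v
      | @tail a b _ hab ih =>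
        obtain ⟨i, rfl⟩ := hab
        fin_cases i
        · exact ih.trans (Cfg.Cmp.r (S := T) a)
        · exact ih.trans (Cfg.Cmp.b (S := T) a)
        · exact ih.trans (Cfg.Cmp.t (S := T) fun h2 => hcon a h2 ih)
    exact hcon d hd (this d)
  obtain ⟨lam, y, lo, h1, h2, h3, h4, h5, h6, h7⟩ := Cfg.solved_of_flow hT
    (z₀ := fun v => ε v * φ 0 v) (z₁ := fun v => ε v * φ 1 v) (z₂ := fun v => ε v * φ 2 v)
    (fun v => by
      change (ε (S.c 0 v) : ℤ) * φ 0 (S.c 0 v) = _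
      rw [(hε v).1, hφ, Units.val_mul]
      linear_combination (ε v : ℤ) * φ 0 v * us (S.s 0 v))
    (fun v => by
      change (ε (S.c 1 v) : ℤ) * φ 1 (S.c 1 v) = _
      rw [(hε v).2, hφ, Units.val_mul]
      linear_combination (ε v : ℤ) * φ 1 v * us (S.s 1 v))
    (fun v => by
      rw [hTs]
      change (ε (S.c 2 v) : ℤ) * φ 2 (S.c 2 v) = _
      rw [hφ, Units.val_mul, Units.val_mul]
      linear_combination -(ε (S.c 2 v) : ℤ) * S.s 2 v * φ 2 v * us (ε v))
    (fun v => by linear_combination (ε v : ℤ) * hφs v)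
    (fun v => mul_ne_zero (Units.ne_zero _) (hφ0 2 v).1) hd hD
  apply hS
  have hodd : ∀ (u : ℤˣ) (n : ℤ), 0 ≤ n → n ≤ 7 → u * (2 * n - 7) ≠ 0 ∧ |u * (2 * n - 7)| < 8 := by
    intro u n hn hn'
    rw [abs_lt]
    rcases Int.units_eq_one_or u with h | h <;> rw [h] <;> push_cast <;> omega
  -- Twice the flow `(lam - y, -lam, y)`, shifted by the odd constant `2 * lo + 7` around each
  -- 0-1-circuit and switched back by `ε`. The windows of eight integers become the odd values from
  -- `-7` to `7`, and colour 2 gets `±2`, `±4`, `±6`.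
  refine ⟨![fun v => ε v * (2 * (lam v - y v - lo v) - 7),
    fun v => (-ε v : ℤˣ) * (2 * (lam v - lo v) - 7), fun v => ε v * (2 * y v)],
    ⟨fun i v => ?_, fun v => ?_⟩, fun i v => ?_⟩
  · fin_cases i
    · change (ε (S.c 0 v) : ℤ) * (2 * (lam (S.c 0 v) - y (S.c 0 v) - lo (S.c 0 v)) - 7)
        = S.s 0 v * (ε v * (2 * (lam v - y v - lo v) - 7))
      have h8 : lam (S.c 0 v) - y (S.c 0 v) = lam v - y v := h3 v
      have h9 : lo (S.c 0 v) = lo v := (h2 v).1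
      rw [h8, h9, (hε v).1, Units.val_mul]
      ring
    · change ((-ε (S.c 1 v) : ℤˣ) : ℤ) * (2 * (lam (S.c 1 v) - lo (S.c 1 v)) - 7)
        = S.s 1 v * ((-ε v : ℤˣ) * (2 * (lam v - lo v) - 7))
      have h8 : lam (S.c 1 v) = lam v := h1 v
      have h9 : lo (S.c 1 v) = lo v := (h2 v).2
      rw [h8, h9, (hε v).2, Units.val_neg, Units.val_neg, Units.val_mul]
      ring
    · change (ε (S.c 2 v) : ℤ) * (2 * y (S.c 2 v)) = S.s 2 v * (ε v * (2 * y v))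
      have h8 : y (S.c 2 v) = T.s v * y v := h4 v
      rw [h8, hTs, Units.val_mul, Units.val_mul]
      linear_combination 2 * (S.s 2 v : ℤ) * ε v * y v * us (ε (S.c 2 v))
  · change (ε v : ℤ) * (2 * (lam v - y v - lo v) - 7) + (-ε v : ℤˣ) * (2 * (lam v - lo v) - 7)
      + ε v * (2 * y v) = 0
    rw [Units.val_neg]
    ring
  · fin_cases i
    · exact hodd _ _ (by linarith [(h7 v).1]) (by linarith [(h7 v).2])
    · exact hodd _ _ (by linarith [(h6 v).1]) (by linarith [(h6 v).2])
    · change (ε v : ℤ) * (2 * y v) ≠ 0 ∧ |(ε v : ℤ) * (2 * y v)| < 8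
      have h8 := h5 v
      have h9 := abs_le.1 h8.2
      rw [abs_lt]
      rcases Int.units_eq_one_or (ε v) with h | h <;> rw [h] <;> push_cast <;> omega

/-- A connected signed graph with a nowhere-zero flow has one with values less than eight. -/
theorem Connected.hasNZ [Fintype V] (h : S.Connected) {k : ℤ} (hk : S.HasNZ k) : S.HasNZ 8 := by
  have hpar : ∀ i, S.par i = 0 ∨ S.par i = 2 := fun i => by
    have : ∀ x : ZMod 4, 2 * x = 0 → x = 0 ∨ x = 2 := by decide
    exact this _ (S.two_mul_par i)
  -- Pigeonhole: two of the three parities agree, and a permutation moves these colours to 0 and 1.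
  obtain ⟨e, he⟩ : ∃ e : Equiv.Perm (Fin 3), S.par (e 0) + S.par (e 1) = 0 := by
    have h00 : (0 : ZMod 4) + 0 = 0 := by decide
    have h22 : (2 : ZMod 4) + 2 = 0 := by decide
    rcases hpar 0 with h0 | h0 <;> rcases hpar 1 with h1 | h1 <;> rcases hpar 2 with h2 | h2
    · exact ⟨1, by simp [h0, h1]⟩
    · exact ⟨1, by simp [h0, h1]⟩
    · exact ⟨Equiv.swap 1 2, by simp [Equiv.swap_apply_of_ne_of_ne, h0, h2]⟩
    · exact ⟨Equiv.swap 0 2, by simp [Equiv.swap_apply_of_ne_of_ne, h1, h2, h22]⟩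
    · exact ⟨Equiv.swap 0 2, by simp [Equiv.swap_apply_of_ne_of_ne, h1, h2]⟩
    · exact ⟨Equiv.swap 1 2, by simp [Equiv.swap_apply_of_ne_of_ne, h0, h2, h22]⟩
    · exact ⟨1, by simp [h0, h1, h22]⟩
    · exact ⟨1, by simp [h0, h1, h22]⟩
  refine HasNZ.of_recolor (ρ := fun _ => e) (hρ := fun _ _ => rfl)
    (Connected.hasNZ_of_par (h.recolor _ _) he (k := k) ?_)
  obtain ⟨φ, ⟨h1, h2⟩, h3⟩ := hk
  refine ⟨fun i v => φ (e i) v, ⟨fun i v => h1 _ v, fun v => ?_⟩, fun i v => h3 _ v⟩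
  have := Equiv.sum_comp e (fun i => φ i v)
  rw [Fin.sum_univ_three, Fin.sum_univ_three, h2 v] at this
  exact this

/-- A signed graph with a nowhere-zero flow has one with values less than eight. -/
theorem HasNZ.eight [Fintype V] {k : ℤ} (hk : S.HasNZ k) : S.HasNZ 8 := by
  classical
  obtain ⟨φ, ⟨h1, h2⟩, h3⟩ := hk
  let R : V → V → Prop := Relation.ReflTransGen fun a b => ∃ i, b = S.c i a
  have hR : ∀ i v, R v (S.c i v) := fun i v => Relation.ReflTransGen.single ⟨i, rfl⟩
  have hR' : ∀ i v, R (S.c i v) v := fun i v => by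
    have := hR i (S.c i v)
    rwa [(S.fpf i).inv] at this
  have hsymm : ∀ {u v}, R u v → R v u := fun {u v} h => by
    induction h with
    | refl => exact Relation.ReflTransGen.refl
    | tail _ h ih =>
      obtain ⟨i, rfl⟩ := h
      exact Relation.ReflTransGen.trans (hR' i _) ih
  let T : Setoid V := ⟨R, ⟨fun _ => Relation.ReflTransGen.refl, hsymm, Relation.ReflTransGen.trans⟩⟩
  have hq : ∀ i v, Quotient.mk T (S.c i v) = Quotient.mk T v := fun i v =>
    Quotient.sound (s := T) (hR' i v)
  have key : ∀ q : Quotient T, ∃ ψ : Fin 3 → V → ℤ, ∀ v, Quotient.mk T v = q →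
      (∀ i, ψ i (S.c i v) = S.s i v * ψ i v) ∧ ψ 0 v + ψ 1 v + ψ 2 v = 0 ∧
      ∀ i, ψ i v ≠ 0 ∧ |ψ i v| < 8 := by
    intro q
    let S' : Sys {v : V // Quotient.mk T v = q} :=
      { c := fun i v => ⟨S.c i v, by rw [hq, v.2]⟩
        s := fun i v => S.s i v
        fpf := fun i => ⟨fun v => Subtype.ext ((S.fpf i).inv v),
          fun v h => (S.fpf i).ne v (congrArg Subtype.val h)⟩
        sinv := fun i v => S.sinv i v }
    have hc : S'.Connected := by
      rintro ⟨u, hu⟩ ⟨v, hv⟩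
      have huv : R u v := Quotient.exact (s := T) (hu.trans hv.symm)
      induction huv with
      | refl => exact Relation.ReflTransGen.refl
      | @tail a b _ hab ih =>
        obtain ⟨i, rfl⟩ := hab
        have ha : Quotient.mk T a = q := by rw [← hq i, hv]
        exact (ih ha).tail ⟨i, rfl⟩
    obtain ⟨ψ, ⟨g1, g2⟩, g3⟩ := hc.hasNZ (k := k)
      ⟨fun i v => φ i v, ⟨fun i v => h1 i v, fun v => h2 v⟩, fun i v => h3 i v⟩
    refine ⟨fun i v => if hv : Quotient.mk T v = q then ψ i ⟨v, hv⟩ else 0, fun v hv =>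
      ⟨fun i => ?_, ?_, fun i => ?_⟩⟩
    · have hv' : Quotient.mk T (S.c i v) = q := by rw [hq, hv]
      simp only [dif_pos hv, dif_pos hv']
      exact g1 i ⟨v, hv⟩
    · simp only [dif_pos hv]
      exact g2 ⟨v, hv⟩
    · simp only [dif_pos hv]
      exact g3 i ⟨v, hv⟩
  choose ψ hψ using key
  refine ⟨fun i v => ψ (Quotient.mk T v) i v, ⟨fun i v => ?_, fun v => ?_⟩, fun i v => ?_⟩
  · simp only [hq]
    exact (hψ _ v rfl).1 i
  · exact (hψ _ v rfl).2.1
  · exact (hψ _ v rfl).2.2 i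

end Sys

end SignedCubic

/-! ### Translation between signed cubic graphs and coloured systems. -/

namespace SignedCubic

/-- The sign of an integer, with value `1` at `0`. -/
def sgn (n : ℤ) : ℤˣ := if 0 ≤ n then 1 else -1

theorem sgn_mul_abs (n : ℤ) : (sgn n : ℤ) * |n| = n := by
  unfold sgn
  split_ifs with h
  · rw [abs_of_nonneg h]; simp
  · rw [abs_of_neg (not_le.1 h)]; simp

theorem sgn_units_mul (u : ℤˣ) {n : ℤ} (hn : n ≠ 0) : sgn (u * n) = u * sgn n := by
  unfold sgn
  rcases Int.units_eq_one_or u with rfl | rfl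
  · simp
  · by_cases h : 0 ≤ n
    · have : ¬ (0 ≤ (((-1 : ℤˣ) : ℤ)) * n) := by push_cast; omega
      rw [if_neg this, if_pos h, mul_one]
    · have : 0 ≤ (((-1 : ℤˣ) : ℤ)) * n := by push_cast; omega
      rw [if_pos this, if_neg h]
      decide

theorem abs_units_mul (u : ℤˣ) (n : ℤ) : |(u : ℤ) * n| = |n| := by
  rcases Int.units_eq_one_or u with h | h <;> simp [h]

section Translation

variable {α β : Type*} {G : Graph α β}

/-- In a properly coloured cubic graph, each vertex has exactly one half-edge of each colour. -/
theorem exists_halfEdge (hcubic : G.IsCubic) {c : G.edgeSet → Fin 3}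
    (hc : ∀ h h' : G.HalfEdge, h ≠ h' → h.vertex = h'.vertex → c h.edge ≠ c h'.edge) :
    ∃ H : G.vertexSet → Fin 3 → G.HalfEdge, (∀ x i, (H x i).vertex = x) ∧
      (∀ x i, c (H x i).edge = i) ∧
      ∀ (h : G.HalfEdge) (x : G.vertexSet), h.vertex = x → h = H x (c h.edge) := by
  have huniq : ∀ h h' : G.HalfEdge, h.vertex = h'.vertex → c h.edge = c h'.edge → h = h' :=
    fun h h' h1 h2 => by
      by_contra hne
      exact hc h h' hne h1 h2
  have hex : ∀ (x : G.vertexSet) (i : Fin 3), ∃ h : G.HalfEdge, h.vertex = x ∧ c h.edge = i := by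
    intro x i
    let f : G.halfEdgesAt x → Fin 3 := fun h => c h.1.edge
    have hf : Function.Injective f := fun h h' heq =>
      Subtype.ext (huniq _ _ (h.2.trans h'.2.symm) heq)
    have hbij := hf.bijective_of_nat_card_le (by
      rw [Nat.card_coe_set_eq, hcubic x x.2, Nat.card_eq_fintype_card, Fintype.card_fin])
    obtain ⟨h, hh⟩ := hbij.2 i
    exact ⟨h.1, h.2, hh⟩
  choose H hH using hex
  exact ⟨H, fun x i => (hH x i).1, fun x i => (hH x i).2, fun h x hx =>
    huniq _ _ (hx.trans (hH x _).1.symm) (hH x _).2.symm⟩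

/-- The other end of an edge. -/
theorem exists_other {c : G.edgeSet → Fin 3}
    (hc : ∀ h h' : G.HalfEdge, h ≠ h' → h.vertex = h'.vertex → c h.edge ≠ c h'.edge)
    (h : G.HalfEdge) : ∃ h' : G.HalfEdge, h'.edge = h.edge ∧ h'.vertex ≠ h.vertex ∧
      ∀ h'' : G.HalfEdge, h''.edge = h.edge → h'' = h ∨ h'' = h' := by
  have huniq : ∀ h h' : G.HalfEdge, h.vertex = h'.vertex → h.edge = h'.edge → h = h' :=
    fun h h' h1 h2 => by
      by_contra hne
      exact hc h h' hne h1 (congrArg c h2)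
  have hedge : ∀ {h h' : G.HalfEdge}, h.1.1 = h'.1.1 → h.edge = h'.edge := fun h => Subtype.ext h
  obtain ⟨y, hy⟩ := h.2.1
  let h' : G.HalfEdge := ⟨(h.1.1, y, false), hy.inc_right, fun h => Bool.noConfusion h⟩
  have he : h'.edge = h.edge := hedge rfl
  have hne : h'.vertex ≠ h.vertex := by
    intro heq
    have heq' : y = h.1.2.1 := heq
    have hloop : G.IsLoopAt h.1.1 h.1.2.1 := by
      rw [heq'] at hy
      exact hy
    -- A loop would supply two distinct half-edges of the same edge, hence of the same colour, at
    -- one vertex.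
    let k : Bool → G.HalfEdge := fun b => ⟨(h.1.1, h.1.2.1, b), h.2.1, fun _ => hloop⟩
    have h1 : k false = k true := huniq _ _ rfl (hedge rfl)
    have h2 := congrArg (fun h : G.HalfEdge => h.1.2.2) h1
    exact Bool.noConfusion h2
  refine ⟨h', he, hne, fun h'' h1 => ?_⟩
  have h2 : h''.1.1 = h.1.1 := congrArg Subtype.val h1
  have h3 : G.Inc h.1.1 h''.1.2.1 := h2 ▸ h''.2.1
  rcases h3.eq_or_eq_of_isLink hy with h4 | h4
  · exact Or.inl (huniq _ _ h4 h1)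
  · exact Or.inr (huniq _ _ h4 (h1.trans he.symm))

/-- Flows of a properly coloured cubic graph correspond to flows of the system of its colours. -/
theorem exists_sys (hcubic : G.IsCubic) (hcol : G.EdgeColorable 3) (σ : G.edgeSet → ℤˣ) :
    ∃ S : Sys G.vertexSet, ∀ k : ℕ, 2 ≤ k → (S.HasNZ k ↔ G.HasNowhereZeroFlow σ k) := by
  classical
  obtain ⟨c, hc⟩ := hcol
  obtain ⟨H, hHv, hHc, hH⟩ := exists_halfEdge hcubic hc
  have hHe : ∀ h : G.HalfEdge, ∃ x i, h = H x i := fun h =>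
    ⟨⟨h.vertex, h.2.1.vertex_mem⟩, c h.edge, hH h ⟨h.vertex, h.2.1.vertex_mem⟩ rfl⟩
  have hHinj : ∀ {x i y j}, H x i = H y j → x = y ∧ i = j := fun {x i y j} h => by
    refine ⟨Subtype.ext ?_, ?_⟩
    · rw [← hHv x i, ← hHv y j, h]
    · rw [← hHc x i, ← hHc y j, h]
  have hother : ∀ i x, ∃ y, (H y i).edge = (H x i).edge ∧ y ≠ x ∧
      ∀ h : G.HalfEdge, h.edge = (H x i).edge → h = H x i ∨ h = H y i := fun i x => by
    obtain ⟨h', h1, h2, h3⟩ := exists_other hc (H x i)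
    obtain ⟨y, j, rfl⟩ := hHe h'
    have hij : j = i := by rw [← hHc y j, h1, hHc]
    subst hij
    refine ⟨y, h1, fun h => h2 (by rw [h]), h3⟩
  choose o ho1 ho2 ho3 using hother
  let S : Sys G.vertexSet :=
    { c := o
      s := fun i x => -σ (H x i).edge
      fpf := fun i => ⟨fun x => by
        rcases ho3 i x (H (o i (o i x)) i) ((ho1 i _).trans (ho1 i x)) with h | h
        · exact (hHinj h).1
        · exact absurd (hHinj h).1 (ho2 i (o i x)), ho2 i⟩
      sinv := fun i x => by rw [ho1] }
  have hsum : ∀ (τ : G.HalfEdge → ℤˣ) (f : G.edgeSet → ℤ) (x : G.vertexSet),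
      ∑ᶠ h ∈ G.halfEdgesAt x, (τ h : ℤ) * f h.edge
        = τ (H x 0) * f (H x 0).edge + τ (H x 1) * f (H x 1).edge + τ (H x 2) * f (H x 2).edge := by
    intro τ f x
    have hrange : G.halfEdgesAt x = Set.range (H x) := Set.ext fun h =>
      ⟨fun hx => ⟨_, (hH h x hx).symm⟩, by rintro ⟨i, rfl⟩; exact hHv x i⟩
    rw [hrange, finsum_mem_range (fun i j h => (hHinj h).2), finsum_eq_sum_of_fintype,
      Fin.sum_univ_three]
  refine ⟨S, fun k hk => ⟨?_, ?_⟩⟩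
  · rintro ⟨φ, ⟨h1, h2⟩, h3⟩
    have habs : ∀ x y i, (H x i).edge = (H y i).edge → |φ i x| = |φ i y| := fun x y i h => by
      rcases ho3 i y _ h with h' | h'
      · rw [(hHinj h').1]
      · rw [(hHinj h').1, show φ i (o i y) = S.s i y * φ i y from h1 i y, abs_units_mul]
    have hend : ∀ e : G.edgeSet, ∃ x, (H x (c e)).edge = e := fun e => by
      obtain ⟨x, y, hxy⟩ := G.exists_isLink_of_mem_edgeSet e.2
      let h : G.HalfEdge := ⟨(e.1, x, false), hxy.inc_left, fun h => Bool.noConfusion h⟩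
      have he : h.edge = e := rfl
      obtain ⟨x, i, hxi⟩ := hHe h
      have hi : i = c e := by rw [← hHc x i, ← hxi, he]
      exact ⟨x, by rw [← hi, ← hxi, he]⟩
    choose v hv using hend
    -- The sign of the outgoing value orients the half-edge and its absolute value is the flow on
    -- the edge. Nonvanishing of `φ` makes the signs at the two ends multiply to `-σ`.
    let τ : G.HalfEdge → ℤˣ := fun h => sgn (φ (c h.edge) ⟨h.vertex, h.2.1.vertex_mem⟩)
    have hτ : ∀ x i, τ (H x i) = sgn (φ i x) := fun x i => by
      simp only [τ, hHc]
      congr 2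
      exact Subtype.ext (hHv x i)
    let f : G.edgeSet → ℤ := fun e => |φ (c e) (v e)|
    have hf : ∀ x i, f (H x i).edge = |φ i x| := fun x i => by
      simp only [f, hHc]
      refine habs _ _ _ ?_
      have := hv (H x i).edge
      rwa [hHc] at this
    refine ⟨hk, τ, f, fun h h' hne he => ?_, fun x hx => ?_, fun e => ?_, fun e => ?_⟩
    · obtain ⟨x, i, rfl⟩ := hHe h
      rcases ho3 i x h' he.symm with rfl | rfl
      · exact absurd rfl hne
      · rw [hτ, hτ, show φ i (o i x) = S.s i x * φ i x from h1 i x, sgn_units_mul _ (h3 i x).1,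
          mul_left_comm, Int.units_mul_self, mul_one]
    · rw [hsum τ f ⟨x, hx⟩, hτ, hτ, hτ, hf, hf, hf, sgn_mul_abs, sgn_mul_abs, sgn_mul_abs, h2]
    · exact abs_ne_zero.2 (h3 _ _).1
    · simp only [f, abs_abs]
      exact (h3 _ _).2
  · rintro ⟨-, τ, f, h1, h2, h3, h4⟩
    refine ⟨fun i x => τ (H x i) * f (H x i).edge, ⟨fun i x => ?_, fun x => ?_⟩, fun i x => ⟨?_, ?_⟩⟩
    · change (τ (H (o i x) i) : ℤ) * f (H (o i x) i).edge
        = ((-σ (H x i).edge : ℤˣ) : ℤ) * (τ (H x i) * f (H x i).edge)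
      have h5 := h1 (H x i) (H (o i x) i) (fun h => ho2 i x (hHinj h).1.symm) (ho1 i x).symm
      rw [ho1, ← h5, Units.val_mul]
      have h6 : (τ (H x i) : ℤ) * τ (H x i) = 1 := by
        rw [← Units.val_mul, Int.units_mul_self, Units.val_one]
      linear_combination -(τ (H (o i x) i) : ℤ) * f (H x i).edge * h6
    · rw [← hsum τ f x]
      exact h2 x x.2
    · exact mul_ne_zero (Units.ne_zero _) (h3 _)
    · rw [abs_units_mul]
      exact h4 _

end Translation

end SignedCubic

theorem theorem4p1 {α : Type*} {β : Type*} (G : Graph α β)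
    (hV : G.vertexSet.Finite) (hE : G.edgeSet.Finite)
    (hcubic : G.IsCubic) (hcol : G.EdgeColorable 3)
    (σ : G.edgeSet → ℤˣ) (hadm : G.FlowAdmissible σ) :
    G.HasNowhereZeroFlow σ 8 := by
  have := hV.fintype
  obtain ⟨S, hS⟩ := SignedCubic.exists_sys hcubic hcol σ
  obtain ⟨k, hk⟩ := hadm
  exact (hS 8 (by norm_num)).1 (((hS k hk.1).2 hk).eight)
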